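/- **Definitions.** Let $v:F\to\Gamma\cup\{\infty\}$ be a valuation on a field $F$, with values in a totally ordered abelian group $\Gamma$ and valuation ring $V$, and let $A$ be a finite-dimensional $F$-algebra. A *surmultiplicative $v$-value function* on $A$ is a map $\alpha:A\to\Gamma\cup\{\infty\}$ with $\alpha(a)=\infty\iff a=0$, $\alpha(a+b)\ge\min(\alpha(a),\alpha(b))$, $\alpha(ca)=v(c)+\alpha(a)$ for $c\in F$, $\alpha(1)=0$ and $\alpha(ab)\ge\alpha(a)+\alpha(b)$. Put $\Gamma_\alpha=\alpha(A\setminus\{0\})$, $R_\alpha=\{a:\alpha(a)\ge0\}$, $J_\alpha=\{a:\alpha(a)>0\}$, $A_0=R_\alpha/J_\alpha$, and $\mathrm{gr}_\alpha(A)=\bigoplus_{g\in\Gamma}A_{\ge g}/A_{>g}$, where $A_{\ge g}=\{a:\alpha(a)\ge g\}$ and $A_{>g}=\{a:\alpha(a)>g\}$. Then $\alpha$ is a *$v$-gauge*, and $R_\alpha$ is its *gauge ring*, if $A$ has an $F$-base $(a_i)$ with $\alpha(\sum c_ia_i)=\min_i(v(c_i)+\alpha(a_i))$ for all $c_i\in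 F$, and $\mathrm{gr}_\alpha(A)$ has no nonzero homogeneous nilpotent two-sided ideal. In that case $\omega(\alpha)$ is the number of simple components of the semisimple ring $A_0$. Gauges $\alpha,\alpha'$ on $A$ are *isomorphic* if $\alpha'\circ\eta=\alpha$ for some $F$-algebra automorphism $\eta$ of $A$. A *Morandi value function* is a surmultiplicative $v$-value function $\alpha$ with $A_0$ simple and $\Gamma_\alpha=\alpha(\{a\in A^\times:\alpha(a^{-1})=-\alpha(a)\})$. Let $A$ be central simple over $F$. A subring $B$ of $A$ is a *Dubrovin valuation ring* if it has an ideal $J$ with $B/J$ simple Artinian such that for each $s\in A\setminus B$ there are $b,c\in B$ with $bs,sc\in B\setminus J$. Such rings $B_1,\dots,B_n$ have the *Intersection Property* if, for $R=\bigcap_i B_i$, the map $S\mapsto J(S)\cap R$ ($J(S)$ the Jacobson radical) is a well-defined order-reversing bijection from the set of all overrings in $A$ of the $B_i$ to the set of prime ideals of $R$. A *Gräter ring* is such an $R$ with the $B_i$ pairwise incomparable that is integral over its center. The *extension number* $\xi_{V,[A]}$ is the number $n$ of the $B_i$ in a Gräter ring of $A$ with center $V$ (it does not depend on the choices). A $v$-gauge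 $\alpha$ on $A$ is *minimal* if $\omega(\alpha)=\xi_{V,[A]}$. A subring $B$ of $A$ is a *total valuation ring* if $d\in B$ or $d^{-1}\in B$ for each $d\in A^\times$. **Setting.** Let $L$ be a field with $\mathrm{char}\,L\ne2$, and let $F=L(x)((y))$, with $y$-adic valuation $w$ and valuation ring $W=L(x)[[y]]$. Order $\mathbb Q\times\mathbb Q$ right-to-left lexicographically. Let $v:F\to(\mathbb Q\times\mathbb Q)\cup\{\infty\}$ be the rank-2 valuation that is the composite of $w$ with the $x$-adic valuation of $L(x)$, so that $v(f)=(\ell,m)$ if the lowest term of $f$ is $c\,y^m$ and $c\in L(x)$ has $x$-adic order $\ell$; let $V$ be its valuation ring. Let $D=(1+x,\,y/F)$ be the quaternion algebra with $i^2=1+x$, $j^2=y$, $k=ij=-ji$. **Statement.** 1. $D$ is a division algebra, and $v$ extends to a valuation $v'$ on $K=F(t)$, $t^2=1+x$, with $v'(t-1)>0$. For each rational $\gamma$ with $0<\gamma<\frac12$, with $\delta=(\gamma,\frac12)$, the function $$\alpha_\gamma(a+bi+cj+dk)=\min\bigl(v'(a+bt),\;v'((c+dt)y)-\delta,\;v'(c-dt)+\delta,\;v'(a-bt)\bigr)\qquad(a,b,c,d\in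 F)$$ is a minimal $v$-gauge on $D$, with $\omega(\alpha_\gamma)=\xi_{V,[D]}=2$ and $\Gamma_{\alpha_\gamma}=\mathbb Z^2\cup(\delta+\mathbb Z^2)\cup(-\delta+\mathbb Z^2)$. 2. For $\gamma\ne\gamma'$ the gauges $\alpha_\gamma$ and $\alpha_{\gamma'}$ are not isomorphic. 3. There are exactly two Dubrovin valuation rings $B_1\neq B_2$ of $D$ with center $V$. Both are total valuation rings, and for every $\gamma$ $$R_{\alpha_\gamma}=B_1\cap B_2=\{a+bi+cj+dk: a,b\in V,\ c,d\in W\}.$$ Hence a minimal gauge is not determined by its gauge ring, even up to isomorphism. 4. By contrast, Morandi value functions are determined by their rings: if $v$ is a valuation on any field $E$, $A$ is a central simple $E$-algebra, finite-dimensional over $E$, and $\alpha,\beta$ are surmultiplicative $v$-value functions on $A$ that are Morandi value functions with $R_\alpha=R_\beta$, then $\alpha=\beta$. -/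

import Mathlib

open scoped DirectSum Quaternion

universe u₁ u₂ u₃ u₄

section ValueFunctions

variable {Γ : Type u₁} [AddCommGroup Γ] [LinearOrder Γ] [IsOrderedAddMonoid Γ]
  {F : Type u₂} [Field F]

/-- The valuation ring `V = {x ∈ F | v x ≥ 0}` of a valuation `v : F → Γ ∪ {∞}`. -/
def valRing (v : AddValuation F (WithTop Γ)) : Subring F where
  carrier := {x | 0 ≤ v x}
  mul_mem' {a b} ha hb := by
    have h : (0 : WithTop Γ) ≤ v a + v b := add_nonneg ha hb
    simpa using h
  one_mem' := by simp
  add_mem' {a b} ha hb := v.map_le_add ha hb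
  zero_mem' := by simp
  neg_mem' {a} ha := by simpa using ha

/-- A surmultiplicative `v`-value function on an `F`-algebra `A`. -/
structure SurmultValueFunction (v : AddValuation F (WithTop Γ))
    (A : Type u₃) [Ring A] [Algebra F A] where
  toFun : A → WithTop Γ
  eq_top_iff' : ∀ x, toFun x = ⊤ ↔ x = 0
  min_le_add' : ∀ x y, min (toFun x) (toFun y) ≤ toFun (x + y)
  map_smul' : ∀ (c : F) (x : A), toFun (c • x) = v c + toFun x
  map_one' : toFun 1 = 0
  add_le_mul' : ∀ x y, toFun x + toFun y ≤ toFun (x * y)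

namespace SurmultValueFunction

variable {v : AddValuation F (WithTop Γ)} {A : Type u₃} [Ring A] [Algebra F A]

instance : CoeFun (SurmultValueFunction v A) (fun _ => A → WithTop Γ) := ⟨toFun⟩

variable (α : SurmultValueFunction v A)

theorem map_zero : α 0 = ⊤ := (α.eq_top_iff' 0).2 rfl

theorem map_neg (x : A) : α (-x) = α x := by
  have h := α.map_smul' (-1) x
  simpa using h

theorem le_add {g : WithTop Γ} {x y : A} (hx : g ≤ α x) (hy : g ≤ α y) : g ≤ α (x + y) :=
  (le_min hx hy).trans (α.min_le_add' x y)

theorem lt_add {g : WithTop Γ} {x y : A} (hx : g < α x) (hy : g < α y) : g < α (x + y) :=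
  (lt_min hx hy).trans_le (α.min_le_add' x y)

/-- The value set `Γ_α = α(A \ {0})`. -/
def valueSet : Set Γ := {g | ∃ x : A, α x = (g : WithTop Γ)}

/-- `A_{≥ g}` -/
def geGroup (g : Γ) : AddSubgroup A where
  carrier := {x | (g : WithTop Γ) ≤ α x}
  add_mem' hx hy := α.le_add hx hy
  zero_mem' := by simp [α.map_zero]
  neg_mem' {x} hx := by simpa [α.map_neg] using hx

/-- `A_{> g}` -/
def gtGroup (g : Γ) : AddSubgroup A where
  carrier := {x | (g : WithTop Γ) < α x}
  add_mem' hx hy := α.lt_add hx hy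
  zero_mem' := by simp [α.map_zero]
  neg_mem' {x} hx := by simpa [α.map_neg] using hx

theorem mul_mem_ge {g h : Γ} {x y : A} (hx : x ∈ α.geGroup g) (hy : y ∈ α.geGroup h) :
    x * y ∈ α.geGroup (g + h) := by
  have hx' : (g : WithTop Γ) ≤ α x := hx
  have hy' : (h : WithTop Γ) ≤ α y := hy
  have : (g : WithTop Γ) + h ≤ α (x * y) := (add_le_add hx' hy').trans (α.add_le_mul' x y)
  simpa [geGroup] using this

theorem mul_mem_gt_left {g h : Γ} {x y : A} (hx : x ∈ α.gtGroup g) (hy : y ∈ α.geGroup h) :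
    x * y ∈ α.gtGroup (g + h) := by
  have hx' : (g : WithTop Γ) < α x := hx
  have hy' : (h : WithTop Γ) ≤ α y := hy
  have h1 : (g : WithTop Γ) + h < α x + h := WithTop.add_lt_add_right (by simp) hx'
  have : (g : WithTop Γ) + h < α (x * y) :=
    (h1.trans_le (add_le_add le_rfl hy')).trans_le (α.add_le_mul' x y)
  simpa [gtGroup] using this

theorem mul_mem_gt_right {g h : Γ} {x y : A} (hx : x ∈ α.geGroup g) (hy : y ∈ α.gtGroup h) :
    x * y ∈ α.gtGroup (g + h) := by
  have hx' : (g : WithTop Γ) ≤ α x := hx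
  have hy' : (h : WithTop Γ) < α y := hy
  have h1 : (g : WithTop Γ) + h < g + α y := WithTop.add_lt_add_left (by simp) hy'
  have : (g : WithTop Γ) + h < α (x * y) :=
    (h1.trans_le (add_le_add hx' le_rfl)).trans_le (α.add_le_mul' x y)
  simpa [gtGroup] using this

theorem one_mem_ge : (1 : A) ∈ α.geGroup 0 := by simp [geGroup, α.map_one']

/-- The homogeneous component `A_g = A_{≥ g} / A_{> g}`. -/
abbrev grPiece (g : Γ) : Type u₃ := α.geGroup g ⧸ (α.gtGroup g).addSubgroupOf (α.geGroup g)

variable {α}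

/-- The class in `A_g` of an element of `A_{≥ g}`. -/
def grMk {g : Γ} (x : A) (hx : x ∈ α.geGroup g) : α.grPiece g :=
  QuotientAddGroup.mk (⟨x, hx⟩ : α.geGroup g)

theorem grMk_eq {g : Γ} {x y : A} (hx : x ∈ α.geGroup g) (hy : y ∈ α.geGroup g) :
    grMk x hx = grMk y hy ↔ -x + y ∈ α.gtGroup g := by
  unfold grMk
  rw [QuotientAddGroup.eq, AddSubgroup.mem_addSubgroupOf]
  rfl

theorem grMk_surj {g : Γ} (z : α.grPiece g) : ∃ x hx, z = grMk (g := g) x hx := by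
  obtain ⟨⟨x, hx⟩, rfl⟩ := QuotientAddGroup.mk_surjective z
  exact ⟨x, hx, rfl⟩

theorem grMk_add {g : Γ} {x y : A} (hx : x ∈ α.geGroup g) (hy : y ∈ α.geGroup g) :
    grMk x hx + grMk y hy = grMk (x + y) (add_mem hx hy) := rfl

theorem grMk_zero {g : Γ} : (0 : α.grPiece g) = grMk 0 (zero_mem _) := rfl

/-- The multiplication `A_g × A_h → A_{g + h}` induced by that of `A`. -/
def grMul {g h : Γ} : α.grPiece g → α.grPiece h → α.grPiece (g + h) :=
  Quotient.map₂ (fun x y => (⟨x.1 * y.1, α.mul_mem_ge x.2 y.2⟩ : α.geGroup (g + h))) (by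
    intro x x' hx y y' hy
    replace hx := (QuotientAddGroup.leftRel_apply).1 hx
    replace hy := (QuotientAddGroup.leftRel_apply).1 hy
    refine (QuotientAddGroup.leftRel_apply).2 ?_
    rw [AddSubgroup.mem_addSubgroupOf] at hx hy ⊢
    have e : (-(x.1 * y.1) + x'.1 * y'.1 : A)
        = (-x.1 + x'.1) * y.1 + x'.1 * (-y.1 + y'.1) := by noncomm_ring
    change (-(x.1 * y.1) + x'.1 * y'.1 : A) ∈ _
    rw [e]
    exact add_mem (α.mul_mem_gt_left hx y.2) (α.mul_mem_gt_right x'.2 hy))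

theorem grMul_mk {g h : Γ} {x y : A} (hx : x ∈ α.geGroup g) (hy : y ∈ α.geGroup h) :
    grMul (grMk x hx) (grMk y hy) = grMk (x * y) (α.mul_mem_ge hx hy) := rfl

theorem grMk_sigma {g h : Γ} {x y : A} (hgh : g = h) (hxy : x = y)
    (hx : x ∈ α.geGroup g) (hy : y ∈ α.geGroup h) :
    (⟨g, grMk x hx⟩ : GradedMonoid α.grPiece) = ⟨h, grMk y hy⟩ := by
  subst hgh hxy; rfl

variable (α)

instance grOne : GradedMonoid.GOne α.grPiece where
  one := grMk 1 α.one_mem_ge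

instance grGMul : GradedMonoid.GMul α.grPiece where
  mul := grMul

instance grGMonoid : GradedMonoid.GMonoid α.grPiece where
  one_mul := by
    rintro ⟨g, a⟩
    obtain ⟨x, hx, rfl⟩ := grMk_surj a
    exact grMk_sigma (zero_add g) (one_mul x) _ _
  mul_one := by
    rintro ⟨g, a⟩
    obtain ⟨x, hx, rfl⟩ := grMk_surj a
    exact grMk_sigma (add_zero g) (mul_one x) _ _
  mul_assoc := by
    rintro ⟨g, a⟩ ⟨h, b⟩ ⟨k, c⟩
    obtain ⟨x, hx, rfl⟩ := grMk_surj a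
    obtain ⟨y, hy, rfl⟩ := grMk_surj b
    obtain ⟨z, hz, rfl⟩ := grMk_surj c
    exact grMk_sigma (add_assoc g h k) (mul_assoc x y z) _ _

instance grGRing : DirectSum.GRing α.grPiece where
  mul_zero {g h} a := by
    obtain ⟨x, hx, rfl⟩ := grMk_surj a
    change grMul _ _ = _
    rw [grMk_zero, grMul_mk]; simp only [mul_zero]; rfl
  zero_mul {g h} a := by
    obtain ⟨x, hx, rfl⟩ := grMk_surj a
    change grMul _ _ = _
    rw [grMk_zero, grMul_mk]; simp only [zero_mul]; rfl
  mul_add {g h} a b c := by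
    obtain ⟨x, hx, rfl⟩ := grMk_surj a
    obtain ⟨y, hy, rfl⟩ := grMk_surj b
    obtain ⟨z, hz, rfl⟩ := grMk_surj c
    change grMul _ _ = grMul _ _ + grMul _ _
    simp only [grMk_add, grMul_mk, mul_add]
  add_mul {g h} a b c := by
    obtain ⟨x, hx, rfl⟩ := grMk_surj a
    obtain ⟨y, hy, rfl⟩ := grMk_surj b
    obtain ⟨z, hz, rfl⟩ := grMk_surj c
    change grMul _ _ = grMul _ _ + grMul _ _
    simp only [grMk_add, grMul_mk, add_mul]
  natCast n := n • grMk 1 α.one_mem_ge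
  natCast_zero := zero_nsmul _
  natCast_succ n := succ_nsmul _ n
  intCast n := n • grMk 1 α.one_mem_ge
  intCast_ofNat n := natCast_zsmul _ n
  intCast_negSucc_ofNat n := negSucc_zsmul _ n

/-- The associated graded ring `gr_α(A) = ⨁ g, A_g`. -/
abbrev gr : Type (max u₁ u₃) := ⨁ g, α.grPiece g

noncomputable instance : Ring α.gr := DirectSum.ring _

/-- A two-sided ideal of `gr_α(A)` is homogeneous if it contains the homogeneous components of
its elements. -/
def IsHomogeneousIdeal (I : TwoSidedIdeal α.gr) : Prop :=
  ∀ z ∈ I, ∀ g : Γ, DirectSum.of α.grPiece g (z g) ∈ I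

/-- A two-sided ideal is nilpotent if for some `n` all products of `n` of its elements vanish. -/
def IsNilpotentIdeal {R : Type*} [Ring R] (I : TwoSidedIdeal R) : Prop :=
  ∃ n : ℕ, ∀ l : List R, l.length = n → (∀ z ∈ l, z ∈ I) → l.prod = 0

/-- `gr_α(A)` is graded semisimple: it has no nonzero homogeneous nilpotent ideal. -/
def IsGradedSemisimple : Prop :=
  ∀ I : TwoSidedIdeal α.gr, α.IsHomogeneousIdeal I → IsNilpotentIdeal I → I = ⊥

/-- `α` is a `v`-norm: `A` has a finite base that splits `α`. -/
def IsNorm : Prop :=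
  ∃ (n : ℕ) (b : Module.Basis (Fin n) F A), ∀ c : Fin n → F,
    α (∑ i, c i • b i) = Finset.univ.inf fun i => v (c i) + α (b i)

/-- `α` is a `v`-gauge. -/
structure IsGauge : Prop where
  isNorm : α.IsNorm
  isGradedSemisimple : α.IsGradedSemisimple

/-- The ring `R_α = {x | α x ≥ 0}`; it is the gauge ring of `α` if `α` is a gauge. -/
def gaugeRing : Subring A where
  carrier := {x | 0 ≤ α x}
  mul_mem' {x y} hx hy := by
    have h : (0 : WithTop Γ) ≤ α x + α y := add_nonneg hx hy
    exact h.trans (α.add_le_mul' x y)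
  one_mem' := by simp [α.map_one']
  add_mem' hx hy := α.le_add hx hy
  zero_mem' := by simp [α.map_zero]
  neg_mem' {x} hx := by simpa [α.map_neg] using hx

/-- The ideal `J_α = {x | α x > 0}` of `R_α`. -/
def gaugeIdeal : Ideal α.gaugeRing where
  carrier := {x | 0 < α x.1}
  add_mem' hx hy := α.lt_add hx hy
  zero_mem' := by simp [α.map_zero]
  smul_mem' c x hx := by
    have h : (0 : WithTop Γ) < α c.1 + α x.1 := lt_of_lt_of_le hx (le_add_of_nonneg_left c.2)
    exact h.trans_le (α.add_le_mul' c.1 x.1)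

instance : α.gaugeIdeal.IsTwoSided where
  mul_mem_of_left {x} c hx := by
    have h : (0 : WithTop Γ) < α x.1 + α c.1 := lt_of_lt_of_le hx (le_add_of_nonneg_right c.2)
    exact h.trans_le (α.add_le_mul' x.1 c.1)

/-- The ring `A_0 = A_{≥ 0} / A_{> 0} = R_α / J_α`. -/
abbrev residueRing : Type u₃ := α.gaugeRing ⧸ α.gaugeIdeal

/-- `ω(α)`, the number of simple components of `A_0`. The simple components of a semisimple ring
are its minimal nonzero two-sided ideals. -/
noncomputable def omega : ℕ := Nat.card {I : TwoSidedIdeal α.residueRing // IsAtom I}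

/-- Two `v`-value functions are isomorphic if an `F`-algebra isomorphism carries one to the
other. -/
def IsIsomorphic {A' : Type*} [Ring A'] [Algebra F A'] (α : SurmultValueFunction v A)
    (α' : SurmultValueFunction v A') : Prop :=
  ∃ η : A ≃ₐ[F] A', ∀ z, α' (η z) = α z

/-- Morandi value functions: `A_0` is simple, and `Γ_α = α(st(α))` where `st(α)` is the set of
units `a` of `A` with `α(a⁻¹) = -α(a)`. -/
structure IsMorandi : Prop where
  isSimpleRing : IsSimpleRing α.residueRing
  valueSet_eq : ∀ g ∈ α.valueSet, ∃ a : Aˣ, α a + α (a⁻¹ : Aˣ) = 0 ∧ α a = (g : WithTop Γ)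

end SurmultValueFunction

end ValueFunctions

section Dubrovin

variable {A : Type u₃} [Ring A]

/-- Dubrovin valuation rings of `A`. -/
def IsDubrovin (B : Subring A) : Prop :=
  ∃ (J : Ideal B) (_ : J.IsTwoSided), IsSimpleRing (B ⧸ J) ∧ IsArtinianRing (B ⧸ J) ∧
    ∀ s : A, s ∉ B →
      (∃ (b : B) (h : b.1 * s ∈ B), (⟨b.1 * s, h⟩ : B) ∉ J) ∧
      (∃ (c : B) (h : s * c.1 ∈ B), (⟨s * c.1, h⟩ : B) ∉ J)

/-- `B` is a total valuation ring of `A`: for each unit `d` of `A`, `B` contains `d` or `d⁻¹`. -/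
def IsTotalValuationRing (B : Subring A) : Prop :=
  ∀ d : Aˣ, d.1 ∈ B ∨ (d⁻¹).1 ∈ B

/-- The set of prime (two-sided) ideals of a ring, as subsets. -/
def primeIdeals (R : Type*) [Ring R] : Set (Set R) :=
  {P | ∃ I : Ideal R, I.IsTwoSided ∧ I ≠ ⊤ ∧
    (∀ a b : R, (∀ r, a * r * b ∈ I) → a ∈ I ∨ b ∈ I) ∧ (I : Set R) = P}

/-- `J(S) ∩ R`, as a subset of `R`, for subrings `R` and `S` of `A`. -/
def radicalTrace (R S : Subring A) : Set R :=
  {r | ∃ h : r.1 ∈ S, (⟨r.1, h⟩ : S) ∈ Ring.jacobson S}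

/-- The Intersection Property: for `R = ⋂ B_i`, the map `S ↦ J(S) ∩ R` is a well-defined
order-reversing bijection from the overrings in `A` of the `B_i` to the prime ideals of `R`. -/
def IntersectionProperty {ι : Type*} (B : ι → Subring A) : Prop :=
  Set.BijOn (radicalTrace (⨅ i, B i)) {S | ∃ i, B i ≤ S} (primeIdeals (⨅ i, B i : Subring A)) ∧
    AntitoneOn (radicalTrace (⨅ i, B i)) {S | ∃ i, B i ≤ S}

/-- `R` is integral over its center. -/
def IsIntegralOverCenter (R : Subring A) : Prop :=
  (Subring.center R).subtype.IsIntegral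

/-- The `B_i` are incomparable Dubrovin valuation rings with the Intersection Property whose
intersection is integral over its center, i.e. they exhibit `⋂ B_i` as a Gräter ring. -/
structure IsGraterFamily {ι : Type*} (B : ι → Subring A) : Prop where
  isDubrovin : ∀ i, IsDubrovin (B i)
  incomparable : ∀ i j, i ≠ j → ¬ B i ≤ B j
  intersectionProperty : IntersectionProperty B
  isIntegral : IsIntegralOverCenter (⨅ i, B i)

/-- The center of the subring `R` of `A` is (the image in `A` of) the subring `V` of `F`. -/
def HasCenter {F : Type u₂} [Field F] [Algebra F A] (R : Subring A) (V : Subring F) : Prop :=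
  (Subring.center R).map R.subtype = V.map (algebraMap F A)

/-- The extension number `ξ_{V,[A]}` of a valuation ring `V` of `F` to a central simple
`F`-algebra `A`: the number of incomparable Dubrovin valuation rings with the Intersection
Property whose intersection is a Gräter ring with center `V`. (This number is the same for all
such families and a family exists, so the choice of `sInf` is immaterial.) -/
noncomputable def extensionNumber {F : Type u₂} [Field F] (V : Subring F)
    (A : Type u₃) [Ring A] [Algebra F A] : ℕ :=
  sInf {n | ∃ B : Fin n → Subring A, IsGraterFamily B ∧ HasCenter (⨅ i, B i) V}

/-- `α` is a minimal `v`-gauge (on a central simple algebra): `ω(α) = ξ_{V,[A]}`. -/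
structure SurmultValueFunction.IsMinimalGauge {Γ : Type u₁} [AddCommGroup Γ] [LinearOrder Γ]
    [IsOrderedAddMonoid Γ] {F : Type u₂} [Field F] {v : AddValuation F (WithTop Γ)}
    {A : Type u₃} [Ring A] [Algebra F A] (α : SurmultValueFunction v A) : Prop where
  isGauge : α.IsGauge
  omega_eq : α.omega = extensionNumber (valRing v) A

end Dubrovin

section TheExample

variable (L : Type u₁) [Field L]

/-- `F = L(x)((y))`. -/
abbrev FF : Type u₁ := LaurentSeries (RatFunc L)

/-- The element `x` of `F`. -/
noncomputable def xF : FF L := HahnSeries.C RatFunc.X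

/-- The element `y` of `F`. -/
noncomputable def yF : FF L := HahnSeries.single 1 1

/-- `ℚ × ℚ` ordered lexicographically, the FIRST coordinate being dominant. The first coordinate
records values of `y`, the second values of `x`. -/
abbrev GG : Type := ℚ ×ₗ ℚ

/-- The pair with `y`-value `m` and `x`-value `l`. -/
def gg (l m : ℚ) : GG := toLex (m, l)

/-- The `x`-adic order of a nonzero rational function. -/
noncomputable def ordX (r : RatFunc L) : ℤ := (r : LaurentSeries L).order

variable {L}

open Classical in
/-- The value `v(f)`: for `f = c_m y^m + c_{m+1} y^{m+1} + ⋯` with `c_m ≠ 0` it consists of `m`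
and the `x`-adic order of `c_m`. -/
noncomputable def vFun (f : FF L) : WithTop GG :=
  if f = 0 then ⊤ else ((gg (ordX L f.leadingCoeff) f.order : GG) : WithTop GG)

theorem ratFunc_coe_ne_zero {r : RatFunc L} (hr : r ≠ 0) : (r : LaurentSeries L) ≠ 0 := by
  intro h
  exact hr ((map_eq_zero _).1 h)

theorem ordX_mul {r s : RatFunc L} (hr : r ≠ 0) (hs : s ≠ 0) :
    ordX L (r * s) = ordX L r + ordX L s := by
  unfold ordX
  rw [map_mul, HahnSeries.order_mul (ratFunc_coe_ne_zero hr) (ratFunc_coe_ne_zero hs)]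

theorem ordX_add {r s : RatFunc L} (hrs : r + s ≠ 0) :
    min (ordX L r) (ordX L s) ≤ ordX L (r + s) := by
  unfold ordX
  have h := ratFunc_coe_ne_zero hrs
  rw [map_add] at h ⊢
  exact HahnSeries.min_order_le_order_add h

theorem vFun_of_ne {f : FF L} (hf : f ≠ 0) :
    vFun f = ((gg (ordX L f.leadingCoeff) f.order : GG) : WithTop GG) := by
  simp [vFun, hf]

theorem vFun_add_aux {f g : FF L} (hf : f ≠ 0) (hg : g ≠ 0) (hfg : f + g ≠ 0)
    (h : f.order ≤ g.order) : min (vFun f) (vFun g) ≤ vFun (f + g) := by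
  have key := HahnSeries.min_order_le_order_add hfg
  rw [min_eq_left h] at key
  have lc : ∀ u : FF L, u.leadingCoeff = u.coeff u.order := fun u => HahnSeries.leadingCoeff_eq
  rw [vFun_of_ne hf, vFun_of_ne hg, vFun_of_ne hfg]
  rcases key.lt_or_eq with hlt | heq
  · refine min_le_of_left_le (WithTop.coe_le_coe.2 ?_)
    exact (Prod.Lex.toLex_le_toLex).2 (Or.inl (Int.cast_lt.2 hlt))
  · have hne : (f + g).leadingCoeff ≠ 0 := HahnSeries.leadingCoeff_ne_zero.2 hfg
    have e : (f + g).leadingCoeff = f.leadingCoeff + g.coeff f.order := by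
      rw [lc, ← heq, HahnSeries.coeff_add, lc f]
    rcases h.lt_or_eq with hlt' | heq'
    · have : g.coeff f.order = 0 := HahnSeries.coeff_eq_zero_of_lt_order hlt'
      rw [this, add_zero] at e
      refine min_le_of_left_le (le_of_eq ?_)
      rw [e, ← heq]
    · have e' : (f + g).leadingCoeff = f.leadingCoeff + g.leadingCoeff := by
        rw [e, lc g, heq']
      have hm := ordX_add (e' ▸ hne)
      rw [← e'] at hm
      rcases min_le_iff.1 hm with h1 | h1
      · refine min_le_of_left_le (WithTop.coe_le_coe.2 ?_)
        exact (Prod.Lex.toLex_le_toLex).2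
          (Or.inr ⟨by simp [heq], by simpa using h1⟩)
      · refine min_le_of_right_le (WithTop.coe_le_coe.2 ?_)
        exact (Prod.Lex.toLex_le_toLex).2
          (Or.inr ⟨by simp [← heq, heq'], by simpa using h1⟩)

theorem vFun_add (f g : FF L) : min (vFun f) (vFun g) ≤ vFun (f + g) := by
  by_cases hf : f = 0
  · subst hf; simp
  by_cases hg : g = 0
  · subst hg; simp
  by_cases hfg : f + g = 0
  · rw [hfg]; simp [vFun]
  rcases le_total f.order g.order with h | h
  · exact vFun_add_aux hf hg hfg h
  · rw [min_comm, add_comm]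
    exact vFun_add_aux hg hf (by rwa [add_comm]) h

theorem vFun_mul (f g : FF L) : vFun (f * g) = vFun f + vFun g := by
  by_cases hf : f = 0
  · subst hf; simp [vFun]
  by_cases hg : g = 0
  · subst hg; simp [vFun]
  rw [vFun_of_ne hf, vFun_of_ne hg, vFun_of_ne (mul_ne_zero hf hg), HahnSeries.leadingCoeff_mul,
    ordX_mul (HahnSeries.leadingCoeff_ne_zero.2 hf) (HahnSeries.leadingCoeff_ne_zero.2 hg),
    HahnSeries.order_mul hf hg, ← WithTop.coe_add]
  congr 1
  simp only [gg, ← toLex_add, Prod.mk_add_mk]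
  push_cast
  rfl

theorem vFun_one : vFun (1 : FF L) = 0 := by
  rw [vFun_of_ne (one_ne_zero : (1 : FF L) ≠ 0)]
  simp [gg, ordX]

variable (L)

/-- The rank 2 valuation `v` on `F`, the composite of the `y`-adic valuation with the `x`-adic
valuation on `L(x)`. -/
noncomputable def vF : AddValuation (FF L) (WithTop GG) :=
  AddValuation.of vFun (by simp [vFun]) vFun_one vFun_add vFun_mul

/-- The quaternion algebra `D = (1 + x, y / F)`: `i ^ 2 = 1 + x`, `j ^ 2 = y`, `k = i j = - j i`. -/
abbrev DD : Type u₁ := ℍ[FF L, 1 + xF L, yF L]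

/-- `K = F(t)` with `t ^ 2 = 1 + x`; the pair `⟨a, b⟩` is `a + b t`. -/
abbrev KK : Type u₁ := QuadraticAlgebra (FF L) (1 + xF L) 0

variable {L}

/-- The function `α` on `D` given by
`α(a + bi + cj + dk) = min(v'(a + bt), v'((c + dt)y) - δ, v'(c - dt) + δ, v'(a - bt))`,
where `δ` has `x`-value `γ` and `y`-value `1 / 2`. It is the restriction to `D` of the function
`(p, q; r, s) ↦ min(v'(p), v'(q) - δ, v'(r) + δ, v'(s))` on `M_2(K)` when `D` is embedded by
`a + bi + cj + dk ↦ (a + bt, (c + dt)y; c - dt, a - bt)`. -/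
noncomputable def alphaFun (v' : AddValuation (KK L) (WithTop GG)) (γ : ℚ) (z : DD L) :
    WithTop GG :=
  min (min (v' ⟨z.re, z.imI⟩)
      (v' (⟨z.imJ, z.imK⟩ * algebraMap (FF L) (KK L) (yF L)) + ((-gg γ (1 / 2) : GG) : WithTop GG)))
    (min (v' ⟨z.imJ, -z.imK⟩ + ((gg γ (1 / 2) : GG) : WithTop GG))
      (v' ⟨z.re, -z.imI⟩))

end TheExample

/-! The element 1 + x has a square root r in L((x)) but none in L(x). So t ↦ r and t ↦ -r give two
embeddings of K in L((x))((y)), and D becomes an algebra of matrices with rows (p, qy) and (q', p'),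
where p = a + br and q = c + dr (`pD`, `qD`) and the dash means r ↦ -r. The reduced norm is pp' -
yqq', whose two terms have y-values of different parity. Hence `om`, the y-value of the norm, is
min(2w(p), 1 + 2w(q)) (`om_eq`). It follows that D is a division algebra and that `om` is twice a
valuation of D, with ring `WD` and residue field L(x)(t). The x-adic valuation has two extensions to
this residue field, and they pull back to two total valuation rings, `BD` for r and for -r.

For the gauges take E = 1 + i, with E + E* = 2 and EE* = -x; p(E) has value 0 and p'(E) has the
value of x. Recovering the coefficients of E and E* from p and p' is then a linear problem of unit
determinant, and it respects two thresholds as long as they differ by at most v(x)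
(`le_of_le_comb`). For q and q' the thresholds differ by 2δ - v(y) = (2γ, 0). So E, E*, Ej, E*j
split the value function if |2γ| ≤ 1, and strict inequality makes the graded ring semisimple
(`isGradedSemisimple_alphaS`). In the gauge ring δ enters only as a half-integral bound on integral
y-values, so γ disappears; the value set still shows γ modulo ℤ up to sign, and isomorphic gauges
have equal value sets.

A Dubrovin valuation ring B with center V lies in `WD` and contains all elements with `om` positive.
It also contains s or its inverse for every s of `WD`, because `WD` is commutative modulo those
elements. Testing E*/E shows that B contains the inverse of E or of E*. This forces B to contain,
and then to equal, one of the two rings `BD` (`eq_BD_of_isDubrovin`). Neither of them is integral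
over V, while their intersection is, and the four overrings match the four primes of the
intersection (`intersectionProperty_BD`). So the extension number is 2, and this is also the number
of components of the residue ring L × L.

For Morandi value functions, simplicity of the residue ring lets the gauge ring determine the
elements of positive value (`pos_of_pos`) and the stable units (`IsStable.of_ring_eq`). Every value
is that of a stable unit, and some positive multiple of it is a value of v, so the ring determines
the function (`eq_of_isMorandi`). -/

theorem exists_one_sub_mem_of_isSimpleRing {B : Type*} [Ring B] (J : Ideal B) [J.IsTwoSided]
    (hs : IsSimpleRing (B ⧸ J)) (T : AddSubgroup B) (hl : ∀ a t, t ∈ T → a * t ∈ T)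
    (hr : ∀ a t, t ∈ T → t * a ∈ T) {z : B} (hz : z ∈ T) (hzJ : z ∉ J) :
    ∃ t ∈ T, 1 - t ∈ J := by
  -- The image of `T` is a two-sided ideal of the simple ring `B ⧸ J`, nonzero because of `z`, so it
  -- contains 1. Both the Morandi argument and the study of Dubrovin rings rest on this.
  let I : TwoSidedIdeal (B ⧸ J) := TwoSidedIdeal.mk'
    {x | ∃ t ∈ T, Ideal.Quotient.mk J t = x}
    ⟨0, T.zero_mem, map_zero _⟩
    (by
      rintro _ _ ⟨s, hs, rfl⟩ ⟨t, ht, rfl⟩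
      exact ⟨s + t, T.add_mem hs ht, map_add _ _ _⟩)
    (by
      rintro _ ⟨s, hs, rfl⟩
      exact ⟨-s, T.neg_mem hs, map_neg _ _⟩)
    (by
      rintro x _ ⟨s, hs, rfl⟩
      obtain ⟨a, rfl⟩ := Ideal.Quotient.mk_surjective x
      exact ⟨a * s, hl _ _ hs, map_mul _ _ _⟩)
    (by
      rintro _ x ⟨s, hs, rfl⟩
      obtain ⟨a, rfl⟩ := Ideal.Quotient.mk_surjective x
      exact ⟨s * a, hr _ _ hs, map_mul _ _ _⟩)
  have hI : ∀ x, x ∈ I ↔ ∃ t ∈ T, Ideal.Quotient.mk J t = x := fun x => TwoSidedIdeal.mem_mk' ..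
  have hne : I ≠ ⊥ := by
    intro hbot
    have h1 : Ideal.Quotient.mk J z ∈ I := (hI _).2 ⟨_, hz, rfl⟩
    rw [hbot, TwoSidedIdeal.mem_bot, Ideal.Quotient.eq_zero_iff_mem] at h1
    exact hzJ h1
  have htop : I = ⊤ := (hs.simple.eq_bot_or_eq_top I).resolve_left hne
  have h1 : (1 : B ⧸ J) ∈ I := htop ▸ trivial
  obtain ⟨t, ht, e⟩ := (hI _).1 h1
  refine ⟨t, ht, ?_⟩
  rw [← map_one (Ideal.Quotient.mk J), eq_comm, Ideal.Quotient.eq] at e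
  exact e

/-! ### Morandi value functions are determined by their rings -/

namespace SurmultValueFunction

section Morandi

variable {Γ : Type u₁} [AddCommGroup Γ] [LinearOrder Γ] [IsOrderedAddMonoid Γ]
  {E : Type u₂} [Field E] {v : AddValuation E (WithTop Γ)}
  {A : Type u₃} [Ring A] [Algebra E A] (α β : SurmultValueFunction v A)

theorem exists_coe_of_ne_zero {x : A} (hx : x ≠ 0) : ∃ g : Γ, α x = (g : WithTop Γ) := by
  obtain ⟨g, hg⟩ := WithTop.ne_top_iff_exists.1 (fun h => hx ((α.eq_top_iff' x).1 h))
  exact ⟨g, hg.symm⟩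

theorem lt_sum {ι : Type*} (s : Finset ι) (f : ι → A) {g : Γ}
    (h : ∀ i ∈ s, (g : WithTop Γ) < α (f i)) : (g : WithTop Γ) < α (∑ i ∈ s, f i) := by
  classical
  induction s using Finset.induction_on with
  | empty => simp [α.map_zero]
  | insert a s ha ih =>
    rw [Finset.sum_insert ha]
    exact α.lt_add (h a (Finset.mem_insert_self a s))
      (ih fun i hi => h i (Finset.mem_insert_of_mem hi))

/-- `1 - z` is a unit with inverse in the ring of `α` if `z` has positive value. -/
theorem exists_unit_one_sub [FiniteDimensional E A] {z : A} (hz : 0 < α z) :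
    ∃ u : Aˣ, (u : A) = 1 - z ∧ 0 ≤ α ((u⁻¹ : Aˣ) : A) := by
  -- Multiplication by `z` strictly raises values, so left multiplication by `1 - z` is injective,
  -- and bijective by finite dimension.
  have hlt : ∀ x : A, x ≠ 0 → α x < α z + α x := by
    intro x hx
    obtain ⟨g, hg⟩ := α.exists_coe_of_ne_zero hx
    have := WithTop.add_lt_add_right (z := (g : WithTop Γ)) (by simp) hz
    simpa [hg] using this
  have hinj : Function.Injective (LinearMap.mulLeft E (1 - z)) := by
    rw [injective_iff_map_eq_zero]
    intro x hx
    by_contra hx0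
    have e : x = z * x := by
      have : (1 - z) * x = 0 := hx
      rwa [sub_mul, one_mul, sub_eq_zero] at this
    have h1 := α.add_le_mul' z x
    rw [← e] at h1
    exact absurd (hlt x hx0) (not_lt.2 h1)
  obtain ⟨b, hb⟩ := (LinearMap.injective_iff_surjective.1 hinj) 1
  have hb' : (1 - z) * b = 1 := hb
  have hb'' : b * (1 - z) = 1 := by
    apply hinj
    change (1 - z) * (b * (1 - z)) = (1 - z) * 1
    rw [← mul_assoc, hb', one_mul, mul_one]
  refine ⟨⟨1 - z, b, hb', hb''⟩, rfl, ?_⟩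
  change 0 ≤ α b
  by_contra hneg
  rw [not_le] at hneg
  have hb0 : b ≠ 0 := by
    rintro rfl
    rw [α.map_zero] at hneg
    exact absurd hneg (by simp)
  -- If `b` had negative value, both summands on the right would have a value larger than that of
  -- `b`.
  have e : b = 1 + z * b := by
    have : b - z * b = 1 := by rw [← hb']; noncomm_ring
    rw [← this]; abel
  have h1 : α b < α (1 + z * b) :=
    α.lt_add (by rwa [α.map_one']) ((hlt b hb0).trans_le (α.add_le_mul' z b))
  rw [← e] at h1
  exact lt_irrefl _ h1

theorem exists_pos_one_sub_of_isSimpleRing (hs : IsSimpleRing α.residueRing) (T : AddSubgroup A)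
    (hT : ∀ t ∈ T, 0 ≤ α t) (hl : ∀ a t, 0 ≤ α a → t ∈ T → a * t ∈ T)
    (hr : ∀ a t, 0 ≤ α a → t ∈ T → t * a ∈ T) {z : A} (hz : z ∈ T) (hz0 : ¬ 0 < α z) :
    ∃ t ∈ T, 0 < α (1 - t) := by
  obtain ⟨t, ht, ht1⟩ := exists_one_sub_mem_of_isSimpleRing α.gaugeIdeal hs
    (T.comap α.gaugeRing.subtype.toAddMonoidHom) (fun a t ht => hl _ _ a.2 ht)
    (fun a t ht => hr _ _ a.2 ht) (z := ⟨z, hT z hz⟩) hz hz0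
  exact ⟨t.1, ht, ht1⟩

variable {α β}

/-- The elements with β positive form an ideal of the common ring. If it were not contained in the
ideal of α, simplicity would give a `t` in it with α(1 - t) positive; but `1 - t` is invertible in
the ring, so 1 would have positive value. -/
theorem pos_of_pos [FiniteDimensional E A] (hs : IsSimpleRing α.residueRing)
    (h : ∀ z, 0 ≤ α z ↔ 0 ≤ β z) {z : A} (hz : 0 < β z) : 0 < α z := by
  by_contra hz0
  obtain ⟨t, ht, ht1⟩ := α.exists_pos_one_sub_of_isSimpleRing hs
    { carrier := {x | 0 < β x}
      add_mem' := fun hx hy => β.lt_add hx hy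
      zero_mem' := by simp [β.map_zero]
      neg_mem' := fun {x} hx => by simpa [β.map_neg] using hx }
    (fun t ht => (h t).2 (le_of_lt ht))
    (fun a t ha ht => lt_of_lt_of_le (lt_of_lt_of_le ht (le_add_of_nonneg_left ((h a).1 ha)))
      (β.add_le_mul' a t))
    (fun a t ha ht => lt_of_lt_of_le (lt_of_lt_of_le ht (le_add_of_nonneg_right ((h a).1 ha)))
      (β.add_le_mul' t a))
    (z := z) hz hz0
  obtain ⟨u, hu, hu1⟩ := β.exists_unit_one_sub (z := t) ht
  have h1 : 0 < α (((u⁻¹ : Aˣ) : A) * (1 - t)) :=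
    lt_of_lt_of_le (lt_of_lt_of_le ht1 (le_add_of_nonneg_left ((h _).2 hu1))) (α.add_le_mul' _ _)
  rw [← hu, Units.inv_mul, α.map_one'] at h1
  exact lt_irrefl _ h1

variable (α) in
/-- The stabilizer `st(α)`: the units `a` with `α(a⁻¹) = -α(a)`. -/
def IsStable (a : Aˣ) : Prop := α a + α (a⁻¹ : Aˣ) = 0

theorem isStable_iff [Nontrivial A] {a : Aˣ} :
    α.IsStable a ↔ ∃ g : Γ, α a = (g : WithTop Γ) ∧ α (a⁻¹ : Aˣ) = ((-g : Γ) : WithTop Γ) := by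
  constructor
  · intro h
    obtain ⟨g, hg⟩ := α.exists_coe_of_ne_zero a.ne_zero
    obtain ⟨g', hg'⟩ := α.exists_coe_of_ne_zero (a⁻¹).ne_zero
    refine ⟨g, hg, ?_⟩
    unfold IsStable at h
    rw [hg, hg', ← WithTop.coe_add, WithTop.coe_eq_zero] at h
    rw [hg', eq_neg_of_add_eq_zero_right h]
  · rintro ⟨g, h1, h2⟩
    unfold IsStable
    rw [h1, h2, ← WithTop.coe_add, add_neg_cancel, WithTop.coe_zero]

theorem IsStable.inv {a : Aˣ} (h : α.IsStable a) : α.IsStable a⁻¹ := by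
  unfold IsStable at h ⊢
  rwa [inv_inv, add_comm]

theorem IsStable.mul_left {a : Aˣ} (h : α.IsStable a) (z : A) : α (a * z) = α a + α z := by
  refine le_antisymm ?_ (α.add_le_mul' _ _)
  have h1 := α.add_le_mul' (a⁻¹ : Aˣ) (a * z)
  rw [Units.inv_mul_cancel_left] at h1
  calc α (a * z) = α a + (α (a⁻¹ : Aˣ) + α (a * z)) := by rw [← add_assoc, h, zero_add]
    _ ≤ _ := add_le_add le_rfl h1

theorem IsStable.mul_right {a : Aˣ} (h : α.IsStable a) (z : A) : α (z * a) = α z + α a := by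
  refine le_antisymm ?_ (α.add_le_mul' _ _)
  have h1 := α.add_le_mul' (z * a) (a⁻¹ : Aˣ)
  rw [Units.mul_inv_cancel_right] at h1
  have h' : α (a⁻¹ : Aˣ) + α a = 0 := by rw [add_comm]; exact h
  calc α (z * a) = (α (z * a) + α (a⁻¹ : Aˣ)) + α a := by rw [add_assoc, h', add_zero]
    _ ≤ _ := add_le_add h1 le_rfl

theorem IsStable.mul {a b : Aˣ} (ha : α.IsStable a) (hb : α.IsStable b) : α.IsStable (a * b) := by
  unfold IsStable
  rw [mul_inv_rev, Units.val_mul, Units.val_mul, ha.mul_left, hb.inv.mul_left]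
  have h1 : α a + α (a⁻¹ : Aˣ) = 0 := ha
  have h2 : α b + α (b⁻¹ : Aˣ) = 0 := hb
  rw [add_assoc, ← add_assoc (α b), h2, zero_add, h1]

theorem IsStable.pow_apply {a : Aˣ} (h : α.IsStable a) (n : ℕ) : α ((a : A) ^ n) = n • α a := by
  induction n with
  | zero => simp [α.map_one']
  | succ n ih => rw [pow_succ, h.mul_right, ih, succ_nsmul]

/-- The values of a stable unit are torsion modulo the values of `v`. -/
theorem IsStable.exists_pow_eq [Nontrivial A] [FiniteDimensional E A] {a : Aˣ}
    (ha : α.IsStable a) : ∃ (n : ℕ) (c : E), 0 < n ∧ c ≠ 0 ∧ α ((a : A) ^ n) = v c := by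
  obtain ⟨g, hg, -⟩ := isStable_iff.1 ha
  obtain ⟨p, hp, hpa⟩ := Algebra.IsIntegral.isIntegral (R := E) (a : A)
  have hp0 : p ≠ 0 := hp.ne_zero
  have hval : ∀ i, α (p.coeff i • (a : A) ^ i) = v (p.coeff i) + i • α a := fun i => by
    rw [α.map_smul', ha.pow_apply]
  -- If no positive multiple of the value of `a` were a value of v, the nonzero terms of an integral
  -- equation for `a` would have pairwise different values. A sum of such terms cannot vanish.
  by_contra! hcon
  have hdist : ∀ i ∈ p.support, ∀ j ∈ p.support, i ≠ j →
      α (p.coeff i • (a : A) ^ i) ≠ α (p.coeff j • (a : A) ^ j) := by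
    have key : ∀ i ∈ p.support, ∀ j ∈ p.support, i < j →
        α (p.coeff i • (a : A) ^ i) ≠ α (p.coeff j • (a : A) ^ j) := by
      intro i hi j hj hij he
      rw [Polynomial.mem_support_iff] at hi hj
      refine hcon (j - i) (p.coeff i / p.coeff j) (by omega) (div_ne_zero hi hj) ?_
      rw [ha.pow_apply, hg]
      rw [hval, hval, hg] at he
      obtain ⟨k, rfl⟩ := Nat.exists_eq_add_of_lt hij
      have hjt : v (p.coeff (i + k + 1)) ≠ ⊤ := (v.ne_top_iff).2 hj
      have e : p.coeff i = (p.coeff i / p.coeff (i + k + 1)) * p.coeff (i + k + 1) := by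
        field_simp
      have hdt : v (p.coeff i / p.coeff (i + k + 1)) ≠ ⊤ := (v.ne_top_iff).2 (div_ne_zero hi hj)
      rw [e, v.map_mul] at he
      generalize v (p.coeff (i + k + 1)) = X at *
      generalize v (p.coeff i / p.coeff (i + k + 1)) = Y at *
      lift X to Γ using hjt
      lift Y to Γ using hdt
      have e2 : i + k + 1 - i = k + 1 := by omega
      rw [e2]
      norm_cast at he ⊢
      rw [add_assoc i k 1, add_smul i] at he
      have : (Y + (X + i • g)) = ((k + 1) • g + (X + i • g)) := by
        rw [← add_assoc, he]; abel
      exact (add_right_cancel this).symm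
    intro i hi j hj hij
    rcases lt_or_gt_of_ne hij with h | h
    · exact key i hi j hj h
    · exact (key j hj i hi h).symm
  have hsum : ∑ i ∈ p.support, p.coeff i • (a : A) ^ i = 0 := by
    rw [← hpa, Polynomial.eval₂_eq_sum, Polynomial.sum_def]
    exact Finset.sum_congr rfl fun i _ => Algebra.smul_def _ _
  obtain ⟨i, hi, hmin⟩ := p.support.exists_min_image (fun i => α (p.coeff i • (a : A) ^ i))
    (Polynomial.support_nonempty.2 hp0)
  have hne : p.coeff i • (a : A) ^ i ≠ 0 := by
    rw [Polynomial.mem_support_iff] at hi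
    rw [← Units.val_pow_eq_pow_val]
    exact smul_ne_zero hi (Units.ne_zero _)
  obtain ⟨m, hm⟩ := α.exists_coe_of_ne_zero hne
  have h1 : (m : WithTop Γ) < α (∑ j ∈ p.support.erase i, p.coeff j • (a : A) ^ j) := by
    refine α.lt_sum _ _ fun j hj => ?_
    rw [Finset.mem_erase] at hj
    rw [← hm]
    exact lt_of_le_of_ne (hmin j hj.2) (hdist i hi j hj.2 hj.1.symm)
  rw [← Finset.add_sum_erase _ _ hi, add_eq_zero_iff_neg_eq] at hsum
  rw [← hsum, α.map_neg, hm] at h1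
  exact lt_irrefl _ h1

/-- Morandi value functions with the same ring have the same stable units. -/
theorem IsStable.of_ring_eq [Nontrivial A] [FiniteDimensional E A] (hβ : β.IsMorandi)
    (h : ∀ z, 0 ≤ α z ↔ 0 ≤ β z) {a : Aˣ}
    (ha : α.IsStable a) : β.IsStable a := by
  obtain ⟨g, hg⟩ := β.exists_coe_of_ne_zero a.ne_zero
  obtain ⟨b, hb, hbg⟩ := hβ.valueSet_eq g ⟨_, hg⟩
  have hb : β.IsStable b := hb
  -- The unit `b` is stable for β and has the same β-value as `a`, so it remains to show that `u`,
  -- of β-value 0, is stable. Conjugation by `u` preserves the ring: `a` preserves it through α and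
  -- `b` through β.
  let u : Aˣ := b⁻¹ * a
  have hu0 : β u = 0 := by
    rw [Units.val_mul, hb.inv.mul_left, hg, ← hbg, add_comm]; exact hb
  have conjα : ∀ z, 0 ≤ α z → 0 ≤ α (a * z * (a⁻¹ : Aˣ)) ∧ 0 ≤ α ((a⁻¹ : Aˣ) * z * a) := by
    intro z hz
    rw [ha.inv.mul_right, ha.mul_left, ha.mul_right, ha.inv.mul_left]
    have h1 : α a + α (a⁻¹ : Aˣ) = 0 := ha
    rw [add_right_comm, h1, zero_add, add_right_comm, add_comm (α (a⁻¹ : Aˣ)), h1, zero_add]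
    exact ⟨hz, hz⟩
  have conjβ : ∀ z, 0 ≤ β z → 0 ≤ β (b * z * (b⁻¹ : Aˣ)) ∧ 0 ≤ β ((b⁻¹ : Aˣ) * z * b) := by
    intro z hz
    rw [hb.inv.mul_right, hb.mul_left, hb.mul_right, hb.inv.mul_left]
    have h1 : β b + β (b⁻¹ : Aˣ) = 0 := hb
    rw [add_right_comm, h1, zero_add, add_right_comm, add_comm (β (b⁻¹ : Aˣ)), h1, zero_add]
    exact ⟨hz, hz⟩
  have conj1 : ∀ z, 0 ≤ β z → 0 ≤ β (u * z * (u⁻¹ : Aˣ)) := by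
    intro z hz
    have := (conjβ _ ((h _).1 (conjα z ((h z).2 hz)).1)).2
    simpa [u, mul_assoc] using this
  have conj2 : ∀ z, 0 ≤ β z → 0 ≤ β ((u⁻¹ : Aˣ) * z * u) := by
    intro z hz
    have := (h _).1 (conjα _ ((h _).2 (conjβ z hz).1)).2
    simpa [u, mul_assoc] using this
  -- As `u` normalizes the ring, its multiples `u * r` form a two-sided ideal, not inside the ideal
  -- of positive values. So some `u * r` is 1 modulo that ideal and hence a unit of the ring, which
  -- puts the inverse of `u` in the ring.
  obtain ⟨t, ⟨r, hr, rfl⟩, ht1⟩ := β.exists_pos_one_sub_of_isSimpleRing hβ.isSimpleRing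
    { carrier := {x | ∃ r, 0 ≤ β r ∧ (u : A) * r = x}
      add_mem' := by
        rintro _ _ ⟨r, hr, rfl⟩ ⟨s, hs, rfl⟩
        exact ⟨r + s, β.le_add hr hs, mul_add _ _ _⟩
      zero_mem' := ⟨0, by simp [β.map_zero], mul_zero _⟩
      neg_mem' := by
        rintro _ ⟨r, hr, rfl⟩
        exact ⟨-r, by rwa [β.map_neg], mul_neg _ _⟩ }
    (by
      rintro _ ⟨r, hr, rfl⟩
      exact (add_nonneg hu0.ge hr).trans (β.add_le_mul' _ _))
    (by
      rintro x _ hx ⟨r, hr, rfl⟩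
      refine ⟨((u⁻¹ : Aˣ) * x * u) * r, (add_nonneg (conj2 x hx) hr).trans (β.add_le_mul' _ _), ?_⟩
      simp only [← mul_assoc, Units.mul_inv, one_mul])
    (by
      rintro x _ hx ⟨r, hr, rfl⟩
      exact ⟨r * x, (add_nonneg hr hx).trans (β.add_le_mul' _ _), (mul_assoc _ _ _).symm⟩)
    (z := u) ⟨1, by rw [β.map_one'], mul_one _⟩ (by rw [hu0]; exact lt_irrefl _)
  obtain ⟨e, he, he1⟩ := β.exists_unit_one_sub ht1
  rw [sub_sub_cancel] at he
  have hinv : ((u⁻¹ : Aˣ) : A) = r * (e⁻¹ : Aˣ) := by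
    rw [Units.inv_eq_of_mul_eq_one_right]
    rw [← mul_assoc, ← he, Units.mul_inv]
  have hu1 : 0 ≤ β (u⁻¹ : Aˣ) := hinv ▸ (add_nonneg hr he1).trans (β.add_le_mul' _ _)
  have hu2 : β (u⁻¹ : Aˣ) ≤ 0 := by
    have := β.add_le_mul' u (u⁻¹ : Aˣ)
    rwa [Units.mul_inv, hu0, zero_add, β.map_one'] at this
  have hu : β.IsStable u := by
    unfold IsStable
    rw [hu0, zero_add]
    exact le_antisymm hu2 hu1
  have : a = b * u := by simp [u]
  rw [this]
  exact hb.mul hu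

/-- Write z as a stable unit times an element of value 0; both factors keep these properties under
β. The value of the unit is pinned down because a positive multiple of it equals some v(c) and
ordered groups are torsion-free. -/
theorem eq_of_isMorandi [Nontrivial A] [FiniteDimensional E A] (hα : α.IsMorandi)
    (hβ : β.IsMorandi) (h : α.gaugeRing = β.gaugeRing) (z : A) : α z = β z := by
  have h0 : ∀ z, 0 ≤ α z ↔ 0 ≤ β z := fun z => by
    change z ∈ α.gaugeRing ↔ z ∈ β.gaugeRing
    rw [h]
  have h1 : ∀ z, 0 < α z ↔ 0 < β z := fun z =>
    ⟨pos_of_pos hβ.isSimpleRing fun z => (h0 z).symm, pos_of_pos hα.isSimpleRing h0⟩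
  have h2 : ∀ z, α z = 0 → β z = 0 := fun z hz =>
    le_antisymm (not_lt.1 fun hlt => ((h1 z).2 hlt).ne' hz) ((h0 z).1 hz.ge)
  by_cases hz : z = 0
  · rw [hz, α.map_zero, β.map_zero]
  obtain ⟨g, hg⟩ := α.exists_coe_of_ne_zero hz
  obtain ⟨a, ha, hag⟩ := hα.valueSet_eq g ⟨z, hg⟩
  have ha : α.IsStable a := ha
  have hb : β.IsStable a := ha.of_ring_eq hβ h0
  have e1 : β z = β a := by
    have h3 : α ((a⁻¹ : Aˣ) * z) = 0 := by
      rw [ha.inv.mul_left, hg, ← hag, add_comm]; exact ha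
    have h4 := h2 _ h3
    calc β z = β (a * ((a⁻¹ : Aˣ) * z)) := by rw [Units.mul_inv_cancel_left]
      _ = β a := by rw [hb.mul_left, h4, add_zero]
  obtain ⟨n, c, hn, hc, hc'⟩ := ha.exists_pow_eq
  have hcinv : v c + v c⁻¹ = 0 := by rw [← v.map_mul, mul_inv_cancel₀ hc, v.map_one]
  have h5 : α (c⁻¹ • (a : A) ^ n) = 0 := by
    rw [α.map_smul', hc', add_comm, hcinv]
  have h6 := h2 _ h5
  rw [β.map_smul', hb.pow_apply] at h6
  rw [ha.pow_apply] at hc'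
  have h7 : n • α a = n • β a := by
    calc n • α a = v c + (v c⁻¹ + n • β a) := by rw [h6, add_zero, hc']
      _ = n • β a := by rw [← add_assoc, hcinv, zero_add]
  obtain ⟨g', hg'⟩ := β.exists_coe_of_ne_zero a.ne_zero
  rw [hag, hg'] at h7
  norm_cast at h7
  have h8 : g = g' := nsmul_right_injective hn.ne' h7
  rw [e1, hg', hg, h8]

end Morandi

end SurmultValueFunction

/-! ### The field L((x))((y)), its valuations and residues, and the square root of 1 + x -/

section LaurentFields

variable (L : Type u₁) [Field L]

/-- The field `L((x))((y))`. -/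
abbrev MM : Type u₁ := LaurentSeries (LaurentSeries L)

/-- The embedding of `L(x)` in `L((x))`. -/
noncomputable def coeHom : RatFunc L →+* LaurentSeries L where
  toFun r := (r : LaurentSeries L)
  map_one' := map_one _
  map_mul' := map_mul _
  map_zero' := map_zero _
  map_add' := map_add _

/-- The embedding of `F = L(x)((y))` in `L((x))((y))`. -/
noncomputable def mapF : FF L →+* MM L where
  toFun f := f.map (coeHom L)
  map_one' := HahnSeries.map_one (coeHom L).toMonoidWithZeroHom
  map_mul' _ _ := HahnSeries.map_mul (coeHom L : RatFunc L →ₙ+* LaurentSeries L)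
  map_zero' := HahnSeries.map_zero ((coeHom L) : ZeroHom (RatFunc L) (LaurentSeries L))
  map_add' _ _ := HahnSeries.map_add (coeHom L : RatFunc L →+ LaurentSeries L)

variable {L}

@[simp]
theorem coeff_mapF (f : FF L) (n : ℤ) :
    (mapF L f).coeff n = coeHom L (f.coeff n) := rfl

theorem le_addVal_iff {k : Type*} [Field k] {f : LaurentSeries k} {n : ℤ} :
    (n : WithTop ℤ) ≤ HahnSeries.addVal ℤ k f ↔ ∀ m < n, f.coeff m = 0 := by
  rw [HahnSeries.addVal_apply]
  constructor
  · intro h m hm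
    exact HahnSeries.coeff_eq_zero_of_lt_orderTop ((WithTop.coe_lt_coe.2 hm).trans_le h)
  · intro h
    by_contra hlt
    rw [not_le] at hlt
    obtain ⟨m, hm⟩ := WithTop.ne_top_iff_exists.1 (ne_top_of_lt hlt)
    rw [← hm, WithTop.coe_lt_coe] at hlt
    exact HahnSeries.coeff_orderTop_ne hm.symm (h m hlt)

/-- The rank 2 valuation on `L((x))((y))`. -/
noncomputable def vMFun (f : MM L) : WithTop GG :=
  open Classical in
  if f = 0 then ⊤ else ((gg f.leadingCoeff.order f.order : GG) : WithTop GG)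

theorem vMFun_of_ne {f : MM L} (hf : f ≠ 0) :
    vMFun f = ((gg f.leadingCoeff.order f.order : GG) : WithTop GG) := by
  simp [vMFun, hf]

theorem gg_le_gg {l m l' m' : ℚ} : gg l m ≤ gg l' m' ↔ m < m' ∨ m = m' ∧ l ≤ l' :=
  Prod.Lex.toLex_le_toLex

theorem gg_lt_gg {l m l' m' : ℚ} : gg l m < gg l' m' ↔ m < m' ∨ m = m' ∧ l < l' :=
  Prod.Lex.toLex_lt_toLex

theorem gg_add (l m l' m' : ℚ) : gg l m + gg l' m' = gg (l + l') (m + m') := rfl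

theorem gg_neg (l m : ℚ) : -gg l m = gg (-l) (-m) := rfl

theorem gg_zero : gg 0 0 = 0 := rfl

theorem gg_inj {l m l' m' : ℚ} : gg l m = gg l' m' ↔ l = l' ∧ m = m' := by
  simp [gg, and_comm]

theorem vMFun_add_aux {f g : MM L} (hf : f ≠ 0) (hg : g ≠ 0) (hfg : f + g ≠ 0)
    (h : f.order ≤ g.order) : min (vMFun f) (vMFun g) ≤ vMFun (f + g) := by
  have key := HahnSeries.min_order_le_order_add hfg
  rw [min_eq_left h] at key
  have lc : ∀ u : MM L, u.leadingCoeff = u.coeff u.order := fun u => HahnSeries.leadingCoeff_eq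
  rw [vMFun_of_ne hf, vMFun_of_ne hg, vMFun_of_ne hfg]
  rcases key.lt_or_eq with hlt | heq
  · exact min_le_of_left_le (WithTop.coe_le_coe.2 (gg_le_gg.2 (Or.inl (Int.cast_lt.2 hlt))))
  · have hne : (f + g).leadingCoeff ≠ 0 := HahnSeries.leadingCoeff_ne_zero.2 hfg
    have e : (f + g).leadingCoeff = f.leadingCoeff + g.coeff f.order := by
      rw [lc, ← heq, HahnSeries.coeff_add, lc f]
    rcases h.lt_or_eq with hlt' | heq'
    · have : g.coeff f.order = 0 := HahnSeries.coeff_eq_zero_of_lt_order hlt'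
      rw [this, add_zero] at e
      refine min_le_of_left_le (le_of_eq ?_)
      rw [e, ← heq]
    · have e' : (f + g).leadingCoeff = f.leadingCoeff + g.leadingCoeff := by
        rw [e, lc g, heq']
      have hm := HahnSeries.min_order_le_order_add (e' ▸ hne)
      rw [← e'] at hm
      rcases min_le_iff.1 hm with h1 | h1
      · exact min_le_of_left_le (WithTop.coe_le_coe.2 (gg_le_gg.2
          (Or.inr ⟨by simp [heq], by simpa using h1⟩)))
      · exact min_le_of_right_le (WithTop.coe_le_coe.2 (gg_le_gg.2
          (Or.inr ⟨by simp [← heq, heq'], by simpa using h1⟩)))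

theorem vMFun_add (f g : MM L) : min (vMFun f) (vMFun g) ≤ vMFun (f + g) := by
  by_cases hf : f = 0
  · subst hf; simp
  by_cases hg : g = 0
  · subst hg; simp
  by_cases hfg : f + g = 0
  · rw [hfg]; simp [vMFun]
  rcases le_total f.order g.order with h | h
  · exact vMFun_add_aux hf hg hfg h
  · rw [min_comm, add_comm]
    exact vMFun_add_aux hg hf (by rwa [add_comm]) h

theorem vMFun_mul (f g : MM L) : vMFun (f * g) = vMFun f + vMFun g := by
  by_cases hf : f = 0
  · subst hf; simp [vMFun]
  by_cases hg : g = 0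
  · subst hg; simp [vMFun]
  rw [vMFun_of_ne hf, vMFun_of_ne hg, vMFun_of_ne (mul_ne_zero hf hg), HahnSeries.leadingCoeff_mul,
    HahnSeries.order_mul (HahnSeries.leadingCoeff_ne_zero.2 hf)
      (HahnSeries.leadingCoeff_ne_zero.2 hg),
    HahnSeries.order_mul hf hg, ← WithTop.coe_add, gg_add]
  push_cast
  rfl

theorem vMFun_one : vMFun (1 : MM L) = 0 := by
  rw [vMFun_of_ne (one_ne_zero : (1 : MM L) ≠ 0)]
  simp [gg]

variable (L) in
/-- The rank 2 valuation on `L((x))((y))`, the composite of the `y`-adic and `x`-adic ones. -/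
noncomputable def vM : AddValuation (MM L) (WithTop GG) :=
  AddValuation.of vMFun (by simp [vMFun]) vMFun_one vMFun_add vMFun_mul

variable (L) in
/-- The `y`-adic valuation on `L((x))((y))`. -/
noncomputable abbrev wM : AddValuation (MM L) (WithTop ℤ) := HahnSeries.addVal ℤ (LaurentSeries L)

variable (L) in
/-- The `y`-adic valuation on `L(x)((y))`. -/
noncomputable abbrev wF : AddValuation (FF L) (WithTop ℤ) := HahnSeries.addVal ℤ (RatFunc L)

theorem vM_apply (f : MM L) : vM L f = vMFun f := rfl

theorem vF_apply (f : FF L) : vF L f = vFun f := rfl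

theorem exists_vM_eq {f : MM L} (hf : f ≠ 0) :
    ∃ l m : ℤ, vM L f = ((gg l m : GG) : WithTop GG) ∧ wM L f = (m : WithTop ℤ) :=
  ⟨_, _, vMFun_of_ne hf, HahnSeries.addVal_apply_of_ne hf⟩

theorem wM_mapF (f : FF L) : wM L (mapF L f) = wF L f := by
  refine le_antisymm ?_ ?_ <;> refine WithTop.forall_coe_le_iff_le.1 fun n hn => ?_
  · rw [le_addVal_iff] at hn ⊢
    intro m hm
    have := hn m hm
    exact (map_eq_zero (coeHom L)).1 this
  · rw [le_addVal_iff] at hn ⊢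
    intro m hm
    rw [coeff_mapF, hn m hm, map_zero]

theorem vM_mapF (f : FF L) : vM L (mapF L f) = vF L f := by
  by_cases hf : f = 0
  · rw [hf, map_zero, AddValuation.map_zero, AddValuation.map_zero]
  have hf' : mapF L f ≠ 0 := (map_ne_zero _).2 hf
  have ho : (mapF L f).order = f.order := by
    have := wM_mapF f
    rw [HahnSeries.addVal_apply_of_ne hf, HahnSeries.addVal_apply_of_ne hf'] at this
    exact WithTop.coe_injective this
  rw [vM_apply, vF_apply, vMFun_of_ne hf', vFun_of_ne hf, HahnSeries.leadingCoeff_eq, ho,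
    HahnSeries.leadingCoeff_eq]
  rfl

theorem vM_C {a : LaurentSeries L} (ha : a ≠ 0) :
    vM L (HahnSeries.C a) = ((gg a.order 0 : GG) : WithTop GG) := by
  rw [vM_apply, vMFun_of_ne (HahnSeries.C_ne_zero ha)]
  have ho : (HahnSeries.C a : MM L).order = 0 := HahnSeries.order_C
  rw [HahnSeries.leadingCoeff_eq, ho]
  simp [HahnSeries.C_apply]

theorem vM_C_C {a : L} (ha : a ≠ 0) : vM L (HahnSeries.C (HahnSeries.C a)) = 0 := by
  rw [vM_C (HahnSeries.C_ne_zero ha), HahnSeries.order_C]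
  simp [gg]

theorem vM_nonneg_coeff {f : MM L} (hf : 0 ≤ vM L f) :
    (∀ m < 0, f.coeff m = 0) ∧ ∀ l < 0, (f.coeff 0).coeff l = 0 := by
  by_cases h0 : f = 0
  · simp [h0]
  rw [vM_apply, vMFun_of_ne h0, ← WithTop.coe_zero, WithTop.coe_le_coe, ← gg_zero, gg_le_gg] at hf
  have ho : 0 ≤ f.order := by
    rcases hf with h | ⟨h, -⟩
    · exact_mod_cast h.le
    · exact_mod_cast h.le
  refine ⟨fun m hm => HahnSeries.coeff_eq_zero_of_lt_order (hm.trans_le ho), fun l hl => ?_⟩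
  rcases hf with h | ⟨h, h'⟩
  · have h1 : f.coeff 0 = 0 := HahnSeries.coeff_eq_zero_of_lt_order (by exact_mod_cast h)
    rw [h1, HahnSeries.coeff_zero]
  · have h : f.order = 0 := by exact_mod_cast h.symm
    rw [HahnSeries.leadingCoeff_eq, h] at h'
    exact HahnSeries.coeff_eq_zero_of_lt_order (hl.trans_le (by exact_mod_cast h'))

theorem vM_pos_of_coeff {f : MM L} (h1 : ∀ m < 0, f.coeff m = 0)
    (h2 : ∀ l ≤ 0, (f.coeff 0).coeff l = 0) : 0 < vM L f := by
  by_cases h0 : f = 0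
  · rw [h0, AddValuation.map_zero]; simp
  rw [vM_apply, vMFun_of_ne h0, ← WithTop.coe_zero, WithTop.coe_lt_coe, ← gg_zero, gg_lt_gg]
  have hc : f.coeff f.order ≠ 0 := by
    rw [← HahnSeries.leadingCoeff_eq]; exact HahnSeries.leadingCoeff_ne_zero.2 h0
  have ho : 0 ≤ f.order := by
    by_contra hlt
    exact hc (h1 _ (not_le.1 hlt))
  rcases ho.lt_or_eq with h | h
  · left; exact_mod_cast h
  · right
    refine ⟨by exact_mod_cast h, ?_⟩
    have hc' : f.leadingCoeff.coeff f.leadingCoeff.order ≠ 0 := by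
      rw [← HahnSeries.leadingCoeff_eq]
      exact HahnSeries.leadingCoeff_ne_zero.2 (HahnSeries.leadingCoeff_ne_zero.2 h0)
    by_contra hlt
    apply hc'
    rw [HahnSeries.leadingCoeff_eq, ← h]
    rw [HahnSeries.leadingCoeff_eq, ← h] at hlt
    refine h2 _ ?_
    by_contra h3
    exact hlt (by exact_mod_cast not_le.1 h3)

/-- The residue in `L` of an element of `L((x))((y))` of nonnegative value. -/
noncomputable def resM (f : MM L) : L := (f.coeff 0).coeff 0

theorem vM_sub_resM_pos {f : MM L} (hf : 0 ≤ vM L f) :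
    0 < vM L (f - HahnSeries.C (HahnSeries.C (resM f))) := by
  obtain ⟨h1, h2⟩ := vM_nonneg_coeff hf
  refine vM_pos_of_coeff (fun m hm => ?_) fun l hl => ?_
  · rw [HahnSeries.coeff_sub, h1 m hm, HahnSeries.C_apply, HahnSeries.coeff_single_of_ne hm.ne,
      sub_zero]
  · rcases hl.lt_or_eq with hl | rfl
    · simp [HahnSeries.C_apply, h2 l hl, HahnSeries.coeff_single_of_ne hl.ne]
    · simp [HahnSeries.C_apply, resM]

theorem vM_C_C_nonneg (a : L) : 0 ≤ vM L (HahnSeries.C (HahnSeries.C a)) := by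
  by_cases ha : a = 0
  · simp [ha]
  · rw [vM_C_C ha]

theorem resM_eq_of_pos {f : MM L} {a : L} (h : 0 < vM L (f - HahnSeries.C (HahnSeries.C a))) :
    resM f = a := by
  have hf : 0 ≤ vM L f := by
    have := AddValuation.map_le_add (vM L) h.le (vM_C_C_nonneg a)
    rwa [sub_add_cancel] at this
  have h1 := AddValuation.map_lt_add (vM L) h (by
    rw [AddValuation.map_sub_swap]; exact vM_sub_resM_pos hf)
  by_contra hne
  have e : f - HahnSeries.C (HahnSeries.C a) + (HahnSeries.C (HahnSeries.C (resM f)) - f)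
      = HahnSeries.C (HahnSeries.C (resM f - a)) := by
    rw [map_sub, map_sub]; ring
  rw [e, vM_C_C (sub_ne_zero.2 hne)] at h1
  exact lt_irrefl _ h1

theorem resM_eq_zero_iff {f : MM L} (hf : 0 ≤ vM L f) : resM f = 0 ↔ 0 < vM L f := by
  constructor
  · intro h
    have := vM_sub_resM_pos hf
    rwa [h, map_zero, map_zero, sub_zero] at this
  · intro h
    apply resM_eq_of_pos
    rwa [map_zero, map_zero, sub_zero]

theorem resM_add {f g : MM L} (hf : 0 ≤ vM L f) (hg : 0 ≤ vM L g) :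
    resM (f + g) = resM f + resM g := by
  apply resM_eq_of_pos
  have := AddValuation.map_lt_add (vM L) (vM_sub_resM_pos hf) (vM_sub_resM_pos hg)
  convert this using 2
  rw [map_add, map_add]; ring

theorem resM_mul {f g : MM L} (hf : 0 ≤ vM L f) (hg : 0 ≤ vM L g) :
    resM (f * g) = resM f * resM g := by
  apply resM_eq_of_pos
  have h1 : 0 < vM L ((f - HahnSeries.C (HahnSeries.C (resM f))) * g) := by
    rw [AddValuation.map_mul]
    exact lt_of_lt_of_le (vM_sub_resM_pos hf) (le_add_of_nonneg_right hg)
  have h2 : 0 < vM L (HahnSeries.C (HahnSeries.C (resM f)) *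
      (g - HahnSeries.C (HahnSeries.C (resM g)))) := by
    rw [AddValuation.map_mul]
    exact lt_of_lt_of_le (vM_sub_resM_pos hg) (le_add_of_nonneg_left (vM_C_C_nonneg _))
  have := AddValuation.map_lt_add (vM L) h1 h2
  convert this using 2
  rw [map_mul, map_mul]; ring

theorem resM_C_C (a : L) : resM (HahnSeries.C (HahnSeries.C a) : MM L) = a := by
  apply resM_eq_of_pos
  rw [sub_self, AddValuation.map_zero]; simp

/-- For nonzero a and b the two sides have degrees of different parity. -/
theorem not_sq_one_add_X {a b : RatFunc L} (h : a * a = (1 + RatFunc.X) * (b * b)) :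
    a = 0 ∧ b = 0 := by
  by_cases hb : b = 0
  · rw [hb, mul_zero, mul_zero, mul_self_eq_zero] at h
    exact ⟨h, hb⟩
  exfalso
  have hx : (1 + RatFunc.X : RatFunc L) = algebraMap (Polynomial L) (RatFunc L)
      (Polynomial.X + Polynomial.C 1) := by
    rw [map_add, RatFunc.algebraMap_X, add_comm]; simp
  have hx0 : (1 + RatFunc.X : RatFunc L) ≠ 0 := by
    rw [hx]
    exact (map_ne_zero_iff _ (RatFunc.algebraMap_injective L)).2 (Polynomial.X_add_C_ne_zero 1)
  have ha : a ≠ 0 := by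
    rintro rfl
    rw [mul_zero, eq_comm] at h
    exact mul_ne_zero hx0 (mul_ne_zero hb hb) h
  have hd := congrArg RatFunc.intDegree h
  rw [RatFunc.intDegree_mul ha ha, RatFunc.intDegree_mul hx0 (mul_ne_zero hb hb),
    RatFunc.intDegree_mul hb hb, hx, RatFunc.intDegree_polynomial, Polynomial.natDegree_X_add_C]
    at hd
  push_cast at hd
  omega

/-- The equation of a square root of `1 + x` in `L((x))`. -/
def IsSqrt (r : LaurentSeries L) : Prop := r * r = 1 + HahnSeries.single 1 1

theorem IsSqrt.neg {r : LaurentSeries L} (hr : IsSqrt r) : IsSqrt (-r) := by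
  unfold IsSqrt at *
  rw [neg_mul_neg, hr]

/-- The image of `a + b t` in `L((x))((y))` under `t ↦ r`. -/
noncomputable def ev (r : LaurentSeries L) (a b : FF L) : MM L :=
  mapF L a + HahnSeries.C r * mapF L b

theorem algebraMap_one_add_X :
    coeHom L (1 + RatFunc.X) = 1 + HahnSeries.single 1 1 := by
  rw [map_add, map_one]
  congr 1
  exact RatFunc.coe_X

theorem mapF_one_add_xF {r : LaurentSeries L} (hr : IsSqrt r) :
    mapF L (1 + xF L) = HahnSeries.C r * HahnSeries.C r := by
  rw [← map_mul, hr, ← algebraMap_one_add_X]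
  have : (1 + xF L : FF L) = HahnSeries.C (1 + RatFunc.X) := by rw [map_add, map_one, xF]
  rw [this]
  exact HahnSeries.map_C (Γ := ℤ) (1 + RatFunc.X : RatFunc L)
    (coeHom L)

/-- The coefficient of `ev r a b` at each power of y is a combination of 1 and r over L(x), and
these are linearly independent because 1 + x is not a square in L(x). Since r no longer appears on
the right, conjugate elements have equal y-value. -/
theorem le_wM_ev {r : LaurentSeries L} (hr : IsSqrt r) {a b : FF L} {n : ℤ} :
    (n : WithTop ℤ) ≤ wM L (ev r a b) ↔ (n : WithTop ℤ) ≤ wF L a ∧ (n : WithTop ℤ) ≤ wF L b := by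
  simp only [le_addVal_iff]
  have key : ∀ m, (ev r a b).coeff m = 0 ↔ a.coeff m = 0 ∧ b.coeff m = 0 := by
    intro m
    have e : (ev r a b).coeff m = coeHom L (a.coeff m) +
        r * coeHom L (b.coeff m) := by
      rw [ev, HahnSeries.coeff_add, HahnSeries.C_mul_eq_smul, HahnSeries.coeff_smul]
      rfl
    rw [e]
    constructor
    · intro h
      apply not_sq_one_add_X
      apply (coeHom L).injective
      rw [map_mul, map_mul, map_mul, algebraMap_one_add_X, ← hr, eq_neg_of_add_eq_zero_left h]
      ring
    · rintro ⟨h1, h2⟩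
      rw [h1, h2, map_zero, mul_zero, add_zero]
  constructor
  · intro h
    exact ⟨fun m hm => ((key m).1 (h m hm)).1, fun m hm => ((key m).1 (h m hm)).2⟩
  · rintro ⟨h1, h2⟩ m hm
    exact (key m).2 ⟨h1 m hm, h2 m hm⟩

theorem ev_eq_zero {r : LaurentSeries L} (hr : IsSqrt r) {a b : FF L} (h : ev r a b = 0) :
    a = 0 ∧ b = 0 := by
  have h1 : ∀ n : ℤ, (n : WithTop ℤ) ≤ wF L a ∧ (n : WithTop ℤ) ≤ wF L b := fun n => by
    rw [← le_wM_ev hr, h, AddValuation.map_zero]; exact le_top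
  have h2 : ∀ f : FF L, (∀ n : ℤ, (n : WithTop ℤ) ≤ wF L f) → f = 0 := by
    intro f hf
    by_contra hne
    have := hf (f.order + 1)
    rw [HahnSeries.addVal_apply_of_ne hne, WithTop.coe_le_coe] at this
    omega
  exact ⟨h2 a fun n => (h1 n).1, h2 b fun n => (h1 n).2⟩

theorem exists_isSqrt (h2 : (2 : L) ≠ 0) : ∃ s : LaurentSeries L, IsSqrt s ∧
    vM L (HahnSeries.C (1 + s)) = 0 ∧
    vM L (HahnSeries.C (1 - s)) = ((gg 1 0 : GG) : WithTop GG) := by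
  have h4 : (4 : L) ≠ 0 := by
    have : (4 : L) = 2 * 2 := by norm_num
    rw [this]; exact mul_ne_zero h2 h2
  -- The Catalan series satisfies C = 1 + xC²; rescaling by -1/4 gives c = 1 - xc²/4, and then 1 +
  -- xc/2 squares to 1 + x. Only division by 2 is needed, so the formula works in every
  -- characteristic other than 2.
  let c : PowerSeries L := PowerSeries.rescale (-(4⁻¹ : L))
    (PowerSeries.map (Nat.castRingHom L) PowerSeries.catalanSeries)
  have hc : c * c * (PowerSeries.C (-(4⁻¹ : L)) * PowerSeries.X) + 1 = c := by
    have := congrArg (fun f => PowerSeries.rescale (-(4⁻¹ : L))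
      (PowerSeries.map (Nat.castRingHom L) f)) PowerSeries.catalanSeries_sq_mul_X_add_one
    simpa [pow_two, PowerSeries.rescale_X] using this
  have hc0 : PowerSeries.constantCoeff c = 1 := by
    rw [← PowerSeries.coeff_zero_eq_constantCoeff_apply, PowerSeries.coeff_rescale]
    simp
  let s : PowerSeries L := 1 + PowerSeries.C (2⁻¹ : L) * PowerSeries.X * c
  have hC : PowerSeries.C (-(4⁻¹ : L)) = - (PowerSeries.C (2⁻¹ : L) * PowerSeries.C (2⁻¹ : L)) := by
    rw [← map_mul, ← map_neg]
    congr 2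
    rw [← mul_inv]; norm_num
  have hC2 : (2 : PowerSeries L) * PowerSeries.C (2⁻¹ : L) = 1 := by
    have : (2 : PowerSeries L) = PowerSeries.C (2 : L) := (map_ofNat PowerSeries.C 2).symm
    rw [this, ← map_mul, mul_inv_cancel₀ h2, map_one]
  have hs : s * s = 1 + PowerSeries.X := by
    rw [hC] at hc
    simp only [s]
    linear_combination (-PowerSeries.X) * hc + PowerSeries.X * c * hC2
  let s' : LaurentSeries L := HahnSeries.ofPowerSeries ℤ L s
  have hs' : IsSqrt s' := by
    unfold IsSqrt
    rw [← map_mul, hs, map_add, map_one]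
    congr 1
    exact PowerSeries.coe_X
  have hcoe : ∀ f : PowerSeries L, PowerSeries.constantCoeff f ≠ 0 →
      (HahnSeries.ofPowerSeries ℤ L f).order = 0 := by
    intro f hf
    have e0 : (HahnSeries.ofPowerSeries ℤ L f).coeff 0 = PowerSeries.constantCoeff f := by
      have := LaurentSeries.coeff_coe_powerSeries f 0
      rw [PowerSeries.coeff_zero_eq_constantCoeff_apply] at this
      exact_mod_cast this
    apply le_antisymm (HahnSeries.order_le_of_coeff_ne_zero (by rwa [e0]))
    have hne : HahnSeries.ofPowerSeries ℤ L f ≠ 0 := by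
      intro h; rw [h] at e0; exact hf (by rw [← e0]; rfl)
    by_contra hlt
    rw [not_le] at hlt
    have h3 : (HahnSeries.ofPowerSeries ℤ L f).coeff (HahnSeries.ofPowerSeries ℤ L f).order ≠ 0 := by
      rw [← HahnSeries.leadingCoeff_eq]; exact HahnSeries.leadingCoeff_ne_zero.2 hne
    apply h3
    have := PowerSeries.coeff_coe (R := L) f (HahnSeries.ofPowerSeries ℤ L f).order
    rwa [if_pos hlt] at this
  have o1 : (1 + s').order = 0 := by
    have : 1 + s' = HahnSeries.ofPowerSeries ℤ L (1 + s) := by rw [map_add, map_one]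
    rw [this]
    apply hcoe
    simp only [s, map_add, map_one, map_mul, PowerSeries.constantCoeff_X]
    rw [mul_zero, zero_mul, add_zero]
    norm_num [h2]
  have hx : (HahnSeries.single (1 : ℤ) (1 : L)) ≠ 0 := HahnSeries.single_ne_zero one_ne_zero
  -- Orders add in this product, and 1 + s has constant term 2 ≠ 0; so all of the order of x falls
  -- on 1 - s.
  have e1 : (1 + s') * (1 - s') = -HahnSeries.single 1 1 := by
    have : s' * s' = 1 + HahnSeries.single 1 1 := hs'
    linear_combination -this
  have n1 : 1 + s' ≠ 0 := by
    intro h; rw [h, zero_mul, eq_comm, neg_eq_zero] at e1; exact hx e1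
  have n2 : 1 - s' ≠ 0 := by
    intro h; rw [h, mul_zero, eq_comm, neg_eq_zero] at e1; exact hx e1
  have o2 : (1 - s').order = 1 := by
    have := HahnSeries.order_mul n1 n2
    rw [e1, HahnSeries.order_neg, HahnSeries.order_single one_ne_zero, o1, zero_add] at this
    exact this.symm
  refine ⟨s', hs', ?_, ?_⟩
  · rw [vM_C n1, o1]; simp [gg]
  · rw [vM_C n2, o2]; simp

end LaurentFields

/-! ### Matrix entries of D, the reduced norm, and the y-adic valuation of D -/

section QuaternionStructure

variable {L : Type u₁} [Field L]

/-- The first row, first column entry of the image of `z` in `M₂(L((x))((y)))`. -/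
noncomputable def pD (r : LaurentSeries L) (z : DD L) : MM L := ev r z.re z.imI

/-- The first row, second column entry (up to `y`) of the image of `z` in `M₂(L((x))((y)))`. -/
noncomputable def qD (r : LaurentSeries L) (z : DD L) : MM L := ev r z.imJ z.imK

variable (L) in
/-- The element `y` of `L((x))((y))`. -/
noncomputable def yM : MM L := mapF L (yF L)

variable (L) in
/-- The value of `x`. -/
def X1 : GG := gg 1 0

variable (L) in
/-- The value of `y`. -/
def Y1 : GG := gg 0 1

theorem X1_pos : (0 : GG) < X1 := by
  rw [← gg_zero, X1, gg_lt_gg]; simp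

section
variable {r : LaurentSeries L} (z w : DD L)

theorem pD_add : pD r (z + w) = pD r z + pD r w := by
  simp only [pD, ev, QuaternionAlgebra.re_add, QuaternionAlgebra.imI_add, map_add]; ring

theorem qD_add : qD r (z + w) = qD r z + qD r w := by
  simp only [qD, ev, QuaternionAlgebra.imJ_add, QuaternionAlgebra.imK_add, map_add]; ring

theorem pD_neg : pD r (-z) = -pD r z := by
  simp only [pD, ev, QuaternionAlgebra.re_neg, QuaternionAlgebra.imI_neg, map_neg]; ring

theorem qD_neg : qD r (-z) = -qD r z := by
  simp only [qD, ev, QuaternionAlgebra.imJ_neg, QuaternionAlgebra.imK_neg, map_neg]; ring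

theorem pD_sub : pD r (z - w) = pD r z - pD r w := by
  rw [sub_eq_add_neg, pD_add, pD_neg, sub_eq_add_neg]

theorem qD_sub : qD r (z - w) = qD r z - qD r w := by
  rw [sub_eq_add_neg, qD_add, qD_neg, sub_eq_add_neg]

theorem pD_smul (c : FF L) : pD r (c • z) = mapF L c * pD r z := by
  simp only [pD, ev, QuaternionAlgebra.re_smul, QuaternionAlgebra.imI_smul, smul_eq_mul, map_mul]
  ring

theorem qD_smul (c : FF L) : qD r (c • z) = mapF L c * qD r z := by
  simp only [qD, ev, QuaternionAlgebra.imJ_smul, QuaternionAlgebra.imK_smul, smul_eq_mul, map_mul]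
  ring

@[simp]
theorem pD_zero : pD r 0 = 0 := by
  simp [pD, ev]

@[simp]
theorem qD_zero : qD r 0 = 0 := by
  simp [qD, ev]

@[simp]
theorem pD_one : pD r 1 = 1 := by
  simp [pD, ev]

@[simp]
theorem qD_one : qD r 1 = 0 := by
  simp [qD, ev]

@[simp]
theorem pD_algebraMap (c : FF L) : pD r (algebraMap (FF L) (DD L) c) = mapF L c := by
  simp [pD, ev, QuaternionAlgebra.coe_algebraMap]

/-- This is the product of the matrices with rows (p, qy) and (q', p'), the dashed entries being
those for `-r`. -/
theorem pD_mul (hr : IsSqrt r) : pD r (z * w) = pD r z * pD r w + yM L * qD r z * qD (-r) w := by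
  simp only [pD, qD, ev, yM, QuaternionAlgebra.re_mul, QuaternionAlgebra.imI_mul, map_add, map_sub,
    map_mul, map_neg, map_zero, map_one]
  have := mapF_one_add_xF hr
  rw [map_add, map_one] at this
  linear_combination (mapF L z.imI * mapF L w.imI - mapF L (yF L) * mapF L z.imK * mapF L w.imK)
    * this

theorem qD_mul (hr : IsSqrt r) : qD r (z * w) = pD r z * qD r w + qD r z * pD (-r) w := by
  simp only [pD, qD, ev, QuaternionAlgebra.imJ_mul, QuaternionAlgebra.imK_mul, map_add, map_sub,
    map_mul, map_neg, map_zero, map_one]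
  have := mapF_one_add_xF hr
  rw [map_add, map_one] at this
  linear_combination (mapF L z.imI * mapF L w.imK - mapF L z.imK * mapF L w.imI) * this

theorem pD_star : pD r (star z) = pD (-r) z := by
  simp only [pD, ev, QuaternionAlgebra.re_star, QuaternionAlgebra.imI_star, zero_mul, add_zero,
    map_neg]
  ring

theorem qD_star : qD r (star z) = -qD r z := by
  simp only [qD, ev, QuaternionAlgebra.imJ_star, QuaternionAlgebra.imK_star, map_neg]
  ring

/-- The reduced norm. -/
noncomputable def nrd (z : DD L) : FF L :=
  z.re * z.re - (1 + xF L) * (z.imI * z.imI) -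
    yF L * (z.imJ * z.imJ - (1 + xF L) * (z.imK * z.imK))

theorem mul_star_eq_nrd : z * star z = algebraMap (FF L) (DD L) (nrd z) := by
  rw [QuaternionAlgebra.coe_algebraMap]
  refine QuaternionAlgebra.ext ?_ ?_ ?_ ?_ <;> simp [nrd] <;> ring

theorem star_mul_eq_nrd : star z * z = algebraMap (FF L) (DD L) (nrd z) := by
  rw [QuaternionAlgebra.coe_algebraMap]
  refine QuaternionAlgebra.ext ?_ ?_ ?_ ?_ <;> simp [nrd] <;> ring

theorem add_star_eq_trd : z + star z = algebraMap (FF L) (DD L) (2 * z.re) := by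
  rw [QuaternionAlgebra.coe_algebraMap]
  refine QuaternionAlgebra.ext ?_ ?_ ?_ ?_ <;> simp [two_mul]

theorem nrd_mul : nrd (z * w) = nrd z * nrd w := by
  simp [nrd]; ring

theorem nrd_algebraMap (c : FF L) : nrd (algebraMap (FF L) (DD L) c) = c * c := by
  simp [nrd, QuaternionAlgebra.coe_algebraMap]

theorem mapF_nrd (hr : IsSqrt r) :
    mapF L (nrd z) = pD r z * pD (-r) z - yM L * qD r z * qD (-r) z := by
  simp only [pD, qD, ev, nrd, yM, map_sub, map_mul, map_neg]
  rw [mapF_one_add_xF hr]; ring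

/-- Twice the extension to `D` of the `y`-adic valuation. -/
noncomputable def om (z : DD L) : WithTop ℤ := wF L (nrd z)

theorem om_mul : om (z * w) = om z + om w := by
  rw [om, nrd_mul, AddValuation.map_mul]; rfl

theorem om_algebraMap (c : FF L) : om (algebraMap (FF L) (DD L) c) = wF L c + wF L c := by
  rw [om, nrd_algebraMap, AddValuation.map_mul]

theorem om_one : om (1 : DD L) = 0 := by
  simp [om, nrd]

theorem wM_ev_neg (hr : IsSqrt r) (a b : FF L) : wM L (ev (-r) a b) = wM L (ev r a b) := by
  refine le_antisymm ?_ ?_ <;> refine WithTop.forall_coe_le_iff_le.1 fun n hn => ?_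
  · exact (le_wM_ev hr).2 ((le_wM_ev hr.neg).1 hn)
  · exact (le_wM_ev hr.neg).2 ((le_wM_ev hr).1 hn)

theorem wF_yF : wF L (yF L) = ((1 : ℤ) : WithTop ℤ) := by
  rw [HahnSeries.addVal_apply, yF, HahnSeries.orderTop_single one_ne_zero]

theorem wM_yM : wM L (yM L) = ((1 : ℤ) : WithTop ℤ) := by
  rw [yM, wM_mapF, wF_yF]

theorem vF_yF : vF L (yF L) = ((Y1 : GG) : WithTop GG) := by
  have : (yF L) ≠ 0 := HahnSeries.single_ne_zero one_ne_zero
  rw [vF_apply, vFun_of_ne this, yF, HahnSeries.leadingCoeff_of_single,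
    HahnSeries.order_single one_ne_zero]
  simp [ordX, Y1]

theorem vM_yM : vM L (yM L) = ((Y1 : GG) : WithTop GG) := by
  rw [yM, vM_mapF, vF_yF]

theorem vF_xF : vF L (xF L) = ((X1 : GG) : WithTop GG) := by
  have : (xF L) ≠ 0 := HahnSeries.C_ne_zero RatFunc.X_ne_zero
  rw [vF_apply, vFun_of_ne this, xF, HahnSeries.C_apply, HahnSeries.leadingCoeff_of_single,
    HahnSeries.order_single RatFunc.X_ne_zero]
  rw [ordX, RatFunc.coe_X, HahnSeries.order_single one_ne_zero]
  simp [X1]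

theorem wF_xF : wF L (xF L) = 0 := by
  rw [HahnSeries.addVal_apply, xF, HahnSeries.C_apply, HahnSeries.orderTop_single RatFunc.X_ne_zero]
  rfl

/-- Conjugate entries have the same y-value, so pp' has even and yqq' odd value. The two terms of
the norm cannot cancel. -/
theorem om_eq (hr : IsSqrt r) : om z = min (wM L (pD r z) + wM L (pD r z))
    (1 + (wM L (qD r z) + wM L (qD r z))) := by
  have h1 : wM L (pD r z * pD (-r) z) = wM L (pD r z) + wM L (pD r z) := by
    rw [AddValuation.map_mul]; congr 1; exact wM_ev_neg hr _ _
  have h2 : wM L (yM L * qD r z * qD (-r) z) = 1 + (wM L (qD r z) + wM L (qD r z)) := by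
    rw [AddValuation.map_mul, AddValuation.map_mul, wM_yM, add_assoc]
    congr 2; exact wM_ev_neg hr _ _
  rw [om, ← wM_mapF, mapF_nrd z hr, ← h1, ← h2]
  by_cases h0 : pD r z = 0 ∧ qD r z = 0
  · rw [h0.1, h0.2]; simp
  · rw [sub_eq_add_neg, AddValuation.map_add_of_distinct_val, AddValuation.map_neg]
    rw [AddValuation.map_neg, h1, h2]
    rw [← AddValuation.top_iff (wM L), ← AddValuation.top_iff (wM L)] at h0
    generalize wM L (pD r z) = P at *
    generalize wM L (qD r z) = Q at *
    induction P using WithTop.recTopCoe <;> induction Q using WithTop.recTopCoe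
    · simp at h0
    · exact ne_of_beq_false rfl
    · exact ne_of_beq_false rfl
    · norm_cast; omega

theorem le_om_even (hr : IsSqrt r) (n : ℤ) : ((2 * n : ℤ) : WithTop ℤ) ≤ om z ↔
    (n : WithTop ℤ) ≤ wM L (pD r z) ∧ (n : WithTop ℤ) ≤ wM L (qD r z) := by
  rw [om_eq z hr, le_min_iff]
  generalize wM L (pD r z) = P
  generalize wM L (qD r z) = Q
  refine and_congr ?_ ?_
  · induction P using WithTop.recTopCoe
    · simp
    · norm_cast; omega
  · induction Q using WithTop.recTopCoe
    · simp
    · norm_cast; omega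

theorem le_om_odd (hr : IsSqrt r) (n : ℤ) : ((2 * n + 1 : ℤ) : WithTop ℤ) ≤ om z ↔
    ((n + 1 : ℤ) : WithTop ℤ) ≤ wM L (pD r z) ∧ (n : WithTop ℤ) ≤ wM L (qD r z) := by
  rw [om_eq z hr, le_min_iff]
  generalize wM L (pD r z) = P
  generalize wM L (qD r z) = Q
  refine and_congr ?_ ?_
  · induction P using WithTop.recTopCoe
    · simp
    · norm_cast; omega
  · induction Q using WithTop.recTopCoe
    · simp
    · norm_cast; omega

variable {z w} in
-- For a fixed threshold, even or odd, the condition on `om` is a pair of separate bounds on p and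
-- q, and these are additive.
theorem le_om_add (hr : IsSqrt r) {n : ℤ} (hz : (n : WithTop ℤ) ≤ om z)
    (hw : (n : WithTop ℤ) ≤ om w) : (n : WithTop ℤ) ≤ om (z + w) := by
  obtain ⟨m, rfl | rfl⟩ := Int.even_or_odd' n
  · rw [le_om_even _ hr] at *
    rw [pD_add, qD_add]
    exact ⟨AddValuation.map_le_add _ hz.1 hw.1, AddValuation.map_le_add _ hz.2 hw.2⟩
  · rw [le_om_odd _ hr] at *
    rw [pD_add, qD_add]
    exact ⟨AddValuation.map_le_add _ hz.1 hw.1, AddValuation.map_le_add _ hz.2 hw.2⟩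

theorem om_neg : om (-z) = om z := by
  have h : nrd (-z) = nrd z := by
    simp only [nrd, QuaternionAlgebra.re_neg, QuaternionAlgebra.imI_neg,
      QuaternionAlgebra.imJ_neg, QuaternionAlgebra.imK_neg]
    ring
  rw [om, h, om]

theorem om_nonneg_iff (hr : IsSqrt r) :
    0 ≤ om z ↔ 0 ≤ wM L (pD r z) ∧ 0 ≤ wM L (qD r z) := by
  have := le_om_even z hr 0
  simpa using this

theorem om_pos_iff (hr : IsSqrt r) :
    1 ≤ om z ↔ 1 ≤ wM L (pD r z) ∧ 0 ≤ wM L (qD r z) := by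
  have := le_om_odd z hr 0
  simpa using this

theorem om_nonneg_iff_coords (hr : IsSqrt r) :
    0 ≤ om z ↔ (0 ≤ wF L z.re ∧ 0 ≤ wF L z.imI) ∧ 0 ≤ wF L z.imJ ∧ 0 ≤ wF L z.imK := by
  rw [om_nonneg_iff z hr]
  exact and_congr (le_wM_ev (n := 0) hr) (le_wM_ev (n := 0) hr)

variable {z} in
-- A vanishing norm would give p and q infinite y-value, and p = q = 0 forces all four coordinates
-- to vanish. Otherwise the conjugate divided by the norm is an inverse.
theorem isUnit_of_ne_zero (hr : IsSqrt r) (hz : z ≠ 0) : IsUnit z := by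
  have hn : nrd z ≠ 0 := by
    intro h0
    have h1 : ∀ n : ℤ, ((2 * n : ℤ) : WithTop ℤ) ≤ om z := fun n => by
      rw [om, h0, AddValuation.map_zero]; exact le_top
    apply hz
    have h2 : pD r z = 0 ∧ qD r z = 0 := by
      constructor
      · rw [← AddValuation.top_iff (wM L), ← top_le_iff]
        exact WithTop.forall_coe_le_iff_le.1 fun n _ => ((le_om_even z hr n).1 (h1 n)).1
      · rw [← AddValuation.top_iff (wM L), ← top_le_iff]
        exact WithTop.forall_coe_le_iff_le.1 fun n _ => ((le_om_even z hr n).1 (h1 n)).2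
    obtain ⟨h3, h4⟩ := ev_eq_zero hr h2.1
    obtain ⟨h5, h6⟩ := ev_eq_zero hr h2.2
    exact QuaternionAlgebra.ext h3 h4 h5 h6
  have e : ∀ c : DD L, algebraMap (FF L) (DD L) (nrd z)⁻¹ * (algebraMap (FF L) (DD L) (nrd z) * c)
      = c := fun c => by
    rw [← mul_assoc, ← map_mul, inv_mul_cancel₀ hn, map_one, one_mul]
  refine ⟨⟨z, algebraMap (FF L) (DD L) (nrd z)⁻¹ * star z, ?_, ?_⟩, rfl⟩
  · rw [← mul_assoc, ← Algebra.commutes, mul_assoc, mul_star_eq_nrd]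
    simpa using e 1
  · rw [mul_assoc, star_mul_eq_nrd]
    simpa using e 1

theorem om_unit (u : (DD L)ˣ) : om (u : DD L) + om ((u⁻¹ : (DD L)ˣ) : DD L) = 0 := by
  rw [← om_mul, Units.mul_inv, om_one]

theorem exists_om_unit (u : (DD L)ˣ) : ∃ n : ℤ, om (u : DD L) = (n : WithTop ℤ) ∧
    om ((u⁻¹ : (DD L)ˣ) : DD L) = ((-n : ℤ) : WithTop ℤ) := by
  have h := om_unit u
  generalize om (u : DD L) = P at *
  generalize om ((u⁻¹ : (DD L)ˣ) : DD L) = Q at *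
  induction P using WithTop.recTopCoe
  · simp at h
  induction Q using WithTop.recTopCoe
  · simp at h
  · rename_i a b
    refine ⟨a, rfl, ?_⟩
    norm_cast at h ⊢
    omega

end

/-! ### Comparison of the rank 2 valuations with the y-adic ones -/

section Comparison

theorem wM_nonneg_of_vM_nonneg {f : MM L} (h : 0 ≤ vM L f) : 0 ≤ wM L f := by
  by_cases h0 : f = 0
  · rw [h0, AddValuation.map_zero]; exact le_top
  obtain ⟨l, m, h1, h2⟩ := exists_vM_eq h0
  rw [h1, ← WithTop.coe_zero, WithTop.coe_le_coe, ← gg_zero, gg_le_gg] at h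
  rw [h2]
  norm_cast at h ⊢
  omega

theorem vM_pos_of_wM_pos {f : MM L} (h : 1 ≤ wM L f) : 0 < vM L f := by
  by_cases h0 : f = 0
  · rw [h0, AddValuation.map_zero]; exact WithTop.coe_lt_top _
  obtain ⟨l, m, h1, h2⟩ := exists_vM_eq h0
  rw [h2] at h
  rw [h1, ← WithTop.coe_zero, WithTop.coe_lt_coe, ← gg_zero, gg_lt_gg]
  left
  norm_cast at h ⊢

theorem wF_nonneg_of_vF_nonneg {f : FF L} (h : 0 ≤ vF L f) : 0 ≤ wF L f := by
  rw [← wM_mapF]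
  rw [← vM_mapF] at h
  exact wM_nonneg_of_vM_nonneg h

theorem vF_pos_of_wF_pos {f : FF L} (h : 1 ≤ wF L f) : 0 < vF L f := by
  rw [← wM_mapF] at h
  rw [← vM_mapF]
  exact vM_pos_of_wM_pos h

variable {r : LaurentSeries L}

theorem one_le_wM_yM_mul {f g : MM L} (hf : 0 ≤ wM L f) (hg : 0 ≤ wM L g) :
    1 ≤ wM L (yM L * f * g) := by
  rw [AddValuation.map_mul, AddValuation.map_mul, wM_yM, add_assoc]
  exact le_add_of_nonneg_right (add_nonneg hf hg)

end Comparison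

/-! ### The rings `WD` and `BD`: totality, residue field, center -/

section Subrings

variable {r : LaurentSeries L}

/-- The valuation ring of the `y`-adic valuation of `D`. -/
def WD (hr : IsSqrt r) : Subring (DD L) where
  carrier := {z | 0 ≤ om z}
  mul_mem' {z w} hz hw := by
    change 0 ≤ om (z * w)
    rw [om_mul]
    exact add_nonneg hz hw
  one_mem' := om_one.ge
  add_mem' {z w} hz hw := le_om_add (n := 0) hr hz hw
  zero_mem' := by
    change 0 ≤ om (0 : DD L)
    simp [om, nrd]
  neg_mem' {z} hz := by
    change 0 ≤ om (-z)
    rwa [om_neg]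

/-- The extension to `D` of the valuation ring `V` determined by the root `r` of `1 + x`. -/
def BD (hr : IsSqrt r) : Subring (DD L) where
  carrier := {z | 0 ≤ om z ∧ 0 ≤ vM L (pD r z)}
  mul_mem' {z w} hz hw := by
    refine ⟨(WD hr).mul_mem hz.1 hw.1, ?_⟩
    rw [pD_mul _ _ hr]
    refine AddValuation.map_le_add _ ?_ (vM_pos_of_wM_pos (one_le_wM_yM_mul ?_ ?_)).le
    · rw [AddValuation.map_mul]
      exact add_nonneg hz.2 hw.2
    · exact ((om_nonneg_iff _ hr).1 hz.1).2
    · exact ((om_nonneg_iff _ hr.neg).1 hw.1).2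
  one_mem' := ⟨om_one.ge, by rw [pD_one, AddValuation.map_one]⟩
  add_mem' {z w} hz hw := ⟨(WD hr).add_mem hz.1 hw.1, by
    rw [pD_add]; exact AddValuation.map_le_add _ hz.2 hw.2⟩
  zero_mem' := ⟨(WD hr).zero_mem, by simp⟩
  neg_mem' {z} hz := ⟨(WD hr).neg_mem hz.1, by
    rw [pD_neg, AddValuation.map_neg]; exact hz.2⟩

theorem mem_WD (hr : IsSqrt r) {z : DD L} : z ∈ WD hr ↔ 0 ≤ om z := Iff.rfl

theorem mem_BD (hr : IsSqrt r) {z : DD L} : z ∈ BD hr ↔ 0 ≤ om z ∧ 0 ≤ vM L (pD r z) := Iff.rfl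

theorem BD_le_WD (hr : IsSqrt r) : BD hr ≤ WD hr := fun _ h => h.1

theorem mem_BD_of_om_pos (hr : IsSqrt r) {z : DD L} (h : 1 ≤ om z) : z ∈ BD hr :=
  ⟨zero_le_one.trans h, (vM_pos_of_wM_pos ((om_pos_iff z hr).1 h).1).le⟩

/-- The error term yqq' has y-value at least 1. So p is multiplicative on `WD` up to elements of
positive value, which makes `BD` total and its residue map a ring homomorphism. -/
theorem wM_pD_mul_sub (hr : IsSqrt r) {z w : DD L} (hz : 0 ≤ om z) (hw : 0 ≤ om w) :
    0 < vM L (pD r (z * w) - pD r z * pD r w) := by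
  rw [pD_mul _ _ hr, add_sub_cancel_left]
  exact vM_pos_of_wM_pos (one_le_wM_yM_mul ((om_nonneg_iff _ hr).1 hz).2
    ((om_nonneg_iff _ hr.neg).1 hw).2)

theorem one_le_iff_pos {n : WithTop ℤ} : 1 ≤ n ↔ 0 < n := by
  induction n using WithTop.recTopCoe
  · simp
  · norm_cast

theorem vM_pD_unit (hr : IsSqrt r) {u : (DD L)ˣ} (hu : om (u : DD L) = 0) :
    vM L (pD r u) + vM L (pD r (u⁻¹ : (DD L)ˣ)) = 0 := by
  have h1 : om ((u⁻¹ : (DD L)ˣ) : DD L) = 0 := by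
    have := om_unit u
    rwa [hu, zero_add] at this
  have h2 := wM_pD_mul_sub hr hu.ge h1.ge
  rw [Units.mul_inv, pD_one] at h2
  have h3 := AddValuation.map_eq_of_lt_sub (vM L) (x := 1)
    (y := pD r u * pD r (u⁻¹ : (DD L)ˣ)) (by
      rw [AddValuation.map_one, AddValuation.map_sub_swap]; exact h2)
  rw [AddValuation.map_mul, AddValuation.map_one] at h3
  exact h3

theorem isTotal_WD (hr : IsSqrt r) : IsTotalValuationRing (WD hr) := by
  intro u
  obtain ⟨n, h1, h2⟩ := exists_om_unit u
  rw [mem_WD, mem_WD, h1, h2]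
  norm_cast
  omega

theorem isTotal_BD (hr : IsSqrt r) : IsTotalValuationRing (BD hr) := by
  intro u
  obtain ⟨n, h1, h2⟩ := exists_om_unit u
  -- If `om` is nonzero, one of the unit and its inverse has positive `om` and lies in `BD` already;
  -- only for `om` equal to 0 does the value of p decide.
  rcases lt_trichotomy n 0 with h | h | h
  · right
    apply mem_BD_of_om_pos
    rw [h2]
    norm_cast
    omega
  · subst h
    have h3 := vM_pD_unit hr h1
    rw [mem_BD, mem_BD, h1, h2]
    by_cases h4 : 0 ≤ vM L (pD r u)
    · exact Or.inl ⟨le_rfl, h4⟩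
    · right
      refine ⟨le_rfl, ?_⟩
      by_contra h5
      rw [not_le] at h4 h5
      have h6 := (add_le_of_nonpos_right h5.le).trans_lt h4
      rw [h3] at h6
      exact lt_irrefl _ h6
  · left
    apply mem_BD_of_om_pos
    rw [h1]
    norm_cast

/-- The residue homomorphism of `BD hr`. -/
noncomputable def resBD (hr : IsSqrt r) : BD hr →+* L where
  toFun z := resM (pD r z.1)
  map_one' := by
    have := resM_C_C (L := L) 1
    simpa using this
  map_mul' z w := by
    change resM (pD r (z.1 * w.1)) = _
    rw [← resM_mul z.2.2 w.2.2]
    have h1 := wM_pD_mul_sub hr z.2.1 w.2.1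
    have h2 : 0 ≤ vM L (pD r z.1 * pD r w.1) := by
      rw [AddValuation.map_mul]; exact add_nonneg z.2.2 w.2.2
    have h3 := (resM_eq_zero_iff h1.le).2 h1
    have h4 := resM_add h1.le h2
    rwa [sub_add_cancel, h3, zero_add] at h4
  map_zero' := by
    change resM (pD r 0) = 0
    rw [pD_zero, resM_eq_zero_iff (by simp)]
    simp
  map_add' z w := by
    change resM (pD r (z.1 + w.1)) = _
    rw [pD_add, resM_add z.2.2 w.2.2]

theorem vF_C_C_nonneg (a : L) : 0 ≤ vF L (HahnSeries.C (RatFunc.C a)) ∧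
    mapF L (HahnSeries.C (RatFunc.C a)) = HahnSeries.C (HahnSeries.C a) := by
  have h : mapF L (HahnSeries.C (RatFunc.C a)) = HahnSeries.C (HahnSeries.C a) := by
    have h1 : mapF L (HahnSeries.C (RatFunc.C a)) = HahnSeries.C (coeHom L (RatFunc.C a)) :=
      HahnSeries.map_C (Γ := ℤ) (RatFunc.C a) (coeHom L)
    have h2 : coeHom L (RatFunc.C a) = HahnSeries.C a := by
      have h3 := RatFunc.coe_coe (Polynomial.C a)
      have h4 : ((Polynomial.C a : Polynomial L) : RatFunc L) = RatFunc.C a :=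
        RatFunc.algebraMap_C a
      rw [h4] at h3
      change _ = coeHom L (RatFunc.C a) at h3
      rw [← h3, Polynomial.coe_C]
      exact PowerSeries.coe_C a
    rw [h1, h2]
  refine ⟨?_, h⟩
  rw [← vM_mapF, h]
  exact vM_C_C_nonneg a

theorem algebraMap_mem_BD (hr : IsSqrt r) {c : FF L} :
    algebraMap (FF L) (DD L) c ∈ BD hr ↔ 0 ≤ vF L c := by
  rw [mem_BD, om_algebraMap, pD_algebraMap, vM_mapF]
  refine ⟨fun h => h.2, fun h => ⟨?_, h⟩⟩
  exact add_nonneg (wF_nonneg_of_vF_nonneg h) (wF_nonneg_of_vF_nonneg h)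

theorem resBD_surjective (hr : IsSqrt r) : Function.Surjective (resBD hr) := by
  intro a
  obtain ⟨h1, h2⟩ := vF_C_C_nonneg a
  refine ⟨⟨_, (algebraMap_mem_BD hr).2 h1⟩, ?_⟩
  change resM (pD r (algebraMap (FF L) (DD L) _)) = a
  rw [pD_algebraMap, h2, resM_C_C]

/-- Take the kernel of `f` as the ideal. For s outside B the multiplier on both sides is the inverse
of s, since the product 1 is not in the kernel. -/
theorem isDubrovin_of_isTotal {A : Type*} [Ring A] (hA : ∀ a : A, a ≠ 0 → IsUnit a) {B : Subring A}
    (hB : IsTotalValuationRing B) {K : Type*} [Field K] (f : B →+* K)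
    (hf : Function.Surjective f) : IsDubrovin B := by
  let e := RingHom.quotientKerEquivOfSurjective hf
  refine ⟨RingHom.ker f, inferInstance, IsSimpleRing.of_ringEquiv e.symm inferInstance,
    e.symm.surjective.isArtinianRing, fun s hs => ?_⟩
  have hs0 : s ≠ 0 := fun h => hs (h ▸ B.zero_mem)
  obtain ⟨u, rfl⟩ := hA s hs0
  have hu := (hB u).resolve_left hs
  have key : ∀ x : B, x.1 = 1 → x ∉ RingHom.ker f := by
    intro x hx
    have : x = 1 := Subtype.ext hx
    rw [RingHom.mem_ker, this, map_one]
    exact one_ne_zero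
  refine ⟨⟨⟨_, hu⟩, ?_, key _ (Units.inv_mul u)⟩, ⟨⟨_, hu⟩, ?_, key _ (Units.mul_inv u)⟩⟩
  · simp [B.one_mem]
  · simp [B.one_mem]

theorem isDubrovin_BD (hr : IsSqrt r) : IsDubrovin (BD hr) :=
  isDubrovin_of_isTotal (fun _ => isUnit_of_ne_zero hr) (isTotal_BD hr) (resBD hr)
    (resBD_surjective hr)

variable (L) in
/-- The quaternion `i`. -/
noncomputable def iD : DD L := ⟨0, 1, 0, 0⟩

variable (L) in
/-- The quaternion `j`. -/
noncomputable def jD : DD L := ⟨0, 0, 1, 0⟩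

/-- Commuting with i kills the j and k coordinates and commuting with j kills the i coordinate,
because 2 and 1 + x are nonzero. So a central element is a scalar. -/
theorem hasCenter_of (hL : (2 : L) ≠ 0) {S : Subring (DD L)} {V : Subring (FF L)}
    (hi : iD L ∈ S) (hj : jD L ∈ S)
    (hS : ∀ c, algebraMap (FF L) (DD L) c ∈ S ↔ c ∈ V) : HasCenter S V := by
  have h2 : (2 : FF L) ≠ 0 := by
    have := (map_ne_zero ((HahnSeries.C : RatFunc L →+* FF L).comp RatFunc.C)).2 hL
    rwa [map_ofNat] at this
  unfold HasCenter
  ext z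
  rw [Subring.mem_map, Subring.mem_map]
  constructor
  · rintro ⟨a, ha, rfl⟩
    rw [Subring.mem_center_iff] at ha
    have h1 := congrArg Subtype.val (ha ⟨_, hi⟩)
    have h3 := congrArg Subtype.val (ha ⟨_, hj⟩)
    change iD L * a.1 = a.1 * iD L at h1
    change jD L * a.1 = a.1 * jD L at h3
    have e1 : a.1.imJ = 0 := by
      have := congrArg QuaternionAlgebra.imK h1
      simp [iD] at this
      have h4 : 2 * a.1.imJ = 0 := by linear_combination this
      exact (mul_eq_zero.1 h4).resolve_left h2
    have hx : (1 + xF L) ≠ 0 := by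
      intro h0
      have := congrArg (fun f : FF L => f.coeff 0) h0
      simp only [HahnSeries.coeff_add, HahnSeries.coeff_one, if_true, HahnSeries.coeff_zero, xF,
        HahnSeries.C_apply, HahnSeries.coeff_single_same] at this
      have h5 := not_sq_one_add_X (a := (0 : RatFunc L)) (b := 1) (by rw [this]; ring)
      exact one_ne_zero h5.2
    have e2 : a.1.imK = 0 := by
      have := congrArg QuaternionAlgebra.imJ h1
      simp [iD] at this
      have h4 : 2 * ((1 + xF L) * a.1.imK) = 0 := by linear_combination this
      exact (mul_eq_zero.1 ((mul_eq_zero.1 h4).resolve_left h2)).resolve_left hx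
    have e3 : a.1.imI = 0 := by
      have := congrArg QuaternionAlgebra.imK h3
      simp [jD] at this
      have h4 : 2 * a.1.imI = 0 := by linear_combination -this
      exact (mul_eq_zero.1 h4).resolve_left h2
    have e : algebraMap (FF L) (DD L) a.1.re = a.1 := by
      rw [QuaternionAlgebra.coe_algebraMap]
      exact QuaternionAlgebra.ext rfl e3.symm e1.symm e2.symm
    exact ⟨a.1.re, (hS _).1 (e ▸ a.2), e⟩
  · rintro ⟨c, hc, rfl⟩
    refine ⟨⟨_, (hS c).2 hc⟩, ?_, rfl⟩
    rw [Subring.mem_center_iff]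
    intro b
    exact Subtype.ext (Algebra.commutes c b.1).symm

end Subrings

end QuaternionStructure

/-! ### The value functions on D and their splitting base -/

section ValueFunctionOnD

variable {L : Type u₁} [Field L]

/-- `E = 1 ± i`, with `1 ± r` of value `0` and `1 ∓ r` of the value of `x`. -/
structure IsSplit (r : LaurentSeries L) (E : DD L) : Prop where
  sqrt : IsSqrt r
  imJ : E.imJ = 0
  imK : E.imK = 0
  val : vM L (pD r E) = 0
  val' : vM L (pD (-r) E) = ((X1 : GG) : WithTop GG)
  add_star : E + star E = 2
  mul_star : E * star E = algebraMap (FF L) (DD L) (-xF L)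

theorem exists_isSplit (h2 : (2 : L) ≠ 0) : ∃ r : LaurentSeries L, IsSplit r (1 + iD L) := by
  obtain ⟨s, hs, h3, h4⟩ := exists_isSqrt h2
  have e1 : ∀ r : LaurentSeries L, pD r (1 + iD L) = HahnSeries.C (1 + r) := fun r => by
    rw [pD_add, pD_one, map_add, map_one]
    simp [pD, ev, iD]
  refine ⟨s, hs, by simp [iD], by simp [iD], by rw [e1, h3], ?_, ?_, ?_⟩
  · rw [e1, ← sub_eq_add_neg, h4]; rfl
  · rw [add_star_eq_trd]
    simp [iD]
  · rw [QuaternionAlgebra.coe_algebraMap]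
    refine QuaternionAlgebra.ext ?_ ?_ ?_ ?_ <;> simp [iD]
    ring

variable {r : LaurentSeries L} {E : DD L}

theorem IsSplit.qD_eq (h : IsSplit r E) (t : LaurentSeries L) : qD t E = 0 := by
  simp [qD, ev, h.imJ, h.imK]

/-- Passing to the other root exchanges E with its conjugate. Every result proved for one of the two
rings `BD` is thereby available for the other. -/
theorem IsSplit.symm (h : IsSplit r E) : IsSplit (-r) (star E) where
  sqrt := h.sqrt.neg
  imJ := by simp [h.imJ]
  imK := by simp [h.imK]
  val := by rw [pD_star, neg_neg, h.val]
  val' := by rw [neg_neg, pD_star, h.val']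
  add_star := by rw [star_star, add_comm, h.add_star]
  mul_star := by rw [star_star, star_mul_eq_nrd, ← mul_star_eq_nrd, h.mul_star]

/-- The function `min(v(p), v(q y) - δ, v(q') + δ, v(p'))`. -/
noncomputable def alphaFn (r : LaurentSeries L) (δ : GG) (z : DD L) : WithTop GG :=
  min (min (vM L (pD r z)) (vM L (qD r z * yM L) + ((-δ : GG) : WithTop GG)))
    (min (vM L (qD (-r) z) + ((δ : GG) : WithTop GG)) (vM L (pD (-r) z)))

theorem le_alphaFn {δ g : GG} {z : DD L} : (g : WithTop GG) ≤ alphaFn r δ z ↔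
    ((g : WithTop GG) ≤ vM L (pD r z) ∧ ((g + δ - Y1 : GG) : WithTop GG) ≤ vM L (qD r z)) ∧
    (((g - δ : GG) : WithTop GG) ≤ vM L (qD (-r) z) ∧ (g : WithTop GG) ≤ vM L (pD (-r) z)) := by
  rw [alphaFn, le_min_iff, le_min_iff, le_min_iff, AddValuation.map_mul, vM_yM]
  generalize vM L (qD r z) = Q
  generalize vM L (qD (-r) z) = Q'
  refine and_congr (and_congr Iff.rfl ?_) (and_congr ?_ Iff.rfl)
  · induction Q using WithTop.recTopCoe
    · simp
    · norm_cast
      constructor <;> intro h <;> grind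
  · induction Q' using WithTop.recTopCoe
    · simp
    · norm_cast
      constructor <;> intro h <;> grind

theorem lt_alphaFn {δ g : GG} {z : DD L} : (g : WithTop GG) < alphaFn r δ z ↔
    ((g : WithTop GG) < vM L (pD r z) ∧ ((g + δ - Y1 : GG) : WithTop GG) < vM L (qD r z)) ∧
    (((g - δ : GG) : WithTop GG) < vM L (qD (-r) z) ∧ (g : WithTop GG) < vM L (pD (-r) z)) := by
  rw [alphaFn, lt_min_iff, lt_min_iff, lt_min_iff, AddValuation.map_mul, vM_yM]
  generalize vM L (qD r z) = Q
  generalize vM L (qD (-r) z) = Q'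
  refine and_congr (and_congr Iff.rfl ?_) (and_congr ?_ Iff.rfl)
  · induction Q using WithTop.recTopCoe
    · simp only [WithTop.top_add, WithTop.coe_lt_top]
    · norm_cast
      constructor <;> intro h <;> grind
  · induction Q' using WithTop.recTopCoe
    · simp only [WithTop.top_add, WithTop.coe_lt_top]
    · norm_cast
      constructor <;> intro h <;> grind

theorem eq_of_forall_le {X Y : WithTop GG}
    (h : ∀ g : GG, (g : WithTop GG) ≤ X ↔ (g : WithTop GG) ≤ Y) : X = Y :=
  le_antisymm (WithTop.forall_coe_le_iff_le.1 fun g => (h g).1)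
    (WithTop.forall_coe_le_iff_le.1 fun g => (h g).2)

theorem le_map_mul_of_le {F : Type*} [Field F] (v : AddValuation F (WithTop GG)) {g h k : GG}
    {x y : F} (hx : (g : WithTop GG) ≤ v x) (hy : (h : WithTop GG) ≤ v y) (hk : k ≤ g + h) :
    (k : WithTop GG) ≤ v (x * y) := by
  rw [AddValuation.map_mul]
  refine le_trans ?_ (add_le_add hx hy)
  exact_mod_cast hk

theorem lt_map_mul_of_le_of_lt {F : Type*} [Field F] (v : AddValuation F (WithTop GG)) {g h k : GG}
    {x y : F} (hx : (g : WithTop GG) ≤ v x) (hy : (h : WithTop GG) < v y) (hk : k ≤ g + h) :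
    (k : WithTop GG) < v (x * y) := by
  rw [AddValuation.map_mul]
  have h1 : ((k : GG) : WithTop GG) ≤ (g : WithTop GG) + h := by exact_mod_cast hk
  refine h1.trans_lt (lt_of_lt_of_le ?_ (add_le_add hx le_rfl))
  exact WithTop.add_lt_add_left (by simp) hy

/-- Exchanging the two indices of the matrix exchanges the off-diagonal shifts, with the factor y
changing sides; this replaces δ by v(y) - δ. -/
theorem alphaFn_symm (r : LaurentSeries L) (δ : GG) (z : DD L) :
    alphaFn (-r) (Y1 - δ) z = alphaFn r δ z := by
  refine eq_of_forall_le fun g => ?_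
  rw [le_alphaFn, le_alphaFn, neg_neg]
  have e1 : g + (Y1 - δ) - Y1 = g - δ := by abel
  have e2 : g - (Y1 - δ) = g + δ - Y1 := by abel
  rw [e1, e2]
  tauto

theorem alphaFn_eq_top (hr : IsSqrt r) {δ : GG} {z : DD L} (hz : alphaFn r δ z = ⊤) : z = 0 := by
  have h1 : ∀ g : GG, (g : WithTop GG) ≤ alphaFn r δ z := fun g => by rw [hz]; exact le_top
  have h2 : pD r z = 0 := by
    rw [← AddValuation.top_iff (vM L), ← top_le_iff]
    exact WithTop.forall_coe_le_iff_le.1 fun g _ => (le_alphaFn.1 (h1 g)).1.1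
  have h3 : qD r z = 0 := by
    rw [← AddValuation.top_iff (vM L), ← top_le_iff]
    exact WithTop.forall_coe_le_iff_le.1 fun g _ => by
      have := (le_alphaFn.1 (h1 (g - δ + Y1))).1.2
      rwa [show g - δ + Y1 + δ - Y1 = g by abel] at this
  obtain ⟨h4, h5⟩ := ev_eq_zero hr h2
  obtain ⟨h6, h7⟩ := ev_eq_zero hr h3
  exact QuaternionAlgebra.ext h4 h5 h6 h7

theorem alphaFn_zero (r : LaurentSeries L) (δ : GG) : alphaFn r δ 0 = ⊤ := by
  simp [alphaFn]

/-- The shifts 0, -δ, δ, 0 of the four matrix entries are differences of row and column weights, so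
they add up correctly in every term of the matrix product. -/
theorem alphaFn_mul (hr : IsSqrt r) (δ : GG) (z w : DD L) :
    alphaFn r δ z + alphaFn r δ w ≤ alphaFn r δ (z * w) := by
  by_cases hz : alphaFn r δ z = ⊤
  · rw [alphaFn_eq_top hr hz, zero_mul, alphaFn_zero]
    exact le_top
  by_cases hw : alphaFn r δ w = ⊤
  · rw [alphaFn_eq_top hr hw, mul_zero, alphaFn_zero]
    exact le_top
  obtain ⟨g, hg⟩ := WithTop.ne_top_iff_exists.1 hz
  obtain ⟨h, hh⟩ := WithTop.ne_top_iff_exists.1 hw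
  rw [← hg, ← hh, ← WithTop.coe_add]
  obtain ⟨⟨a1, a2⟩, a3, a4⟩ := le_alphaFn.1 hg.le
  obtain ⟨⟨b1, b2⟩, b3, b4⟩ := le_alphaFn.1 hh.le
  have hy : ((Y1 : GG) : WithTop GG) ≤ vM L (yM L) := vM_yM.ge
  have key := fun {f f' : MM L} (k : GG) => AddValuation.map_le_add (vM L) (x := f) (y := f')
    (g := ((k : GG) : WithTop GG))
  rw [le_alphaFn, pD_mul _ _ hr, qD_mul _ _ hr, qD_mul _ _ hr.neg, pD_mul _ _ hr.neg, neg_neg]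
  refine ⟨⟨key _ ?_ ?_, key _ ?_ ?_⟩, key _ ?_ ?_, key _ ?_ ?_⟩
  · exact le_map_mul_of_le _ a1 b1 le_rfl
  · exact le_map_mul_of_le _ (le_map_mul_of_le _ hy a2 le_rfl) b3 (le_of_eq (by abel))
  · exact le_map_mul_of_le _ a1 b2 (le_of_eq (by abel))
  · exact le_map_mul_of_le _ a2 b4 (le_of_eq (by abel))
  · exact le_map_mul_of_le _ a4 b3 (le_of_eq (by abel))
  · exact le_map_mul_of_le _ a3 b1 (le_of_eq (by abel))
  · exact le_map_mul_of_le _ a4 b4 le_rfl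
  · exact le_map_mul_of_le _ (le_map_mul_of_le _ hy a3 le_rfl) b2 (le_of_eq (by abel))

/-- The value functions on `D`, for arbitrary `δ`. -/
noncomputable def alphaS (hr : IsSqrt r) (δ : GG) : SurmultValueFunction (vF L) (DD L) where
  toFun := alphaFn r δ
  eq_top_iff' x := ⟨alphaFn_eq_top hr, fun h => h ▸ alphaFn_zero r δ⟩
  min_le_add' x y := by
    refine WithTop.forall_coe_le_iff_le.1 fun g hg => ?_
    rw [le_min_iff, le_alphaFn, le_alphaFn] at hg
    obtain ⟨⟨⟨a1, a2⟩, a3, a4⟩, ⟨b1, b2⟩, b3, b4⟩ := hg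
    rw [le_alphaFn, pD_add, pD_add, qD_add, qD_add]
    exact ⟨⟨AddValuation.map_le_add _ a1 b1, AddValuation.map_le_add _ a2 b2⟩,
      AddValuation.map_le_add _ a3 b3, AddValuation.map_le_add _ a4 b4⟩
  map_smul' c x := by
    simp only [alphaFn, pD_smul, qD_smul, AddValuation.map_mul, vM_mapF, add_assoc]
    simp only [add_min]
  map_one' := by
    simp [alphaFn]
  add_le_mul' := alphaFn_mul hr δ

theorem alphaS_apply (hr : IsSqrt r) (δ : GG) (z : DD L) : alphaS hr δ z = alphaFn r δ z := rfl

/-- The element of `D` with coordinates `c` in the splitting base `E, E*, E j, E* j`. -/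
noncomputable def combD (E : DD L) (c₁ c₂ c₃ c₄ : FF L) : DD L :=
  c₁ • E + c₂ • star E + (c₃ • (E * jD L) + c₄ • (star E * jD L))

theorem pD_jD (t : LaurentSeries L) : pD t (jD L) = 0 := by
  simp [pD, ev, jD]

theorem qD_jD (t : LaurentSeries L) : qD t (jD L) = 1 := by
  simp [qD, ev, jD]

theorem pD_combD (h : IsSplit r E) (c₁ c₂ c₃ c₄ : FF L) : pD r (combD E c₁ c₂ c₃ c₄) =
    mapF L c₁ * pD r E + mapF L c₂ * pD (-r) E := by
  simp only [combD, pD_add, pD_smul, pD_mul _ _ h.sqrt, pD_jD, h.qD_eq, qD_star, pD_star]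
  ring

theorem qD_combD (h : IsSplit r E) (c₁ c₂ c₃ c₄ : FF L) : qD r (combD E c₁ c₂ c₃ c₄) =
    mapF L c₃ * pD r E + mapF L c₄ * pD (-r) E := by
  simp only [combD, qD_add, qD_smul, qD_mul _ _ h.sqrt, qD_jD, h.qD_eq, qD_star, pD_star]
  ring

theorem pD_neg_combD (h : IsSplit r E) (c₁ c₂ c₃ c₄ : FF L) : pD (-r) (combD E c₁ c₂ c₃ c₄) =
    mapF L c₁ * pD (-r) E + mapF L c₂ * pD r E := by
  simp only [combD, pD_add, pD_smul, pD_mul _ _ h.sqrt.neg, pD_jD, h.qD_eq, qD_star, pD_star,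
    neg_neg]
  ring

theorem qD_neg_combD (h : IsSplit r E) (c₁ c₂ c₃ c₄ : FF L) : qD (-r) (combD E c₁ c₂ c₃ c₄) =
    mapF L c₃ * pD (-r) E + mapF L c₄ * pD r E := by
  simp only [combD, qD_add, qD_smul, qD_mul _ _ h.sqrt.neg, qD_jD, h.qD_eq, qD_star, pD_star,
    neg_neg]
  ring

/-- The two-dimensional splitting: `E` and `E*` split a pair of values differing by at most
that of `x`. -/
theorem le_of_le_comb (h : IsSplit r E) {a b : MM L} {g g' : GG} (h1 : g ≤ X1 + g')
    (h2 : g' ≤ X1 + g) : ((g : WithTop GG) ≤ vM L (a * pD r E + b * pD (-r) E) ∧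
      (g' : WithTop GG) ≤ vM L (a * pD (-r) E + b * pD r E)) ↔
    (g : WithTop GG) ≤ vM L a ∧ (g' : WithTop GG) ≤ vM L b := by
  have e1 : ((0 : GG) : WithTop GG) ≤ vM L (pD r E) := h.val.ge
  have e2 : ((X1 : GG) : WithTop GG) ≤ vM L (pD (-r) E) := h.val'.ge
  -- This is the determinant of the system in `a` and `b`. It is a unit since the square of p(E) has
  -- value 0 and that of p'(E) has positive value; Cramer's rule then recovers `a` and `b`.
  have e3 : vM L (pD r E * pD r E - pD (-r) E * pD (-r) E) = 0 := by
    have h3 : vM L (pD r E * pD r E) = 0 := by rw [AddValuation.map_mul, h.val, add_zero]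
    rw [AddValuation.map_sub_eq_of_lt_left, h3]
    rw [h3]
    refine lt_of_lt_of_le (WithTop.coe_lt_coe.2 X1_pos) (le_map_mul_of_le _ e2 e2 ?_)
    exact le_add_of_nonneg_right X1_pos.le
  constructor
  · rintro ⟨ha, hb⟩
    have k1 := AddValuation.map_le_sub (vM L) (g := ((g : GG) : WithTop GG))
      (le_map_mul_of_le (vM L) e1 ha (by rw [zero_add])) (le_map_mul_of_le (vM L) e2 hb h1)
    have k2 := AddValuation.map_le_sub (vM L) (g := ((g' : GG) : WithTop GG))
      (le_map_mul_of_le (vM L) e1 hb (by rw [zero_add])) (le_map_mul_of_le (vM L) e2 ha h2)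
    have f1 : pD r E * (a * pD r E + b * pD (-r) E) - pD (-r) E * (a * pD (-r) E + b * pD r E) =
      a * (pD r E * pD r E - pD (-r) E * pD (-r) E) := by ring
    have f2 : pD r E * (a * pD (-r) E + b * pD r E) - pD (-r) E * (a * pD r E + b * pD (-r) E) =
      b * (pD r E * pD r E - pD (-r) E * pD (-r) E) := by ring
    rw [f1, AddValuation.map_mul, e3, add_zero] at k1
    rw [f2, AddValuation.map_mul, e3, add_zero] at k2
    exact ⟨k1, k2⟩
  · rintro ⟨ha, hb⟩
    exact ⟨AddValuation.map_le_add _ (le_map_mul_of_le _ ha e1 (by rw [add_zero]))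
      (le_map_mul_of_le _ hb e2 (by rwa [add_comm])),
      AddValuation.map_le_add _ (le_map_mul_of_le _ ha e2 (by rwa [add_comm]))
      (le_map_mul_of_le _ hb e1 (by rw [add_zero]))⟩

theorem add_sub_le_add_sub {G : Type*} [AddCommGroup G] [LinearOrder G] [IsOrderedAddMonoid G]
    {x y d : G} (g : G) (h1 : d + d - y ≤ x) (h2 : 0 ≤ x + (d + d - y)) :
    g + d - y ≤ x + (g - d) ∧ g - d ≤ x + (g + d - y) := by
  constructor <;> grind

/-- The entries p, p' involve only c₁, c₂, with equal thresholds. The entries q, q' involve only c₃,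
c₄, with thresholds differing by 2δ - v(y), and the two hypotheses bound this difference by v(x) in
absolute value. -/
theorem le_alphaFn_combD (h : IsSplit r E) {δ : GG} (h1 : δ + δ - Y1 ≤ X1)
    (h2 : 0 ≤ X1 + (δ + δ - Y1)) (c₁ c₂ c₃ c₄ : FF L) (g : GG) :
    (g : WithTop GG) ≤ alphaFn r δ (combD E c₁ c₂ c₃ c₄) ↔
    ((g : WithTop GG) ≤ vF L c₁ ∧ (g : WithTop GG) ≤ vF L c₂) ∧
    ((g + δ - Y1 : GG) : WithTop GG) ≤ vF L c₃ ∧ ((g - δ : GG) : WithTop GG) ≤ vF L c₄ := by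
  rw [le_alphaFn, pD_combD h, qD_combD h, pD_neg_combD h, qD_neg_combD h]
  obtain ⟨h3, h4⟩ := add_sub_le_add_sub g h1 h2
  have k1 := le_of_le_comb h (a := mapF L c₁) (b := mapF L c₂) (g := g) (g' := g)
    (le_add_of_nonneg_left X1_pos.le) (le_add_of_nonneg_left X1_pos.le)
  have k2 := le_of_le_comb h (a := mapF L c₃) (b := mapF L c₄) (g := g + δ - Y1) (g' := g - δ)
    h3 h4
  rw [vM_mapF, vM_mapF] at k1 k2
  rw [← k1, ← k2]
  exact ⟨fun ⟨⟨a, b⟩, c, d⟩ => ⟨⟨a, d⟩, b, c⟩, fun ⟨⟨a, d⟩, b, c⟩ => ⟨⟨a, b⟩, c, d⟩⟩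

theorem alphaFn_combD (h : IsSplit r E) {δ : GG} (h1 : δ + δ - Y1 ≤ X1)
    (h2 : 0 ≤ X1 + (δ + δ - Y1)) (c₁ c₂ c₃ c₄ : FF L) :
    alphaFn r δ (combD E c₁ c₂ c₃ c₄) = min (min (vF L c₁) (vF L c₂))
      (min (vF L c₃ + ((Y1 - δ : GG) : WithTop GG)) (vF L c₄ + ((δ : GG) : WithTop GG))) := by
  refine eq_of_forall_le fun g => ?_
  rw [le_alphaFn_combD h h1 h2, le_min_iff, le_min_iff, le_min_iff]
  generalize vF L c₃ = Q
  generalize vF L c₄ = Q'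
  refine and_congr Iff.rfl (and_congr ?_ ?_)
  · induction Q using WithTop.recTopCoe
    · simp
    · norm_cast
      constructor <;> intro h <;> grind
  · induction Q' using WithTop.recTopCoe
    · simp
    · norm_cast
      constructor <;> intro h <;> grind

theorem combD_zero_iff (h : IsSplit r E) {c₁ c₂ c₃ c₄ : FF L} (h0 : combD E c₁ c₂ c₃ c₄ = 0) :
    c₁ = 0 ∧ c₂ = 0 ∧ c₃ = 0 ∧ c₄ = 0 := by
  have h2 : ∀ δ : GG, δ + δ - Y1 = 0 → min (min (vF L c₁) (vF L c₂))
      (min (vF L c₃ + ((Y1 - δ : GG) : WithTop GG)) (vF L c₄ + ((δ : GG) : WithTop GG))) = ⊤ := by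
    intro δ hδ
    rw [← alphaFn_combD h (by rw [hδ]; exact X1_pos.le) (by rw [hδ, add_zero]; exact X1_pos.le),
      h0, alphaFn_zero]
  -- Any admissible δ would do; half the value of y makes both bounds trivial.
  have h3 := h2 (gg 0 (1 / 2)) (by rw [Y1, sub_eq_zero, gg_add]; norm_num)
  simp only [min_eq_top, WithTop.add_eq_top, WithTop.coe_ne_top, or_false,
    AddValuation.top_iff] at h3
  tauto

variable (E) in
/-- The family `E, E*, E j, E* j`. -/
noncomputable def famD : Fin 4 → DD L := ![E, star E, E * jD L, star E * jD L]

theorem sum_famD (c : Fin 4 → FF L) :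
    ∑ i, c i • famD E i = combD E (c 0) (c 1) (c 2) (c 3) := by
  rw [Fin.sum_univ_four]
  simp only [famD, combD, Matrix.cons_val]
  rw [add_assoc]

/-- The splitting base `E, E*, E j, E* j` of `D`. -/
noncomputable def basisD (h : IsSplit r E) : Module.Basis (Fin 4) (FF L) (DD L) :=
  basisOfLinearIndependentOfCardEqFinrank (b := famD E) (by
    rw [Fintype.linearIndependent_iff]
    intro c hc
    rw [sum_famD] at hc
    obtain ⟨h1, h2, h3, h4⟩ := combD_zero_iff h hc
    intro i
    fin_cases i <;> assumption)
    (by rw [QuaternionAlgebra.finrank_eq_four]; rfl)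

theorem coe_basisD (h : IsSplit r E) : ⇑(basisD h) = famD E :=
  coe_basisOfLinearIndependentOfCardEqFinrank _ _

theorem exists_combD (h : IsSplit r E) (z : DD L) : ∃ c₁ c₂ c₃ c₄, z = combD E c₁ c₂ c₃ c₄ := by
  have := (basisD h).sum_repr z
  rw [coe_basisD, sum_famD] at this
  exact ⟨_, _, _, _, this.symm⟩

theorem isNorm_alphaS (h : IsSplit r E) {δ : GG} (h1 : δ + δ - Y1 ≤ X1)
    (h2 : 0 ≤ X1 + (δ + δ - Y1)) : (alphaS h.sqrt δ).IsNorm := by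
  refine ⟨4, basisD h, fun c => ?_⟩
  have e0 := alphaFn_combD h h1 h2 1 0 0 0
  have e1 := alphaFn_combD h h1 h2 0 1 0 0
  have e2 := alphaFn_combD h h1 h2 0 0 1 0
  have e3 := alphaFn_combD h h1 h2 0 0 0 1
  have hz : ∀ x : DD L, (0 : FF L) • x = 0 := fun x => zero_smul (FF L) x
  have ho : ∀ x : DD L, (1 : FF L) • x = x := fun x => one_smul (FF L) x
  simp [combD, hz, ho] at e0 e1 e2 e3
  rw [coe_basisD, sum_famD, alphaS_apply, alphaFn_combD h h1 h2]
  refine eq_of_forall_le fun g => ?_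
  rw [Finset.le_inf_iff]
  simp [Fin.forall_fin_succ, famD, alphaS_apply, e0, e1, e2, e3, and_assoc]

end ValueFunctionOnD

/-! ### Criteria for graded semisimplicity, for two simple components, and for non-isomorphism -/

namespace SurmultValueFunction

variable {Γ : Type u₁} [AddCommGroup Γ] [LinearOrder Γ] [IsOrderedAddMonoid Γ]
  {F : Type u₂} [Field F] {v : AddValuation F (WithTop Γ)}
  {A : Type u₃} [Ring A] [Algebra F A] (α : SurmultValueFunction v A)

/-- The degree `k` is a separate variable so that no transport between the pieces of degrees `n • g`
and `k` is needed later. -/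
theorem of_grMk_pow {g : Γ} {x : A} (hx : x ∈ α.geGroup g) (n : ℕ) : ∀ k, k = n • g →
    ∃ h : x ^ n ∈ α.geGroup k, (DirectSum.of α.grPiece g (grMk x hx)) ^ n =
      DirectSum.of α.grPiece k (grMk (x ^ n) h) := by
  induction n with
  | zero =>
    intro k hk
    rw [zero_smul] at hk
    subst hk
    refine ⟨by rw [pow_zero]; exact α.one_mem_ge, ?_⟩
    rw [pow_zero]
    simp only [pow_zero]
    rfl
  | succ n ih =>
    intro k hk
    obtain ⟨h, e⟩ := ih _ rfl
    rw [succ_nsmul] at hk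
    subst hk
    refine ⟨by rw [pow_succ]; exact α.mul_mem_ge h hx, ?_⟩
    rw [pow_succ, e, DirectSum.of_mul_of]
    congr 1
    change grMul _ _ = _
    rw [grMul_mk]
    simp only [pow_succ]

/-- A nonzero homogeneous ideal contains the nonzero class of some z, hence the class of wz. If no
power of that class vanishes, the ideal is not nilpotent. -/
theorem isGradedSemisimple_of (h : ∀ z : A, z ≠ 0 → ∃ (w : A) (g : Γ), (g : WithTop Γ) ≤ α w ∧
    ∀ n : ℕ, ∃ k : Γ, (k : WithTop Γ) = n • ((g : WithTop Γ) + α z) ∧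
      α ((w * z) ^ n) = (k : WithTop Γ)) : α.IsGradedSemisimple := by
  intro I hI hnil
  obtain ⟨n, hn⟩ := hnil
  by_contra hne
  obtain ⟨ζ, hζ, hζ0⟩ : ∃ ζ ∈ I, ζ ≠ 0 := by
    by_contra! hcon
    apply hne
    rw [eq_bot_iff]
    intro x hx
    rw [TwoSidedIdeal.mem_bot]
    exact hcon x hx
  obtain ⟨g, hg⟩ : ∃ g, ζ g ≠ 0 := by
    by_contra! hcon
    exact hζ0 (DFinsupp.ext hcon)
  have h1 := hI ζ hζ g
  obtain ⟨z, hz, ez⟩ := grMk_surj (ζ g)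
  rw [ez] at h1 hg
  have hz' : ¬ (g : WithTop Γ) < α z := by
    intro hlt
    apply hg
    rw [grMk_zero, grMk_eq]
    rw [add_zero]
    exact neg_mem (show z ∈ α.gtGroup g from hlt)
  have hzg : α z = (g : WithTop Γ) := le_antisymm (not_lt.1 hz') hz
  have hz0 : z ≠ 0 := by
    rintro rfl
    rw [α.map_zero] at hzg
    exact WithTop.coe_ne_top hzg.symm
  obtain ⟨w, m, hw, hk⟩ := h z hz0
  have h2 := I.mul_mem_left (DirectSum.of α.grPiece m (grMk w hw)) _ h1
  rw [DirectSum.of_mul_of] at h2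
  have e3 : GradedMonoid.GMul.mul (grMk w hw) (grMk z hz) =
    grMk (w * z) (α.mul_mem_ge hw hz) := rfl
  rw [e3] at h2
  have h4 := hn (List.replicate n (DirectSum.of α.grPiece (m + g)
    (grMk (w * z) (α.mul_mem_ge hw hz)))) (List.length_replicate) (fun x hx => by
      rw [List.eq_of_mem_replicate hx]; exact h2)
  rw [List.prod_replicate] at h4
  obtain ⟨k, hk1, hk2⟩ := hk n
  obtain ⟨hm, e5⟩ := α.of_grMk_pow (α.mul_mem_ge hw hz) n k (by
    rw [hzg] at hk1
    exact_mod_cast hk1)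
  rw [e5] at h4
  have h6 : grMk ((w * z) ^ n) hm = 0 := by
    apply DirectSum.of_injective k
    rw [h4, _root_.map_zero]
  rw [grMk_zero, grMk_eq, add_zero] at h6
  have h7 : (w * z) ^ n ∈ α.gtGroup k := by simpa using neg_mem h6
  exact absurd hk2.symm (ne_of_lt h7)

/-- The residue ring is isomorphic to K × K, whose ideals are pairs of ideals of K; the two atoms
are the coordinate factors. -/
theorem omega_eq_two {K : Type*} [Field K] (f : α.gaugeRing →+* K × K)
    (hf : Function.Surjective f) (hker : ∀ z, f z = 0 ↔ 0 < α z.1) : α.omega = 2 := by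
  have hI : ∀ a ∈ α.gaugeIdeal, f a = 0 := fun a ha => (hker a).2 ha
  let e : α.residueRing ≃+* K × K := RingEquiv.ofBijective (Ideal.Quotient.lift _ f hI) (by
    refine ⟨?_, ?_⟩
    · rw [injective_iff_map_eq_zero]
      intro x hx
      obtain ⟨a, rfl⟩ := Ideal.Quotient.mk_surjective x
      rw [Ideal.Quotient.lift_mk] at hx
      exact Ideal.Quotient.eq_zero_iff_mem.2 ((hker a).1 hx)
    · intro y
      obtain ⟨a, rfl⟩ := hf y
      exact ⟨Ideal.Quotient.mk _ a, Ideal.Quotient.lift_mk _ _ _⟩)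
  let o : TwoSidedIdeal α.residueRing ≃o Ideal K × Ideal K :=
    (e.mapTwoSidedIdeal.trans TwoSidedIdeal.orderIsoIdeal).trans Ideal.idealProdEquiv
  have h1 : ∀ J : Ideal K × Ideal K, IsAtom J ↔ J = (⊤, ⊥) ∨ J = (⊥, ⊤) := by
    rintro ⟨J₁, J₂⟩
    have hlt : (⊥ : Ideal K) < ⊤ := bot_lt_top
    constructor
    · intro h
      rcases eq_bot_or_eq_top J₁ with rfl | rfl <;> rcases eq_bot_or_eq_top J₂ with rfl | rfl
      · exact absurd rfl h.1
      · exact Or.inr rfl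
      · exact Or.inl rfl
      · have := h.2 (⊤, ⊥) (Prod.mk_lt_mk.2 (Or.inr ⟨le_rfl, hlt⟩))
        exact absurd (congrArg Prod.fst this) hlt.ne'
    · rintro (h | h) <;> rw [h] <;> refine ⟨fun h => ?_, ?_⟩
      · exact hlt.ne' (congrArg Prod.fst h)
      · rintro ⟨b₁, b₂⟩ hb
        obtain ⟨-, hb2⟩ := Prod.mk_le_mk.1 hb.le
        have e2 : b₂ = ⊥ := le_bot_iff.1 hb2
        rcases eq_bot_or_eq_top b₁ with rfl | rfl
        · rw [e2]; rfl
        · rw [e2] at hb; exact absurd hb (lt_irrefl _)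
      · exact hlt.ne' (congrArg Prod.snd h)
      · rintro ⟨b₁, b₂⟩ hb
        obtain ⟨hb2, -⟩ := Prod.mk_le_mk.1 hb.le
        have e2 : b₁ = ⊥ := le_bot_iff.1 hb2
        rcases eq_bot_or_eq_top b₂ with rfl | rfl
        · rw [e2]; rfl
        · rw [e2] at hb; exact absurd hb (lt_irrefl _)
  have h2 : α.omega = Nat.card {J : Ideal K × Ideal K // J = (⊤, ⊥) ∨ J = (⊥, ⊤)} :=
    Nat.card_congr (o.toEquiv.subtypeEquiv fun I => by
      rw [← h1]; exact (o.isAtom_iff I).symm)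
  rw [h2]
  have hne : ((⊤, ⊥) : Ideal K × Ideal K) ≠ (⊥, ⊤) := fun h =>
    (bot_lt_top : (⊥ : Ideal K) < ⊤).ne' (congrArg Prod.fst h)
  have h3 := Set.ncard_pair hne
  exact h3

theorem IsIsomorphic.valueSet_eq {A' : Type*} [Ring A'] [Algebra F A']
    {α : SurmultValueFunction v A} {β : SurmultValueFunction v A'} (h : α.IsIsomorphic β) :
    α.valueSet = β.valueSet := by
  obtain ⟨η, hη⟩ := h
  ext g
  constructor
  · rintro ⟨x, hx⟩
    exact ⟨η x, by rw [hη, hx]⟩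
  · rintro ⟨x, hx⟩
    exact ⟨η.symm x, by rw [← hη, η.apply_symm_apply, hx]⟩

end SurmultValueFunction

/-! ### The gauge property, gauge ring, residue ring and value set of α -/

section ValueFunctionOnD

variable {L : Type u₁} [Field L] {r : LaurentSeries L} {E : DD L}

theorem le_alphaFn_E (h : IsSplit r E) (δ : GG) : ((0 : GG) : WithTop GG) ≤ alphaFn r δ E := by
  rw [le_alphaFn, h.val, h.val', h.qD_eq, h.qD_eq, AddValuation.map_zero]
  exact ⟨⟨le_rfl, le_top⟩, le_top, WithTop.coe_le_coe.2 X1_pos.le⟩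

/-- If the first diagonal entry of `z` dominates its column, then `α` is multiplicative on powers
of `z`. -/
theorem alphaFn_pow (hr : IsSqrt r) {δ g : GG} {z : DD L} (hz : (g : WithTop GG) ≤ alphaFn r δ z)
    (hp : vM L (pD r z) = (g : WithTop GG)) (hq : ((g - δ : GG) : WithTop GG) < vM L (qD (-r) z))
    (n : ℕ) : alphaFn r δ (z ^ n) = ((n • g : GG) : WithTop GG) := by
  obtain ⟨⟨-, a2⟩, -, -⟩ := le_alphaFn.1 hz
  have key : ((n • g : GG) : WithTop GG) ≤ alphaFn r δ (z ^ n) ∧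
      vM L (pD r (z ^ n)) = ((n • g : GG) : WithTop GG) ∧
      ((n • g - δ : GG) : WithTop GG) < vM L (qD (-r) (z ^ n)) := by
    induction n with
    | zero =>
      rw [pow_zero, zero_smul, pD_one, qD_one, AddValuation.map_zero, AddValuation.map_one]
      refine ⟨(alphaS hr δ).map_one'.ge, rfl, WithTop.coe_lt_top _⟩
    | succ n ih =>
      obtain ⟨i1, i2, i3⟩ := ih
      obtain ⟨⟨-, b2⟩, -, b4⟩ := le_alphaFn.1 i1
      have hy : ((Y1 : GG) : WithTop GG) ≤ vM L (yM L) := vM_yM.ge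
      rw [pow_succ, succ_nsmul]
      refine ⟨?_, ?_, ?_⟩
      · refine le_trans ?_ (alphaFn_mul hr δ _ _)
        rw [WithTop.coe_add]
        exact add_le_add i1 hz
      · have e : vM L (pD r (z ^ n) * pD r z) = ((n • g + g : GG) : WithTop GG) := by
          rw [AddValuation.map_mul, i2, hp, WithTop.coe_add]
        rw [pD_mul _ _ hr, AddValuation.map_add_eq_of_lt_left, e]
        rw [e]
        exact lt_map_mul_of_le_of_lt _ (le_map_mul_of_le _ hy b2 le_rfl) hq (le_of_eq (by abel))
      · rw [qD_mul _ _ hr.neg, neg_neg]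
        refine AddValuation.map_lt_add _ ?_ ?_
        · exact lt_map_mul_of_le_of_lt _ b4 hq (le_of_eq (by abel))
        · rw [mul_comm]
          exact lt_map_mul_of_le_of_lt _ hp.ge i3 (le_of_eq (by abel))
  refine le_antisymm ?_ key.1
  rw [← key.2.1]
  exact (min_le_left _ _).trans (min_le_left _ _)

/-- Left multiplication by E keeps p at its value and raises the entry q' below it by v(x). Then p
dominates its column strictly, and `alphaFn_pow` applies. -/
theorem exists_mul_of_pD (h : IsSplit r E) {δ g : GG} {z : DD L}
    (hz : alphaFn r δ z = (g : WithTop GG)) (hp : vM L (pD r z) = (g : WithTop GG)) :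
    ∃ (w : DD L) (m : GG), (m : WithTop GG) ≤ alphaFn r δ w ∧
      ∀ n : ℕ, alphaFn r δ ((w * z) ^ n) = ((n • (m + g) : GG) : WithTop GG) := by
  obtain ⟨-, a3, -⟩ := le_alphaFn.1 hz.ge
  refine ⟨E, 0, le_alphaFn_E h δ, fun n => alphaFn_pow h.sqrt ?_ ?_ ?_ n⟩
  · rw [WithTop.coe_add]
    exact (add_le_add (le_alphaFn_E h δ) hz.ge).trans (alphaFn_mul h.sqrt δ _ _)
  · rw [pD_mul _ _ h.sqrt, h.qD_eq, mul_zero, zero_mul, add_zero, AddValuation.map_mul, h.val, hp,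
      zero_add, zero_add]
  · rw [qD_mul _ _ h.sqrt.neg, h.qD_eq, zero_mul, add_zero]
    refine lt_of_lt_of_le ?_ (le_map_mul_of_le _ h.val'.ge a3 le_rfl)
    rw [WithTop.coe_lt_coe, zero_add]
    exact lt_add_of_pos_left _ X1_pos

/-- Left multiplication by E*j, of value at least δ, carries the minimal entry q to the lower
diagonal place. The entry above it gains v(x), and strict domination there is exactly the inequality
2δ - v(y) < v(x). -/
theorem exists_mul_of_qD (h : IsSplit r E) {δ g : GG} (hδ : δ + δ - Y1 < X1) {z : DD L}
    (hz : alphaFn r δ z = (g : WithTop GG)) (hq : vM L (qD r z) = ((g + δ - Y1 : GG) : WithTop GG)) :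
    ∃ (w : DD L) (m : GG), (m : WithTop GG) ≤ alphaFn r δ w ∧
      ∀ n : ℕ, alphaFn r δ ((w * z) ^ n) = ((n • (m + g) : GG) : WithTop GG) := by
  obtain ⟨-, -, a4⟩ := le_alphaFn.1 hz.ge
  have p1 : ∀ t, IsSqrt t → pD t (star E * jD L) = 0 := fun t ht => by
    rw [pD_mul _ _ ht, pD_jD, qD_star, h.qD_eq]; ring
  have q1 : ∀ t, IsSqrt t → qD t (star E * jD L) = pD (-t) E := fun t ht => by
    rw [qD_mul _ _ ht, qD_jD, qD_star, h.qD_eq, pD_star]; ring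
  have hw : ((δ : GG) : WithTop GG) ≤ alphaFn r δ (star E * jD L) := by
    rw [le_alphaFn, p1 _ h.sqrt, p1 _ h.sqrt.neg, q1 _ h.sqrt, q1 _ h.sqrt.neg, neg_neg,
      AddValuation.map_zero, h.val, h.val', sub_self]
    exact ⟨⟨le_top, WithTop.coe_le_coe.2 hδ.le⟩, le_rfl, le_top⟩
  refine ⟨star E * jD L, δ, hw, fun n => ?_⟩
  rw [← alphaFn_symm]
  refine alphaFn_pow h.sqrt.neg ?_ ?_ ?_ n
  · rw [alphaFn_symm, WithTop.coe_add]
    exact (add_le_add hw hz.ge).trans (alphaFn_mul h.sqrt δ _ _)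
  · rw [pD_mul _ _ h.sqrt.neg, p1 _ h.sqrt.neg, q1 _ h.sqrt.neg, neg_neg, zero_mul, zero_add,
      AddValuation.map_mul, AddValuation.map_mul, vM_yM, h.val, hq, add_zero, ← WithTop.coe_add]
    congr 1
    abel
  · rw [neg_neg, qD_mul _ _ h.sqrt, p1 _ h.sqrt, q1 _ h.sqrt, zero_mul, zero_add]
    refine lt_of_lt_of_le ?_ (le_map_mul_of_le _ h.val'.ge a4 le_rfl)
    rw [WithTop.coe_lt_coe]
    have e : δ + g - (Y1 - δ) = (δ + δ - Y1) + g := by abel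
    rw [e]
    exact add_lt_add_left hδ g

/-- Some matrix entry attains the value of z. The upper row is covered by the two preceding lemmas,
the lower row by the same lemmas for the other root and v(y) - δ. -/
theorem isGradedSemisimple_alphaS (h : IsSplit r E) {δ : GG} (h1 : δ + δ - Y1 < X1)
    (h2 : 0 < X1 + (δ + δ - Y1)) : (alphaS h.sqrt δ).IsGradedSemisimple := by
  apply SurmultValueFunction.isGradedSemisimple_of
  intro z hz
  obtain ⟨g, hg⟩ := (alphaS h.sqrt δ).exists_coe_of_ne_zero hz
  rw [alphaS_apply] at hg
  suffices H : ∃ (w : DD L) (m : GG), (m : WithTop GG) ≤ alphaFn r δ w ∧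
      ∀ n : ℕ, alphaFn r δ ((w * z) ^ n) = ((n • (m + g) : GG) : WithTop GG) by
    obtain ⟨w, m, hw, hn⟩ := H
    refine ⟨w, m, hw, fun n => ⟨n • (m + g), ?_, hn n⟩⟩
    rw [alphaS_apply, hg]
    norm_cast
  have hcases : vM L (pD r z) = (g : WithTop GG) ∨
      vM L (qD r z) = ((g + δ - Y1 : GG) : WithTop GG) ∨
      vM L (qD (-r) z) = ((g - δ : GG) : WithTop GG) ∨ vM L (pD (-r) z) = (g : WithTop GG) := by
    obtain ⟨⟨a1, a2⟩, a3, a4⟩ := le_alphaFn.1 hg.ge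
    by_contra! hcon
    obtain ⟨b1, b2, b3, b4⟩ := hcon
    have := lt_alphaFn.2 ⟨⟨lt_of_le_of_ne a1 b1.symm, lt_of_le_of_ne a2 b2.symm⟩,
      lt_of_le_of_ne a3 b3.symm, lt_of_le_of_ne a4 b4.symm⟩
    rw [hg] at this
    exact lt_irrefl _ this
  rcases hcases with hc | hc | hc | hc
  · exact exists_mul_of_pD h hg hc
  · exact exists_mul_of_qD h h1 hg hc
  · have := exists_mul_of_qD h.symm (δ := Y1 - δ) (g := g) (by grind) (z := z)
      (by rw [alphaFn_symm, hg]) (by rw [hc]; congr 1; abel)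
    simpa only [alphaFn_symm] using this
  · have := exists_mul_of_pD h.symm (δ := Y1 - δ) (g := g) (z := z)
      (by rw [alphaFn_symm, hg]) hc
    simpa only [alphaFn_symm] using this

/-- The y-value of f is an integer and y is the dominant coordinate, so a bound with y-coordinate
-1/2 only tests whether that integer is nonnegative. This is why γ leaves no trace in the gauge
ring. -/
theorem gg_neg_half_le {f : MM L} (a : ℚ) :
    ((gg a (-(1 / 2)) : GG) : WithTop GG) ≤ vM L f ↔ 0 ≤ wM L f := by
  by_cases h0 : f = 0
  · simp [h0]
  obtain ⟨l, m, h1, h2⟩ := exists_vM_eq h0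
  rw [h1, h2, WithTop.coe_le_coe, gg_le_gg]
  norm_cast
  constructor
  · rintro (h | ⟨h, -⟩)
    · by_contra hm
      have h3 : m ≤ -1 := by omega
      have h4 : (m : ℚ) ≤ -1 := by exact_mod_cast h3
      norm_num at h
      linarith
    · have : ((2 * m + 1 : ℤ) : ℚ) = 0 := by push_cast; rw [← h]; norm_num
      have h3 : 2 * m + 1 = 0 := by exact_mod_cast this
      omega
  · intro h
    left
    have h4 : (0 : ℚ) ≤ m := by exact_mod_cast h
    norm_num
    linarith

theorem gg_neg_half_lt {f : MM L} (a : ℚ) :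
    ((gg a (-(1 / 2)) : GG) : WithTop GG) < vM L f ↔ 0 ≤ wM L f := by
  rw [← gg_neg_half_le (a + 1)]
  constructor
  · intro h
    rw [gg_neg_half_le, ← gg_neg_half_le a]
    exact h.le
  · intro h
    refine lt_of_lt_of_le (WithTop.coe_lt_coe.2 ?_) h
    rw [gg_lt_gg]
    exact Or.inr ⟨rfl, by linarith⟩

theorem delta_sub (γ : ℚ) : (0 : GG) + gg γ (1 / 2) - Y1 = gg γ (-(1 / 2)) := by
  rw [zero_add, Y1, sub_eq_add_neg, gg_neg, gg_add]
  norm_num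

theorem zero_sub_delta (γ : ℚ) : (0 : GG) - gg γ (1 / 2) = gg (-γ) (-(1 / 2)) := by
  rw [zero_sub, gg_neg]

theorem wM_qD_neg (hr : IsSqrt r) (z : DD L) : wM L (qD (-r) z) = wM L (qD r z) :=
  wM_ev_neg hr _ _

theorem gaugeRing_alphaS (hr : IsSqrt r) (γ : ℚ) :
    (alphaS hr (gg γ (1 / 2))).gaugeRing = BD hr ⊓ BD hr.neg := by
  ext z
  change ((0 : GG) : WithTop GG) ≤ alphaFn r _ z ↔ _
  rw [le_alphaFn, delta_sub, zero_sub_delta, gg_neg_half_le, gg_neg_half_le, wM_qD_neg hr,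
    Subring.mem_inf, mem_BD, mem_BD, om_nonneg_iff _ hr]
  constructor
  · rintro ⟨⟨h1, h2⟩, -, h4⟩
    exact ⟨⟨⟨wM_nonneg_of_vM_nonneg h1, h2⟩, h1⟩, ⟨wM_nonneg_of_vM_nonneg h1, h2⟩, h4⟩
  · rintro ⟨⟨⟨-, h2⟩, h1⟩, -, h4⟩
    exact ⟨⟨h1, h2⟩, h2, h4⟩

theorem alphaS_pos_iff (hr : IsSqrt r) (γ : ℚ) {z : DD L} (hz : 0 ≤ alphaS hr (gg γ (1 / 2)) z) :
    0 < alphaS hr (gg γ (1 / 2)) z ↔ 0 < vM L (pD r z) ∧ 0 < vM L (pD (-r) z) := by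
  change ((0 : GG) : WithTop GG) ≤ alphaFn r _ z at hz
  change ((0 : GG) : WithTop GG) < alphaFn r _ z ↔ _
  rw [le_alphaFn, delta_sub, zero_sub_delta, gg_neg_half_le, gg_neg_half_le] at hz
  rw [lt_alphaFn, delta_sub, zero_sub_delta, gg_neg_half_lt, gg_neg_half_lt]
  constructor
  · rintro ⟨⟨h1, -⟩, -, h4⟩
    exact ⟨h1, h4⟩
  · rintro ⟨h1, h4⟩
    exact ⟨⟨h1, hz.1.2⟩, hz.2.1, h4⟩

theorem om_E (h : IsSplit r E) : om E = 0 := by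
  have h1 : wM L (pD r E) = 0 := by
    have hne : pD r E ≠ 0 := by
      intro h0
      have := h.val
      rw [h0, AddValuation.map_zero] at this
      exact WithTop.coe_ne_top this.symm
    obtain ⟨l, m, h2, h3⟩ := exists_vM_eq hne
    rw [h.val, ← WithTop.coe_zero, WithTop.coe_eq_coe, ← gg_zero, gg_inj] at h2
    have : m = 0 := by exact_mod_cast h2.2.symm
    rw [h3, this]; rfl
  rw [om_eq _ h.sqrt, h1, h.qD_eq, AddValuation.map_zero]
  simp

theorem om_star (z : DD L) : om (star z) = om z := by
  have h : nrd (star z) = nrd z := by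
    apply QuaternionAlgebra.algebraMap_injective (c₁ := 1 + xF L) (c₂ := 0) (c₃ := yF L)
    rw [← mul_star_eq_nrd, star_star, star_mul_eq_nrd]
  rw [om, h, om]

theorem E_mem_BD (h : IsSplit r E) : E ∈ BD h.sqrt ∧ E ∈ BD h.sqrt.neg := by
  rw [mem_BD, mem_BD, om_E h, h.val, h.val']
  exact ⟨⟨le_rfl, le_rfl⟩, le_rfl, WithTop.coe_le_coe.2 X1_pos.le⟩

theorem star_E_mem_BD (h : IsSplit r E) : star E ∈ BD h.sqrt ∧ star E ∈ BD h.sqrt.neg := by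
  rw [mem_BD, mem_BD, om_star, om_E h, pD_star, pD_star, neg_neg, h.val, h.val']
  exact ⟨⟨le_rfl, WithTop.coe_le_coe.2 X1_pos.le⟩, le_rfl, le_rfl⟩

theorem omega_alphaS (h : IsSplit r E) (γ : ℚ) : (alphaS h.sqrt (gg γ (1 / 2))).omega = 2 := by
  have hR : ∀ z, z ∈ (alphaS h.sqrt (gg γ (1 / 2))).gaugeRing ↔
      z ∈ BD h.sqrt ∧ z ∈ BD h.sqrt.neg := fun z => by
    rw [gaugeRing_alphaS, Subring.mem_inf]
  have hR1 : (alphaS h.sqrt (gg γ (1 / 2))).gaugeRing ≤ BD h.sqrt := fun z hz => ((hR z).1 hz).1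
  have hR2 : (alphaS h.sqrt (gg γ (1 / 2))).gaugeRing ≤ BD h.sqrt.neg :=
    fun z hz => ((hR z).1 hz).2
  refine SurmultValueFunction.omega_eq_two _
    (((resBD h.sqrt).comp (Subring.inclusion hR1)).prod
      ((resBD h.sqrt.neg).comp (Subring.inclusion hR2))) ?_ ?_
  · rintro ⟨a, b⟩
    have hu : resM (pD r E) ≠ 0 := by
      rw [Ne, resM_eq_zero_iff h.val.ge, h.val]
      exact lt_irrefl _
    -- With ρ the residue of p(E), the pair of residues of E is (ρ, 0) and that of E* is (0, ρ), so
    -- constant multiples of E and E* reach every pair.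
    let e : DD L := algebraMap (FF L) (DD L) (HahnSeries.C (RatFunc.C (a / resM (pD r E)))) * E
    let f : DD L :=
      algebraMap (FF L) (DD L) (HahnSeries.C (RatFunc.C (b / resM (pD r E)))) * star E
    have he : ∀ t, IsSqrt t → pD t e =
        HahnSeries.C (HahnSeries.C (a / resM (pD r E))) * pD t E := fun t ht => by
      rw [pD_mul _ _ ht, pD_algebraMap, h.qD_eq, mul_zero, add_zero, (vF_C_C_nonneg _).2]
    have hf : ∀ t, IsSqrt t → pD t f =
        HahnSeries.C (HahnSeries.C (b / resM (pD r E))) * pD (-t) E := fun t ht => by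
      rw [pD_mul _ _ ht, pD_algebraMap, qD_star, h.qD_eq, neg_zero, mul_zero, add_zero,
        (vF_C_C_nonneg _).2, pD_star]
    have hmem : e + f ∈ (alphaS h.sqrt (gg γ (1 / 2))).gaugeRing := by
      rw [hR]
      constructor
      · exact add_mem (mul_mem ((algebraMap_mem_BD _).2 (vF_C_C_nonneg _).1) (E_mem_BD h).1)
          (mul_mem ((algebraMap_mem_BD _).2 (vF_C_C_nonneg _).1) (star_E_mem_BD h).1)
      · exact add_mem (mul_mem ((algebraMap_mem_BD _).2 (vF_C_C_nonneg _).1) (E_mem_BD h).2)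
          (mul_mem ((algebraMap_mem_BD _).2 (vF_C_C_nonneg _).1) (star_E_mem_BD h).2)
    have hX : 0 ≤ vM L (pD (-r) E) := h.val' ▸ WithTop.coe_le_coe.2 X1_pos.le
    have hX0 : resM (pD (-r) E) = 0 :=
      (resM_eq_zero_iff hX).2 (h.val' ▸ WithTop.coe_lt_coe.2 X1_pos)
    have key : ∀ (c c' : L) (x x' : MM L), 0 ≤ vM L x → 0 ≤ vM L x' →
        resM (HahnSeries.C (HahnSeries.C c) * x + HahnSeries.C (HahnSeries.C c') * x') =
        c * resM x + c' * resM x' := by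
      intro c c' x x' hx hx'
      rw [resM_add, resM_mul (vM_C_C_nonneg c) hx, resM_mul (vM_C_C_nonneg c') hx', resM_C_C,
        resM_C_C]
      · rw [AddValuation.map_mul]; exact add_nonneg (vM_C_C_nonneg c) hx
      · rw [AddValuation.map_mul]; exact add_nonneg (vM_C_C_nonneg c') hx'
    refine ⟨⟨e + f, hmem⟩, Prod.ext ?_ ?_⟩
    · change resM (pD r (e + f)) = a
      rw [pD_add, he _ h.sqrt, hf _ h.sqrt, key _ _ _ _ h.val.ge hX, hX0, mul_zero, add_zero,
        div_mul_cancel₀ _ hu]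
    · change resM (pD (-r) (e + f)) = b
      rw [pD_add, he _ h.sqrt.neg, hf _ h.sqrt.neg, neg_neg, key _ _ _ _ hX h.val.ge, hX0,
        mul_zero, zero_add, div_mul_cancel₀ _ hu]
  · intro z
    rw [alphaS_pos_iff _ _ z.2]
    obtain ⟨hz1, hz2⟩ := (hR _).1 z.2
    rw [← resM_eq_zero_iff hz1.2, ← resM_eq_zero_iff hz2.2]
    exact Prod.ext_iff

/-- The difference 2δ - v(y) is (2γ, 0), so both inequalities say that |2γ| < 1. -/
theorem delta_bounds {γ : ℚ} (h1 : 0 < γ) (h2 : γ < 1 / 2) :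
    gg γ (1 / 2) + gg γ (1 / 2) - Y1 < X1 ∧ 0 < X1 + (gg γ (1 / 2) + gg γ (1 / 2) - Y1) := by
  have e : gg γ (1 / 2) + gg γ (1 / 2) - Y1 = gg (γ + γ) 0 := by
    rw [Y1, sub_eq_add_neg, gg_neg, gg_add, gg_add]
    norm_num
  rw [e, X1, gg_add, ← gg_zero, gg_lt_gg, gg_lt_gg]
  refine ⟨Or.inr ⟨rfl, by linarith⟩, Or.inr ⟨by norm_num, by linarith⟩⟩

theorem isGauge_alphaS (h : IsSplit r E) {γ : ℚ} (h1 : 0 < γ) (h2 : γ < 1 / 2) :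
    (alphaS h.sqrt (gg γ (1 / 2))).IsGauge :=
  ⟨isNorm_alphaS h (delta_bounds h1 h2).1.le (delta_bounds h1 h2).2.le,
    isGradedSemisimple_alphaS h (delta_bounds h1 h2).1 (delta_bounds h1 h2).2⟩

theorem exists_vF_eq {f : FF L} (hf : f ≠ 0) :
    ∃ l m : ℤ, vF L f = ((gg l m : GG) : WithTop GG) :=
  ⟨_, _, vFun_of_ne hf⟩

theorem vF_xF_zpow_mul_yF_zpow (l m : ℤ) :
    vF L (xF L ^ l * yF L ^ m) = ((gg l m : GG) : WithTop GG) := by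
  have hx : xF L ≠ 0 := HahnSeries.C_ne_zero RatFunc.X_ne_zero
  have hy : yF L ≠ 0 := HahnSeries.single_ne_zero one_ne_zero
  have key : ∀ (f : FF L) (hf : f ≠ 0) (a b : ℚ), vF L f = ((gg a b : GG) : WithTop GG) →
      ∀ n : ℤ, vF L (f ^ n) = ((gg (n * a) (n * b) : GG) : WithTop GG) := by
    intro f hf a b hab
    have hnat : ∀ n : ℕ, vF L (f ^ n) = ((gg (n * a) (n * b) : GG) : WithTop GG) := by
      intro n
      induction n with
      | zero => simp [gg_zero]
      | succ n ih =>
        rw [pow_succ, AddValuation.map_mul, ih, hab, ← WithTop.coe_add, gg_add]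
        congr 2 <;> push_cast <;> ring
    intro n
    obtain ⟨k, rfl | rfl⟩ := n.eq_nat_or_neg
    · rw [zpow_natCast, hnat]; simp
    · obtain ⟨l', m', h3⟩ := exists_vF_eq (zpow_ne_zero (-(k : ℤ)) hf)
      have h4 : vF L (f ^ k * f ^ (-(k : ℤ))) = 0 := by
        rw [← zpow_natCast, ← zpow_add₀ hf, add_neg_cancel, zpow_zero, AddValuation.map_one]
      rw [AddValuation.map_mul, hnat, h3, ← WithTop.coe_add, ← WithTop.coe_zero,
        WithTop.coe_eq_coe, gg_add, ← gg_zero, gg_inj] at h4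
      rw [h3]
      congr 2
      · push_cast; linarith [h4.1]
      · push_cast; linarith [h4.2]
  rw [AddValuation.map_mul, key _ hx 1 0 vF_xF, key _ hy 0 1 vF_yF, ← WithTop.coe_add, gg_add]
  simp

theorem valueSet_alphaS (h : IsSplit r E) {γ : ℚ} (h1 : 0 < γ) (h2 : γ < 1 / 2) :
    (alphaS h.sqrt (gg γ (1 / 2))).valueSet = {g | ∃ l m : ℤ, g = gg l m ∨
      g = gg γ (1 / 2) + gg l m ∨ g = -gg γ (1 / 2) + gg l m} := by
  have key := alphaFn_combD h (delta_bounds h1 h2).1.le (delta_bounds h1 h2).2.le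
  have hval : ∀ (f : FF L) (k : GG) (g : GG), vF L f + (k : WithTop GG) = (g : WithTop GG) →
      ∃ l m : ℤ, g = gg l m + k := by
    intro f k g hfg
    have hf : f ≠ 0 := by
      rintro rfl
      rw [AddValuation.map_zero, WithTop.top_add] at hfg
      exact WithTop.coe_ne_top hfg.symm
    obtain ⟨l, m, hlm⟩ := exists_vF_eq hf
    rw [hlm, ← WithTop.coe_add, WithTop.coe_eq_coe] at hfg
    exact ⟨l, m, hfg.symm⟩
  ext g
  constructor
  · rintro ⟨z, hz⟩
    obtain ⟨c₁, c₂, c₃, c₄, rfl⟩ := exists_combD h z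
    rw [alphaS_apply, key] at hz
    have hmin : ∀ a b : WithTop GG, min a b = (g : WithTop GG) → a = g ∨ b = g := by
      intro a b hab
      rcases min_choice a b with h' | h' <;> rw [h'] at hab
      · exact Or.inl hab
      · exact Or.inr hab
    rcases hmin _ _ hz with hz | hz <;> rcases hmin _ _ hz with hz | hz
    · obtain ⟨l, m, e⟩ := hval c₁ 0 g (by rw [WithTop.coe_zero, add_zero, hz])
      exact ⟨l, m, Or.inl (by rw [e, add_zero])⟩
    · obtain ⟨l, m, e⟩ := hval c₂ 0 g (by rw [WithTop.coe_zero, add_zero, hz])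
      exact ⟨l, m, Or.inl (by rw [e, add_zero])⟩
    · obtain ⟨l, m, e⟩ := hval _ _ g hz
      -- The base element Ej has value v(y) - δ, and v(y) is absorbed into the second integer.
      refine ⟨l, m + 1, Or.inr (Or.inr ?_)⟩
      rw [e, Y1, sub_eq_add_neg, gg_neg, gg_add, gg_add, gg_add, gg_inj]
      push_cast
      exact ⟨by ring, by ring⟩
    · obtain ⟨l, m, e⟩ := hval _ _ g hz
      exact ⟨l, m, Or.inr (Or.inl (by rw [e, add_comm]))⟩
  · rintro ⟨l, m, rfl | rfl | rfl⟩
    · refine ⟨combD E (xF L ^ l * yF L ^ m) 0 0 0, ?_⟩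
      rw [alphaS_apply, key, vF_xF_zpow_mul_yF_zpow]
      simp
    · refine ⟨combD E 0 0 0 (xF L ^ l * yF L ^ m), ?_⟩
      rw [alphaS_apply, key, vF_xF_zpow_mul_yF_zpow]
      simp [add_comm]
    · refine ⟨combD E 0 0 (xF L ^ l * yF L ^ (m - 1)) 0, ?_⟩
      rw [alphaS_apply, key, vF_xF_zpow_mul_yF_zpow]
      simp only [AddValuation.map_zero, WithTop.top_add, min_self, le_top, inf_of_le_left,
        inf_of_le_right]
      rw [← WithTop.coe_add, WithTop.coe_eq_coe, Y1, sub_eq_add_neg (gg 0 1), gg_neg, gg_add,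
        gg_add, gg_add, gg_inj]
      push_cast
      exact ⟨by ring, by ring⟩

/-- The value set determines γ modulo ℤ up to sign, and the interval from 0 to 1/2 contains at most
one number of each such class. -/
theorem not_isIsomorphic_alphaS (h : IsSplit r E) {γ γ' : ℚ} (h1 : 0 < γ) (h2 : γ < 1 / 2)
    (h1' : 0 < γ') (h2' : γ' < 1 / 2) (hne : γ ≠ γ') :
    ¬ (alphaS h.sqrt (gg γ (1 / 2))).IsIsomorphic (alphaS h.sqrt (gg γ' (1 / 2))) := by
  intro hiso
  have hset := hiso.valueSet_eq
  rw [valueSet_alphaS h h1 h2, valueSet_alphaS h h1' h2'] at hset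
  have hmem : gg γ (1 / 2) ∈ {g | ∃ l m : ℤ, g = gg l m ∨
      g = gg γ (1 / 2) + gg l m ∨ g = -gg γ (1 / 2) + gg l m} :=
    ⟨0, 0, Or.inr (Or.inl (by simp [gg_zero]))⟩
  rw [hset] at hmem
  obtain ⟨l, m, hg | hg | hg⟩ := hmem
  · rw [gg_inj] at hg
    have h3 : (0 : ℚ) < l := by rw [← hg.1]; exact h1
    have h4 : (l : ℚ) < 1 := by rw [← hg.1]; linarith
    norm_cast at h3 h4
    omega
  · rw [gg_add, gg_inj] at hg
    have h3 : (l : ℚ) < 1 := by linarith [hg.1]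
    have h4 : (-1 : ℚ) < l := by linarith [hg.1]
    norm_cast at h3 h4
    have h5 : l = 0 := by omega
    apply hne
    rw [hg.1, h5]; simp
  · rw [gg_neg, gg_add, gg_inj] at hg
    have h3 : (l : ℚ) < 1 := by linarith [hg.1]
    have h4 : (0 : ℚ) < l := by linarith [hg.1]
    norm_cast at h3 h4
    omega

end ValueFunctionOnD

/-! ### Overrings of `BD`, and recognition of `BD` -/

section Overrings

variable {L : Type u₁} [Field L] {r : LaurentSeries L} {E : DD L}

theorem xF_ne_zero : xF L ≠ 0 := HahnSeries.C_ne_zero RatFunc.X_ne_zero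

theorem yF_ne_zero : yF L ≠ 0 := HahnSeries.single_ne_zero one_ne_zero

theorem vF_xF_inv : vF L (xF L)⁻¹ = ((-X1 : GG) : WithTop GG) := by
  have := vF_xF_zpow_mul_yF_zpow (L := L) (-1) 0
  rw [zpow_neg_one, zpow_zero, mul_one] at this
  rw [this, X1, gg_neg]
  simp

theorem wF_xF_inv : wF L (xF L)⁻¹ = 0 := by
  have := AddValuation.map_mul (wF L) (xF L) (xF L)⁻¹
  rwa [mul_inv_cancel₀ xF_ne_zero, AddValuation.map_one, wF_xF, zero_add, eq_comm] at this

theorem xF_inv_not_nonneg : ¬ 0 ≤ vF L (xF L)⁻¹ := by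
  rw [vF_xF_inv, not_le]
  exact WithTop.coe_lt_coe.2 (neg_lt_zero.2 X1_pos)

theorem om_algebraMap_mul (c : FF L) (z : DD L) :
    om (algebraMap (FF L) (DD L) c * z) = wF L c + wF L c + om z := by
  rw [om_mul, om_algebraMap]

theorem pD_algebraMap_mul (c : FF L) (z : DD L) :
    pD r (algebraMap (FF L) (DD L) c * z) = mapF L c * pD r z := by
  rw [← Algebra.smul_def, pD_smul]

theorem wM_eq_zero_of_vM_neg {f : MM L} (h1 : 0 ≤ wM L f) (h2 : vM L f < 0) :
    wM L f = 0 ∧ vM L f ≤ ((-X1 : GG) : WithTop GG) := by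
  have hf : f ≠ 0 := by
    rintro rfl
    rw [AddValuation.map_zero] at h2
    exact absurd h2 (by simp)
  obtain ⟨l, m, h3, h4⟩ := exists_vM_eq hf
  rw [h4] at h1 ⊢
  rw [h3] at h2 ⊢
  rw [← WithTop.coe_zero, WithTop.coe_lt_coe, ← gg_zero, gg_lt_gg] at h2
  rw [WithTop.coe_le_coe, X1, gg_neg, gg_le_gg]
  norm_cast at h1 h2
  rcases h2 with h2 | ⟨h2, h5⟩
  · omega
  · subst h2
    have h6 : l ≤ -1 := by omega
    refine ⟨rfl, Or.inr ⟨by simp, by exact_mod_cast h6⟩⟩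

theorem le_vM_of_pos {f : MM L} (h : 0 < vM L f) : ((X1 : GG) : WithTop GG) ≤ vM L f := by
  by_cases hf : f = 0
  · rw [hf, AddValuation.map_zero]; exact le_top
  obtain ⟨l, m, h3, h4⟩ := exists_vM_eq hf
  rw [h3] at h ⊢
  rw [← WithTop.coe_zero, WithTop.coe_lt_coe, ← gg_zero, gg_lt_gg] at h
  rw [WithTop.coe_le_coe, X1, gg_le_gg]
  norm_cast at h ⊢

theorem wM_eq_zero_of_vM_eq_zero {f : MM L} (h : vM L f = 0) : wM L f = 0 := by
  have hf : f ≠ 0 := by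
    rintro rfl
    rw [AddValuation.map_zero] at h
    exact absurd h (by simp)
  obtain ⟨l, m, h3, h4⟩ := exists_vM_eq hf
  rw [h3, ← WithTop.coe_zero, WithTop.coe_eq_coe, ← gg_zero, gg_inj] at h
  have : m = 0 := by exact_mod_cast h.2
  rw [h4, this]; rfl

theorem exists_nsmul_le {f : MM L} (h : 0 ≤ wM L f) :
    ∃ n : ℕ, ((-(n • X1) : GG) : WithTop GG) ≤ vM L f := by
  by_cases hf : f = 0
  · exact ⟨0, by rw [hf, AddValuation.map_zero]; exact le_top⟩
  obtain ⟨l, m, h3, h4⟩ := exists_vM_eq hf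
  rw [h4] at h
  norm_cast at h
  refine ⟨l.natAbs, ?_⟩
  have e : -(l.natAbs • X1) = gg (-(l.natAbs : ℤ)) 0 := by
    have : ∀ n : ℕ, n • X1 = gg n 0 := by
      intro n
      induction n with
      | zero => simp [gg_zero]
      | succ n ih => rw [succ_nsmul, ih, X1, gg_add]; simp
    rw [this, gg_neg]
    simp
  rw [e, h3, WithTop.coe_le_coe, gg_le_gg]
  rcases h.lt_or_eq with h5 | h5
  · left; exact_mod_cast h5
  · right
    subst h5
    refine ⟨by simp, ?_⟩
    have : -(l.natAbs : ℤ) ≤ l := by omega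
    exact_mod_cast this

theorem om_eq_zero_of_vM (hr : IsSqrt r) {z : DD L} (hz : 0 ≤ om z) (h : wM L (pD r z) = 0) :
    om z = 0 := by
  have := ((om_nonneg_iff z hr).1 hz).2
  rw [om_eq z hr, h, add_zero]
  refine min_eq_left ?_
  exact add_nonneg zero_le_one (add_nonneg this this)

theorem inv_mem_BD (hr : IsSqrt r) {u : (DD L)ˣ} (h0 : om (u : DD L) = 0)
    (h : vM L (pD r u) = 0) : ((u⁻¹ : (DD L)ˣ) : DD L) ∈ BD hr := by
  have h1 := vM_pD_unit hr h0
  rw [h, zero_add] at h1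
  have h2 := om_unit u
  rw [h0, zero_add] at h2
  exact ⟨h2.ge, h1.ge⟩

/-- An overring of `BD` containing an element of `WD` outside of `BD` contains `x⁻¹`. -/
theorem xF_inv_mem_of_not_mem (hr : IsSqrt r) {S : Subring (DD L)} (hS : BD hr ≤ S) {s : DD L}
    (hs : s ∈ S) (hs1 : s ∈ WD hr) (hs2 : s ∉ BD hr) :
    algebraMap (FF L) (DD L) (xF L)⁻¹ ∈ S := by
  have hneg : vM L (pD r s) < 0 := by
    by_contra h
    exact hs2 ⟨hs1, not_lt.1 h⟩
  obtain ⟨h1, h2⟩ := wM_eq_zero_of_vM_neg ((om_nonneg_iff s hr).1 hs1).1 hneg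
  have h3 := om_eq_zero_of_vM hr hs1 h1
  have hs0 : s ≠ 0 := fun h => hs2 (h ▸ (BD hr).zero_mem)
  obtain ⟨u, rfl⟩ := isUnit_of_ne_zero hr hs0
  have h4 := vM_pD_unit hr h3
  -- The x-value of p(s) is an integer, so being negative it is at most -1; dividing the inverse of
  -- s by x keeps it in `BD`.
  have h5 : algebraMap (FF L) (DD L) (xF L)⁻¹ * ((u⁻¹ : (DD L)ˣ) : DD L) ∈ BD hr := by
    refine ⟨?_, ?_⟩
    · have := om_unit u
      rw [h3, zero_add] at this
      rw [om_algebraMap_mul, wF_xF_inv, this]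
      simp
    · rw [pD_algebraMap_mul, AddValuation.map_mul, vM_mapF, vF_xF_inv]
      calc (0 : WithTop GG) = vM L (pD r u) + vM L (pD r (u⁻¹ : (DD L)ˣ)) := h4.symm
        _ ≤ _ := add_le_add h2 le_rfl
  have h6 := S.mul_mem (hS h5) hs
  rwa [Units.inv_mul_cancel_right] at h6

/-- For z in `WD` the value of p(z) is bounded below by a multiple of the value of x, so a power of
x multiplies z into `BD`. -/
theorem WD_le_of_xF_inv_mem (hr : IsSqrt r) {S : Subring (DD L)} (hS : BD hr ≤ S)
    (hx : algebraMap (FF L) (DD L) (xF L)⁻¹ ∈ S) : WD hr ≤ S := by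
  intro z hz
  obtain ⟨n, hn⟩ := exists_nsmul_le ((om_nonneg_iff z hr).1 hz).1
  have h1 : algebraMap (FF L) (DD L) (xF L ^ n) * z ∈ BD hr := by
    refine ⟨?_, ?_⟩
    · rw [om_algebraMap_mul, AddValuation.map_pow, wF_xF]
      have hz' : 0 ≤ om z := hz
      simpa using hz'
    · rw [pD_algebraMap_mul]
      refine le_map_mul_of_le _ (g := n • X1) ?_ hn (by rw [add_neg_cancel])
      rw [vM_mapF, AddValuation.map_pow, vF_xF]
      norm_cast
  have h2 := S.mul_mem (S.pow_mem hx n) (hS h1)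
  rwa [← map_pow, ← mul_assoc, ← map_mul, ← mul_pow, inv_mul_cancel₀ xF_ne_zero, one_pow,
    map_one, one_mul] at h2

/-- If s has negative `om`, a high enough power of its inverse moves any element into the part of
`BD` where `om` is positive; multiplying by the same power of s returns the element. -/
theorem eq_top_of_not_le_WD (hr : IsSqrt r) {S : Subring (DD L)} (hS : BD hr ≤ S)
    (h : ¬ S ≤ WD hr) : S = ⊤ := by
  obtain ⟨s, hs, hs1⟩ := Set.not_subset.1 h
  have hs0 : s ≠ 0 := by
    rintro rfl
    exact hs1 (WD hr).zero_mem
  obtain ⟨u, rfl⟩ := isUnit_of_ne_zero hr hs0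
  obtain ⟨m, h1, h2⟩ := exists_om_unit u
  have hm : m < 0 := by
    by_contra hm
    refine hs1 ?_
    change 0 ≤ om (u : DD L)
    rw [h1]
    exact_mod_cast not_lt.1 hm
  rw [eq_top_iff]
  intro z _
  by_cases hz : z = 0
  · rw [hz]; exact S.zero_mem
  obtain ⟨w, rfl⟩ := isUnit_of_ne_zero hr hz
  obtain ⟨k, h3, -⟩ := exists_om_unit w
  have hpow : ∀ n : ℕ, om (((u⁻¹ : (DD L)ˣ) : DD L) ^ n) = ((n * -m : ℤ) : WithTop ℤ) := by
    intro n
    induction n with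
    | zero => rw [pow_zero, om_one]; simp
    | succ n ih =>
      rw [pow_succ, om_mul, ih, h2]
      norm_cast
      push_cast
      ring
  have h4 : (w : DD L) * ((u⁻¹ : (DD L)ˣ) : DD L) ^ (k.natAbs + 1) ∈ S := by
    apply hS
    apply mem_BD_of_om_pos
    rw [om_mul, hpow, h3]
    have h5 : ((k.natAbs : ℤ) + 1) ≤ ((k.natAbs : ℤ) + 1) * -m :=
      le_mul_of_one_le_right (by positivity) (by omega)
    have h6 : 1 ≤ k + ((k.natAbs + 1 : ℕ) : ℤ) * -m := by
      rw [Nat.cast_succ]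
      omega
    exact_mod_cast h6
  have h5 := S.mul_mem h4 (S.pow_mem hs (k.natAbs + 1))
  rwa [mul_assoc, ← Units.val_pow_eq_pow_val, ← Units.val_pow_eq_pow_val, ← Units.val_mul,
    inv_pow, inv_mul_cancel, Units.val_one, mul_one] at h5

theorem overring_BD (hr : IsSqrt r) {S : Subring (DD L)} (hS : BD hr ≤ S) :
    S = BD hr ∨ S = WD hr ∨ S = ⊤ := by
  by_cases h1 : S ≤ WD hr
  · by_cases h2 : S ≤ BD hr
    · exact Or.inl (le_antisymm h2 hS)
    · obtain ⟨s, hs, hs2⟩ := Set.not_subset.1 h2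
      exact Or.inr (Or.inl (le_antisymm h1 (WD_le_of_xF_inv_mem hr hS
        (xF_inv_mem_of_not_mem hr hS hs (h1 hs) hs2))))
  · exact Or.inr (Or.inr (eq_top_of_not_le_WD hr hS h1))

/-- Modulo elements of positive `y`-adic value, the intersection of the two rings `BD` consists of
the `V`-linear combinations of `E` and `E*`. -/
theorem exists_comb_of_mem (h : IsSplit r E) {z : DD L} (h1 : z ∈ BD h.sqrt)
    (h2 : z ∈ BD h.sqrt.neg) : ∃ c₁ c₂ : FF L, 0 ≤ vF L c₁ ∧ 0 ≤ vF L c₂ ∧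
      1 ≤ om (z - (algebraMap (FF L) (DD L) c₁ * E + algebraMap (FF L) (DD L) c₂ * star E)) := by
  obtain ⟨c₁, c₂, c₃, c₄, rfl⟩ := exists_combD h z
  have h3 := h1.2
  have h4 := h2.2
  rw [pD_combD h] at h3
  rw [pD_neg_combD h] at h4
  have h5 := (le_of_le_comb h (g := 0) (g' := 0) (by rw [add_zero]; exact X1_pos.le)
    (by rw [add_zero]; exact X1_pos.le)).1 ⟨h3, h4⟩
  rw [vM_mapF, vM_mapF] at h5
  refine ⟨c₁, c₂, h5.1, h5.2, ?_⟩
  have e1 : pD r (algebraMap (FF L) (DD L) c₁ * E + algebraMap (FF L) (DD L) c₂ * star E) =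
      pD r (combD E c₁ c₂ c₃ c₄) := by
    rw [pD_add, pD_algebraMap_mul, pD_algebraMap_mul, pD_star, pD_combD h]
  have e2 : qD r (algebraMap (FF L) (DD L) c₁ * E + algebraMap (FF L) (DD L) c₂ * star E) = 0 := by
    rw [qD_add, ← Algebra.smul_def, ← Algebra.smul_def, qD_smul, qD_smul, qD_star, h.qD_eq]
    ring
  rw [om_pos_iff _ h.sqrt, pD_sub, qD_sub, e1, e2, sub_self, sub_zero, AddValuation.map_zero]
  exact ⟨le_top, ((om_nonneg_iff _ h.sqrt).1 h1.1).2⟩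

theorem om_pow (z : DD L) (n : ℕ) : om (z ^ n) = n • om z := by
  induction n with
  | zero => rw [pow_zero, om_one, zero_smul]
  | succ n ih => rw [pow_succ, om_mul, ih, succ_nsmul]

theorem pD_mul_pow {t : LaurentSeries L} (ht : IsSqrt t) {e : DD L} (he : ∀ t, qD t e = 0)
    (z : DD L) (n : ℕ) : pD t (z * e ^ n) = pD t z * pD t e ^ n := by
  induction n with
  | zero => simp
  | succ n ih => rw [pow_succ, ← mul_assoc, pD_mul _ _ ht, ih, he, mul_zero, add_zero, pow_succ,
      mul_assoc]

theorem mem_of_om_sub {S : Subring (DD L)} (hP : ∀ z, 1 ≤ om z → z ∈ S) {z w : DD L}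
    (h : 1 ≤ om (z - w)) (hw : w ∈ S) : z ∈ S := by
  have := S.add_mem (hP _ h) hw
  rwa [sub_add_cancel] at this

/-- Multiplication by E leaves the value of p unchanged and raises that of p' by v(x). So z E^n lies
in the intersection of both rings for large n, where it is a V-combination of E and E* modulo
positive `om`, hence in S; then E^n is cancelled by e^n. Among the overrings of `BD`, those beyond
`BD` itself contain the inverse of x. -/
theorem eq_BD_of (h : IsSplit r E) {S : Subring (DD L)} 
    (hP : ∀ z, 1 ≤ om z → z ∈ S) (hV : ∀ c, algebraMap (FF L) (DD L) c ∈ S ↔ 0 ≤ vF L c)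
    (hE : E ∈ S) (hE' : star E ∈ S) {e : DD L} (he : e ∈ S) (hEe : E * e = 1) : S = BD h.sqrt := by
  have hle : BD h.sqrt ≤ S := by
    intro z hz
    obtain ⟨n, hn⟩ := exists_nsmul_le ((om_nonneg_iff z h.sqrt.neg).1 hz.1).1
    have h0 : 0 ≤ om (z * E ^ n) := by
      rw [om_mul, om_pow, om_E h, smul_zero, add_zero]; exact hz.1
    have h1 : z * E ^ n ∈ BD h.sqrt := by
      refine ⟨h0, ?_⟩
      rw [pD_mul_pow h.sqrt h.qD_eq, AddValuation.map_mul, AddValuation.map_pow, h.val, smul_zero,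
        add_zero]
      exact hz.2
    have h2 : z * E ^ n ∈ BD h.sqrt.neg := by
      refine ⟨h0, ?_⟩
      rw [pD_mul_pow h.sqrt.neg h.qD_eq]
      refine le_map_mul_of_le _ hn (h := n • X1) ?_ (by rw [neg_add_cancel])
      rw [AddValuation.map_pow, h.val']
      norm_cast
    obtain ⟨c₁, c₂, h3, h4, h5⟩ := exists_comb_of_mem h h1 h2
    have h6 : z * E ^ n ∈ S := mem_of_om_sub hP h5
      (S.add_mem (S.mul_mem ((hV _).2 h3) hE) (S.mul_mem ((hV _).2 h4) hE'))
    have h7 := S.mul_mem h6 (S.pow_mem he n)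
    have hcomm : Commute E e := by
      obtain ⟨u, hu⟩ := isUnit_of_ne_zero h.sqrt (left_ne_zero_of_mul_eq_one hEe)
      rw [← hu] at hEe ⊢
      rw [← Units.inv_eq_of_mul_eq_one_right hEe]
      exact (Commute.refl _).units_inv_right
    rwa [mul_assoc, ← hcomm.mul_pow, hEe, one_pow, mul_one] at h7
  rcases overring_BD h.sqrt hle with h1 | h1 | h1
  · exact h1
  · exfalso
    refine xF_inv_not_nonneg ((hV _).1 ?_)
    rw [h1]
    change 0 ≤ om _
    rw [om_algebraMap, wF_xF_inv, add_zero]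
  · exfalso
    refine xF_inv_not_nonneg ((hV _).1 ?_)
    rw [h1]
    trivial

end Overrings

/-! ### Dubrovin valuation rings in division rings -/

section SimpleQuotient

variable {A : Type*} [Ring A] {B : Subring A}

/-- If `s` is not in the Dubrovin valuation ring `B` of a division ring, then `1 ∈ B s B`. -/
theorem IsDubrovin.one_mem_of_not_mem (hA : ∀ a : A, a ≠ 0 → IsUnit a) (hB : IsDubrovin B)
    (T : AddSubgroup A) (hl : ∀ a t, a ∈ B → t ∈ T → a * t ∈ T)
    (hr : ∀ a t, a ∈ B → t ∈ T → t * a ∈ T) {s : A} (hs : s ∈ T) (hsB : s ∉ B) : 1 ∈ T := by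
  obtain ⟨J, hJ, hsimple, -, hD⟩ := hB
  have hJ1 : (1 : B) ∉ J := fun h1 => by
    have : Subsingleton (B ⧸ J) := Ideal.Quotient.subsingleton_iff.2 ((Ideal.eq_top_iff_one J).2 h1)
    exact not_subsingleton (B ⧸ J) this
  -- The defining ideal is quasi-regular, so a congruence to 1 modulo J can be improved to an
  -- equality.
  have hunit : ∀ j ∈ J, ∃ u ∈ B, u * (1 - j.1) = 1 := by
    intro j hj
    have hne : 1 - j.1 ≠ 0 := by
      intro h0
      apply hJ1
      have : j = 1 := Subtype.ext (sub_eq_zero.1 h0).symm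
      rwa [this] at hj
    obtain ⟨u, hu⟩ := hA _ hne
    refine ⟨(u⁻¹ : Aˣ), ?_, by rw [← hu, Units.inv_mul]⟩
    -- Otherwise the Dubrovin condition yields b with X = b j u⁻¹ in B but not in J; however X(1 -
    -- j) = bj gives X = bj + Xj, which lies in J.
    have h1 : j.1 * (u⁻¹ : Aˣ) ∈ B := by
      by_contra hcon
      obtain ⟨⟨b, hb, hbJ⟩, -⟩ := hD _ hcon
      apply hbJ
      have h2 : (⟨b.1 * (j.1 * (u⁻¹ : Aˣ)), hb⟩ : B) =
          b * j + ⟨b.1 * (j.1 * (u⁻¹ : Aˣ)), hb⟩ * j := by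
        apply Subtype.ext
        change b.1 * (j.1 * (u⁻¹ : Aˣ)) = b.1 * j.1 + b.1 * (j.1 * (u⁻¹ : Aˣ)) * j.1
        have h3 : b.1 * (j.1 * (u⁻¹ : Aˣ)) * (1 - j.1) = b.1 * j.1 := by
          rw [← hu, mul_assoc, mul_assoc, Units.inv_mul, mul_one]
        rw [mul_sub, mul_one, sub_eq_iff_eq_add] at h3
        exact h3
      rw [h2]
      exact J.add_mem (J.mul_mem_left _ hj) (J.mul_mem_left _ hj)
    have h4 : ((u⁻¹ : Aˣ) : A) = 1 + j.1 * (u⁻¹ : Aˣ) := by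
      have : (1 - j.1) * (u⁻¹ : Aˣ) = 1 := by rw [← hu, Units.mul_inv]
      rw [sub_mul, one_mul, sub_eq_iff_eq_add] at this
      exact this
    rw [h4]
    exact B.add_mem B.one_mem h1
  obtain ⟨⟨b, hb, hbJ⟩, -⟩ := hD s hsB
  obtain ⟨t, ht, ht1⟩ := exists_one_sub_mem_of_isSimpleRing J hsimple
    (T.comap B.subtype.toAddMonoidHom) (fun a t ht => hl _ _ a.2 ht)
    (fun a t ht => hr _ _ a.2 ht) (z := ⟨b.1 * s, hb⟩) (hl _ _ b.2 hs) hbJ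
  obtain ⟨u, hu, hu1⟩ := hunit _ ht1
  have e : 1 - (1 - t : B).1 = t.1 := by
    change 1 - (1 - t.1) = t.1
    rw [sub_sub_cancel]
  rw [e] at hu1
  rw [← hu1]
  exact hl _ _ hu ht

end SimpleQuotient

/-! ### Classification of the Dubrovin valuation rings of D with center V -/

section DubrovinRings

variable {L : Type u₁} [Field L] {r : LaurentSeries L} {E : DD L}

theorem HasCenter.algebraMap_mem_iff {S : Subring (DD L)} {V : Subring (FF L)} (h : HasCenter S V)
    (c : FF L) : algebraMap (FF L) (DD L) c ∈ S ↔ c ∈ V := by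
  constructor
  · intro hc
    have h1 : algebraMap (FF L) (DD L) c ∈ (Subring.center S).map S.subtype := by
      refine ⟨⟨_, hc⟩, ?_, rfl⟩
      exact Subring.mem_center_iff.2 fun b => Subtype.ext (Algebra.commutes c b.1).symm
    rw [HasCenter] at h
    rw [h] at h1
    obtain ⟨c', hc', e⟩ := h1
    rwa [← QuaternionAlgebra.algebraMap_injective e]
  · intro hc
    have h1 : algebraMap (FF L) (DD L) c ∈ V.map (algebraMap (FF L) (DD L)) := ⟨c, hc, rfl⟩
    rw [HasCenter] at h
    rw [← h] at h1
    obtain ⟨s, -, e⟩ := h1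
    rw [← e]
    exact s.2

/-- The products pp cancel in the commutator and the rest of its p-entry is divisible by y, so `WD`
is commutative modulo positive `om`. -/
theorem om_commutator (hr : IsSqrt r) {a b : DD L} (ha : 0 ≤ om a) (hb : 0 ≤ om b) :
    1 ≤ om (a * b - b * a) := by
  rw [om_pos_iff _ hr]
  constructor
  · have a2 := ((om_nonneg_iff _ hr).1 ha).2
    have a3 := ((om_nonneg_iff _ hr.neg).1 ha).2
    have b2 := ((om_nonneg_iff _ hr).1 hb).2
    have b3 := ((om_nonneg_iff _ hr.neg).1 hb).2
    have e : pD r (a * b - b * a) = yM L * qD r a * qD (-r) b - yM L * qD r b * qD (-r) a := by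
      rw [pD_sub, pD_mul _ _ hr, pD_mul _ _ hr]; ring
    rw [e]
    exact AddValuation.map_le_sub _ (one_le_wM_yM_mul a2 b3) (one_le_wM_yM_mul b2 a3)
  · exact ((om_nonneg_iff _ hr).1 ((WD hr).sub_mem ((WD hr).mul_mem ha hb)
      ((WD hr).mul_mem hb ha))).2

theorem two_le_wF_re (hr : IsSqrt r) {u : DD L} (hu : ((4 : ℤ) : WithTop ℤ) ≤ om u) :
    ((2 : ℤ) : WithTop ℤ) ≤ wF L u.re := by
  have := (le_om_even u hr 2).1 hu
  exact ((le_wM_ev hr).1 this.1).1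

theorem vF_nonneg_of_one_le {f : FF L} (h : ((1 : ℤ) : WithTop ℤ) ≤ wF L f) : 0 ≤ vF L f :=
  (vF_pos_of_wF_pos h).le

theorem wF_yF_inv : wF L (yF L)⁻¹ = ((-1 : ℤ) : WithTop ℤ) := by
  have h := AddValuation.map_mul (wF L) (yF L) (yF L)⁻¹
  rw [mul_inv_cancel₀ yF_ne_zero, AddValuation.map_one, wF_yF] at h
  generalize wF L (yF L)⁻¹ = P at *
  induction P using WithTop.recTopCoe
  · simp at h
  · norm_cast at h ⊢
    omega

theorem yF_inv_not_nonneg : ¬ 0 ≤ vF L (yF L)⁻¹ := by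
  intro h
  have := wF_nonneg_of_vF_nonneg h
  rw [wF_yF_inv] at this
  norm_cast at this

/-- If w in B has very negative `om`, its inverse u satisfies u² = τu - n with τ, n and also τ/y,
n/y in V. Hence u = τ - nw lies in B, then so does u²/y, and multiplying by w² puts 1/y in B,
against the center being V. -/
theorem le_WD_of_hasCenter (hr : IsSqrt r) {B : Subring (DD L)}
    (hV : ∀ c, algebraMap (FF L) (DD L) c ∈ B ↔ 0 ≤ vF L c) : B ≤ WD hr := by
  intro z₀ hz₀
  by_contra hneg
  have hz0 : z₀ ≠ 0 := fun h => hneg (h ▸ (WD hr).zero_mem)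
  obtain ⟨u₀, rfl⟩ := isUnit_of_ne_zero hr hz0
  -- The fourth power gives `om u` at least 4, so trace and norm of `u` have y-value at least 2 and
  -- still have positive y-value after division by y.
  let w := u₀ ^ 4
  have hz : (w : DD L) ∈ B := by
    simp only [w, Units.val_pow_eq_pow_val]
    exact B.pow_mem hz₀ 4
  set u : DD L := ((w⁻¹ : (DD L)ˣ) : DD L) with hu
  have hou : ((4 : ℤ) : WithTop ℤ) ≤ om u := by
    obtain ⟨m, h1, h2⟩ := exists_om_unit u₀
    have hm : m < 0 := by
      by_contra hm
      refine hneg ?_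
      change 0 ≤ om (u₀ : DD L)
      rw [h1]
      exact_mod_cast not_lt.1 hm
    have e : u = ((u₀⁻¹ : (DD L)ˣ) : DD L) ^ 4 := by
      rw [hu, ← Units.val_pow_eq_pow_val, inv_pow]
    rw [e, om_pow, h2]
    have h5 : (4 : ℤ) ≤ 4 • -m := by
      rw [nsmul_eq_mul]
      push_cast
      omega
    exact_mod_cast h5
  have hre := two_le_wF_re hr hou
  have h2 : 0 ≤ wF L (2 : FF L) := by
    have := AddValuation.map_le_add (wF L) (x := 1) (y := 1) (g := 0)
      (by rw [AddValuation.map_one]) (by rw [AddValuation.map_one])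
    rwa [one_add_one_eq_two] at this
  set τ : FF L := 2 * u.re with hτ
  set n : FF L := nrd u with hn
  have hwτ : ((2 : ℤ) : WithTop ℤ) ≤ wF L τ := by
    rw [hτ, AddValuation.map_mul]
    exact hre.trans (le_add_of_nonneg_left h2)
  have hwn : ((4 : ℤ) : WithTop ℤ) ≤ wF L n := hou
  have hdiv : ∀ f : FF L, ((2 : ℤ) : WithTop ℤ) ≤ wF L f →
      0 ≤ vF L f ∧ 0 ≤ vF L ((yF L)⁻¹ * f) := by
    intro f hf
    refine ⟨vF_nonneg_of_one_le (le_trans (by norm_cast) hf), vF_nonneg_of_one_le ?_⟩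
    rw [AddValuation.map_mul, wF_yF_inv]
    refine le_trans ?_ (add_le_add le_rfl hf)
    norm_cast
  obtain ⟨t1, t2⟩ := hdiv τ hwτ
  obtain ⟨n1, n2⟩ := hdiv n (le_trans (by norm_cast) hwn)
  have huu : u * u = algebraMap (FF L) (DD L) τ * u - algebraMap (FF L) (DD L) n := by
    rw [hτ, hn, ← add_star_eq_trd, ← star_mul_eq_nrd]
    noncomm_ring
  have hzu : (w : DD L) * u = 1 := Units.mul_inv w
  have huz : u * (w : DD L) = 1 := Units.inv_mul w
  have hu1 : u = algebraMap (FF L) (DD L) τ - algebraMap (FF L) (DD L) n * w := by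
    have := congrArg (· * (w : DD L)) huu
    simp only [sub_mul, mul_assoc, huz, mul_one] at this
    exact this
  have huB : u ∈ B := by
    rw [hu1]
    exact B.sub_mem ((hV _).2 t1) (B.mul_mem ((hV _).2 n1) hz)
  have hg : algebraMap (FF L) (DD L) ((yF L)⁻¹ * τ) * u - algebraMap (FF L) (DD L) ((yF L)⁻¹ * n)
      ∈ B := B.sub_mem (B.mul_mem ((hV _).2 t2) huB) ((hV _).2 n2)
  have hge : algebraMap (FF L) (DD L) ((yF L)⁻¹ * τ) * u -
      algebraMap (FF L) (DD L) ((yF L)⁻¹ * n) =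
      algebraMap (FF L) (DD L) (yF L)⁻¹ * (u * u) := by
    rw [huu, map_mul _ _ τ, map_mul _ _ n, mul_sub, mul_assoc]
  rw [hge] at hg
  have h3 := B.mul_mem hg (B.mul_mem hz hz)
  have h4 : u * u * ((w : DD L) * w) = 1 := by
    rw [mul_assoc, ← mul_assoc u (w : DD L), huz, one_mul, huz]
  rw [mul_assoc, h4, mul_one, hV] at h3
  exact yF_inv_not_nonneg h3

/-- The elements with positive `om` are closed under multiplication by B on both sides. One of them
outside B would force 1 to be among them. -/
theorem mem_of_om_pos (hr : IsSqrt r) {B : Subring (DD L)} (hB : IsDubrovin B)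
    (hW : B ≤ WD hr) {z : DD L} (hz : 1 ≤ om z) : z ∈ B := by
  by_contra hzB
  have h1 := hB.one_mem_of_not_mem (fun _ => isUnit_of_ne_zero hr)
    { carrier := {t | 1 ≤ om t}
      add_mem' := fun ha hb => le_om_add (n := 1) hr ha hb
      zero_mem' := by
        change 1 ≤ om (0 : DD L)
        simp [om, nrd]
      neg_mem' := fun {t} ht => by
        change 1 ≤ om (-t)
        rwa [om_neg] }
    (fun a t ha ht => by
      change 1 ≤ om (a * t)
      rw [om_mul]
      exact le_trans ht (le_add_of_nonneg_left (hW ha)))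
    (fun a t ha ht => by
      change 1 ≤ om (t * a)
      rw [om_mul]
      exact le_trans ht (le_add_of_nonneg_right (hW ha)))
    (s := z) hz hzB
  change 1 ≤ om (1 : DD L) at h1
  rw [om_one] at h1
  norm_cast at h1

/-- A Dubrovin valuation ring between `{om > 0}` and `WD` is total in `WD`. -/
theorem inv_mem_of_not_mem (hr : IsSqrt r) {B : Subring (DD L)} (hB : IsDubrovin B)
    (hW : B ≤ WD hr) {u : (DD L)ˣ} (hu : 0 ≤ om (u : DD L)) (huB : (u : DD L) ∉ B) :
    ((u⁻¹ : (DD L)ˣ) : DD L) ∈ B := by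
  have hadd : ∀ {a b : DD L}, 1 ≤ om a → 1 ≤ om b → 1 ≤ om (a + b) :=
    fun ha hb => le_om_add (n := 1) hr ha hb
  -- Modulo positive `om` the multiples of u by B absorb left multiplication as well, since
  -- commutators in `WD` have positive `om`. As u is not in B, this bimodule contains 1.
  have h1 := hB.one_mem_of_not_mem (fun _ => isUnit_of_ne_zero hr)
    { carrier := {t : DD L | ∃ b ∈ B, 1 ≤ om (t - (u : DD L) * b)}
      add_mem' := by
        rintro s t ⟨b, hb, hb1⟩ ⟨c, hc, hc1⟩
        refine ⟨b + c, B.add_mem hb hc, ?_⟩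
        have := hadd hb1 hc1
        convert this using 2
        noncomm_ring
      zero_mem' := ⟨0, B.zero_mem, by simp [om, nrd]⟩
      neg_mem' := by
        rintro t ⟨b, hb, hb1⟩
        refine ⟨-b, B.neg_mem hb, ?_⟩
        have e : -t - (u : DD L) * -b = -(t - (u : DD L) * b) :=
          (congrArg (-t - ·) (mul_neg (u : DD L) b)).trans (neg_sub' _ _).symm
        rwa [e, om_neg] }
    (by
      rintro a t ha ⟨b, hb, hb1⟩
      refine ⟨a * b, B.mul_mem ha hb, ?_⟩
      have e : a * t - (u : DD L) * (a * b) =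
          a * (t - (u : DD L) * b) + (a * (u : DD L) - (u : DD L) * a) * b := by
        simp only [mul_sub, sub_mul, mul_assoc, sub_add_sub_cancel]
      rw [e]
      apply hadd
      · rw [om_mul]
        exact le_trans hb1 (le_add_of_nonneg_left (hW ha))
      · rw [om_mul]
        exact le_trans (om_commutator hr (hW ha) hu) (le_add_of_nonneg_right (hW hb)))
    (by
      rintro a t ha ⟨b, hb, hb1⟩
      refine ⟨b * a, B.mul_mem hb ha, ?_⟩
      have e : t * a - (u : DD L) * (b * a) = (t - (u : DD L) * b) * a := by
        rw [sub_mul, mul_assoc]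
      rw [e, om_mul]
      exact le_trans hb1 (le_add_of_nonneg_right (hW ha)))
    (s := u) ⟨1, B.one_mem, by simp [om, nrd]⟩ huB
  obtain ⟨b, hb, hb1⟩ := h1
  -- Here ub is congruent to 1 modulo positive `om`; so is its inverse, which therefore lies in B,
  -- and u⁻¹ = b(ub)⁻¹.
  have hq : om ((u : DD L) * b) = 0 := by
    have h2 : 0 ≤ om ((u : DD L) * b) := by
      rw [om_mul]; exact add_nonneg hu (hW hb)
    refine le_antisymm ?_ h2
    by_contra h3
    rw [not_le, ← one_le_iff_pos] at h3
    have := hadd hb1 h3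
    rw [sub_add_cancel, om_one] at this
    norm_cast at this
  have hq0 : (u : DD L) * b ≠ 0 := by
    intro h0
    rw [h0] at hq
    simp [om, nrd] at hq
  obtain ⟨q, hqe⟩ := isUnit_of_ne_zero hr hq0
  have hqi : om ((q⁻¹ : (DD L)ˣ) : DD L) = 0 := by
    have := om_unit q
    rwa [hqe, hq, zero_add] at this
  have h4 : 1 ≤ om (((q⁻¹ : (DD L)ˣ) : DD L) - 1) := by
    have e : ((q⁻¹ : (DD L)ˣ) : DD L) - 1 = (q⁻¹ : (DD L)ˣ) * (1 - u * b) := by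
      rw [← hqe, mul_sub, mul_one, Units.inv_mul]
    rw [e, om_mul, hqi, zero_add]
    exact hb1
  have h5 : ((q⁻¹ : (DD L)ˣ) : DD L) ∈ B :=
    mem_of_om_sub (fun z hz => mem_of_om_pos hr hB hW hz) h4 B.one_mem
  have h6 : ((u⁻¹ : (DD L)ˣ) : DD L) = b * (q⁻¹ : (DD L)ˣ) := by
    rw [Units.inv_eq_of_mul_eq_one_right]
    rw [← mul_assoc, ← hqe, Units.mul_inv]
  rw [h6]
  exact B.mul_mem hb h5

/-- If E were not in B, its inverse would be, hence also E* = -xE⁻¹ and E = 2 - E*; so E and E* lie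
in B. Now B contains E*E⁻¹ or its inverse. Adding 1 and dividing by 2 gives the inverse of E or of
E*, and `eq_BD_of` applies for the corresponding root. -/
theorem eq_BD_of_isDubrovin (h : IsSplit r E) (hL : (2 : L) ≠ 0) {B : Subring (DD L)}
    (hB : IsDubrovin B) (hV : ∀ c, algebraMap (FF L) (DD L) c ∈ B ↔ 0 ≤ vF L c) :
    B = BD h.sqrt ∨ B = BD h.sqrt.neg := by
  have hW := le_WD_of_hasCenter h.sqrt hV
  have hP : ∀ z, 1 ≤ om z → z ∈ B := fun z hz => mem_of_om_pos h.sqrt hB hW hz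
  have hne : E ≠ 0 := by
    intro h0
    have := om_E h
    rw [h0] at this
    simp [om, nrd] at this
  obtain ⟨u, hu⟩ := isUnit_of_ne_zero h.sqrt hne
  obtain ⟨w, hw⟩ := isUnit_of_ne_zero h.sqrt (star_ne_zero.2 hne)
  have hou : om (u : DD L) = 0 := by rw [hu, om_E h]
  have how : om (w : DD L) = 0 := by rw [hw, om_star, om_E h]
  have hx : 0 ≤ vF L (-xF L) := by
    rw [AddValuation.map_neg, vF_xF]
    exact WithTop.coe_le_coe.2 X1_pos.le
  have h2 : (2 : DD L) ∈ B := by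
    rw [← one_add_one_eq_two]
    exact B.add_mem B.one_mem B.one_mem
  have hE : E ∈ B := by
    by_contra hcon
    have h3 := inv_mem_of_not_mem h.sqrt hB hW hou.ge (by rwa [hu])
    apply hcon
    have h4 : star E = (u⁻¹ : (DD L)ˣ) * algebraMap (FF L) (DD L) (-xF L) := by
      rw [← h.mul_star, ← hu, Units.inv_mul_cancel_left]
    have h5 : E = 2 - star E := by rw [← h.add_star, add_sub_cancel_right]
    rw [h5, h4]
    exact B.sub_mem h2 (B.mul_mem h3 ((hV _).2 hx))
  have hE' : star E ∈ B := by
    have h5 : star E = 2 - E := by rw [← h.add_star, add_sub_cancel_left]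
    rw [h5]
    exact B.sub_mem h2 hE
  have hhalf : algebraMap (FF L) (DD L) (HahnSeries.C (RatFunc.C (2⁻¹ : L))) ∈ B :=
    (hV _).2 (vF_C_C_nonneg _).1
  have hhalf2 : algebraMap (FF L) (DD L) (HahnSeries.C (RatFunc.C (2⁻¹ : L))) * 2 = 1 := by
    have e : (2 : DD L) = algebraMap (FF L) (DD L) (HahnSeries.C (RatFunc.C (2 : L))) := by
      rw [map_ofNat, map_ofNat, map_ofNat]
    rw [e, ← map_mul, ← map_mul, ← map_mul, inv_mul_cancel₀ hL, map_one, map_one, map_one]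
  have key : ∀ {a b : (DD L)ˣ}, (a : DD L) + b = 2 → (b : DD L) * (a⁻¹ : (DD L)ˣ) ∈ B →
      ((a⁻¹ : (DD L)ˣ) : DD L) ∈ B := by
    intro a b hab hmem
    have h6 := B.mul_mem hhalf (B.add_mem B.one_mem hmem)
    have e : 1 + (b : DD L) * (a⁻¹ : (DD L)ˣ) = 2 * (a⁻¹ : (DD L)ˣ) := by
      rw [← hab, add_mul, Units.mul_inv]
    rwa [e, ← mul_assoc, hhalf2, one_mul] at h6
  by_cases hf : ((w * u⁻¹ : (DD L)ˣ) : DD L) ∈ B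
  · left
    exact eq_BD_of h hP hV hE hE' (key (by rw [hu, hw, h.add_star]) hf)
      (by rw [← hu, Units.mul_inv])
  · right
    have hof : 0 ≤ om ((w * u⁻¹ : (DD L)ˣ) : DD L) := by
      have := om_unit u
      rw [hou, zero_add] at this
      rw [Units.val_mul, om_mul, how, this, add_zero]
    have h7 := inv_mem_of_not_mem h.sqrt hB hW hof hf
    rw [mul_inv_rev, inv_inv] at h7
    exact eq_BD_of h.symm hP hV hE' (by rwa [star_star])
      (key (by rw [hu, hw, add_comm, h.add_star]) h7) (by rw [← hw, Units.mul_inv])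

end DubrovinRings

/-! ### Jacobson radicals of total valuation rings and their traces -/

section TotalRings

variable {A : Type*} [Ring A]

theorem IsTotalValuationRing.mono {S T : Subring A} (h : IsTotalValuationRing S) (hST : S ≤ T) :
    IsTotalValuationRing T := fun d => (h d).imp (fun hd => hST hd) (fun hd => hST hd)

variable [Nontrivial A]

/-- The Jacobson radical of a total valuation ring of a division ring consists of the nonunits. -/
theorem mem_jacobson_iff_of_isTotal (hA : ∀ a : A, a ≠ 0 → IsUnit a) {S : Subring A}
    (hS : IsTotalValuationRing S) (x : S) : x ∈ Ring.jacobson S ↔ ∀ s : S, s * x ≠ 1 := by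
  rw [← Ideal.jacobson_bot, Ideal.mem_jacobson_iff]
  constructor
  · intro h s hs
    obtain ⟨z, hz⟩ := h (-s)
    rw [Ideal.mem_bot, mul_assoc, neg_mul, hs, mul_neg, mul_one, neg_add_cancel, zero_sub,
      neg_eq_zero] at hz
    exact one_ne_zero hz
  · intro h y
    suffices ∃ z : S, z.1 * (y.1 * x.1 + 1) = 1 by
      obtain ⟨z, hz⟩ := this
      refine ⟨z, ?_⟩
      rw [Ideal.mem_bot, sub_eq_zero]
      apply Subtype.ext
      change z.1 * y.1 * x.1 + z.1 = 1
      rw [← hz, mul_add, mul_one, mul_assoc]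
    by_cases hc : y.1 * x.1 = 0
    · exact ⟨1, by rw [hc, zero_add]; exact mul_one _⟩
    have hu : y.1 * x.1 + 1 ≠ 0 := by
      intro h0
      refine h (-y) (Subtype.ext ?_)
      change -y.1 * x.1 = 1
      rw [neg_mul, eq_neg_of_add_eq_zero_left h0, neg_neg]
    obtain ⟨c, hc⟩ := hA _ hc
    obtain ⟨u, hu⟩ := hA _ hu
    rw [← hu]
    suffices ((u⁻¹ : Aˣ) : A) ∈ S from ⟨⟨_, this⟩, Units.inv_mul u⟩
    -- Here u = c + 1. If cu⁻¹ is in S, then so is u⁻¹ = 1 - cu⁻¹. Otherwise uc⁻¹ = 1 + c⁻¹ is in S,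
    -- and c⁻¹y would be a left inverse of x in S.
    rcases hS (c * u⁻¹) with h1 | h1
    · have e : ((u⁻¹ : Aˣ) : A) = 1 - ((c * u⁻¹ : Aˣ) : A) := by
        rw [eq_sub_iff_add_eq, Units.val_mul, ← Units.mul_inv u, hc, hu, add_mul, one_mul,
          add_comm]
      rw [e]
      exact S.sub_mem S.one_mem h1
    · rw [mul_inv_rev, inv_inv, Units.val_mul, hu, ← hc, add_mul, one_mul, Units.mul_inv] at h1
      have h2 : ((c⁻¹ : Aˣ) : A) ∈ S := by
        have := S.sub_mem h1 S.one_mem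
        rwa [add_sub_cancel_left] at this
      refine absurd (Subtype.ext ?_) (h (⟨_, h2⟩ * y))
      change (c⁻¹ : Aˣ) * y.1 * x.1 = 1
      rw [mul_assoc, ← hc, Units.inv_mul]

variable {R S T : Subring A}

theorem mem_radicalTrace_iff (hA : ∀ a : A, a ≠ 0 → IsUnit a) (hRS : R ≤ S)
    (hS : IsTotalValuationRing S) (x : R) : x ∈ radicalTrace R S ↔ ∀ s ∈ S, s * x.1 ≠ 1 := by
  constructor
  · rintro ⟨h, hx⟩ s hs e
    exact (mem_jacobson_iff_of_isTotal hA hS _).1 hx ⟨s, hs⟩ (Subtype.ext e)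
  · intro h
    refine ⟨hRS x.2, (mem_jacobson_iff_of_isTotal hA hS _).2 fun s hs => h s.1 s.2 ?_⟩
    exact congrArg Subtype.val hs

/-- The trace is even completely prime: if a and b have left inverses in S, so does ab. Only the
multiplier 1 is needed to test primeness. -/
theorem radicalTrace_mem_primeIdeals (hA : ∀ a : A, a ≠ 0 → IsUnit a) (hRS : R ≤ S)
    (hS : IsTotalValuationRing S) : radicalTrace R S ∈ primeIdeals R := by
  have hmem : ∀ x : R, x ∈ (Ring.jacobson S).comap (Subring.inclusion hRS) ↔
      ∀ s ∈ S, s * x.1 ≠ 1 := fun x => by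
    rw [← mem_radicalTrace_iff hA hRS hS]
    exact ⟨fun h => ⟨hRS x.2, h⟩, fun ⟨_, h⟩ => h⟩
  refine ⟨(Ring.jacobson S).comap (Subring.inclusion hRS), inferInstance, ?_, ?_, ?_⟩
  · rw [Ideal.ne_top_iff_one, hmem]
    intro h
    exact h 1 S.one_mem (mul_one 1)
  · intro a b h
    by_contra! hcon
    rw [hmem, hmem] at hcon
    push Not at hcon
    obtain ⟨⟨s, hs, hs1⟩, t, ht, ht1⟩ := hcon
    refine (hmem _).1 (h 1) (t * s) (S.mul_mem ht hs) ?_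
    change t * s * (a.1 * 1 * b.1) = 1
    rw [mul_one, mul_assoc, ← mul_assoc s, hs1, one_mul, ht1]
  · ext x
    rw [SetLike.mem_coe, hmem, mem_radicalTrace_iff hA hRS hS]

theorem radicalTrace_anti (hA : ∀ a : A, a ≠ 0 → IsUnit a) (hRS : R ≤ S)
    (hS : IsTotalValuationRing S) (hST : S ≤ T) : radicalTrace R T ≤ radicalTrace R S := by
  intro x hx
  rw [mem_radicalTrace_iff hA (hRS.trans hST) (hS.mono hST)] at hx
  rw [mem_radicalTrace_iff hA hRS hS]
  exact fun s hs => hx s (hST hs)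

end TotalRings

/-! ### Nonunits of the overrings, and elements of prime ideals of the intersection -/

section Traces

variable {L : Type u₁} [Field L] {r : LaurentSeries L} {E : DD L}

theorem om_zero : om (0 : DD L) = ⊤ := by simp [om, nrd]

theorem nonunit_BD_iff (hr : IsSqrt r) {z : DD L} (hz : z ∈ BD hr) :
    (∀ s ∈ BD hr, s * z ≠ 1) ↔ 0 < vM L (pD r z) := by
  constructor
  · intro h
    by_contra hcon
    have h0 : vM L (pD r z) = 0 := le_antisymm (not_lt.1 hcon) hz.2
    have h1 : om z = 0 := om_eq_zero_of_vM hr hz.1 (wM_eq_zero_of_vM_eq_zero h0)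
    have hz0 : z ≠ 0 := by
      rintro rfl
      rw [om_zero] at h1
      exact absurd h1 (by simp)
    obtain ⟨u, rfl⟩ := isUnit_of_ne_zero hr hz0
    exact h _ (inv_mem_BD hr h1 h0) (Units.inv_mul u)
  · intro h s hs e
    obtain ⟨u, rfl⟩ := isUnit_of_ne_zero hr (right_ne_zero_of_mul_eq_one e)
    rw [← Units.inv_eq_of_mul_eq_one_left e] at hs
    have h1 : om (u : DD L) = 0 := by
      refine le_antisymm ?_ hz.1
      rw [← om_unit u]
      exact le_add_of_nonneg_right hs.1
    have h2 := vM_pD_unit hr h1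
    exact (add_pos_of_pos_of_nonneg h hs.2).ne' h2

theorem nonunit_WD_iff (hr : IsSqrt r) {z : DD L} (hz : z ∈ WD hr) :
    (∀ s ∈ WD hr, s * z ≠ 1) ↔ 1 ≤ om z := by
  rw [one_le_iff_pos]
  constructor
  · intro h
    by_contra hcon
    have h1 : om z = 0 := le_antisymm (not_lt.1 hcon) hz
    have hz0 : z ≠ 0 := by
      rintro rfl
      rw [om_zero] at h1
      exact absurd h1 (by simp)
    obtain ⟨u, rfl⟩ := isUnit_of_ne_zero hr hz0
    have h2 := om_unit u
    rw [h1, zero_add] at h2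
    exact h _ h2.ge (Units.inv_mul u)
  · intro h s hs e
    have h2 := om_mul s z
    rw [e, om_one] at h2
    exact (h.trans_le (le_add_of_nonneg_left hs)).ne h2

theorem nonunit_top_iff (hr : IsSqrt r) {z : DD L} :
    (∀ s ∈ (⊤ : Subring (DD L)), s * z ≠ 1) ↔ z = 0 := by
  constructor
  · intro h
    by_contra hz
    obtain ⟨u, rfl⟩ := isUnit_of_ne_zero hr hz
    exact h _ trivial (Units.inv_mul u)
  · rintro rfl s - e
    rw [mul_zero] at e
    exact zero_ne_one e

theorem om_jD : om (jD L) = 1 := by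
  have : nrd (jD L) = -yF L := by simp [nrd, jD]
  rw [om, this, AddValuation.map_neg, wF_yF]
  rfl

theorem jD_mem_BD (hr : IsSqrt r) : jD L ∈ BD hr := mem_BD_of_om_pos hr om_jD.ge

/-- The intersection of the two rings `BD`. -/
theorem inf_BD_symm (h : IsSplit r E) :
    BD h.symm.sqrt ⊓ BD h.symm.sqrt.neg = BD h.sqrt ⊓ BD h.sqrt.neg := by
  ext z
  simp only [Subring.mem_inf, mem_BD, neg_neg]
  tauto

variable {M : AddSubgroup (DD L)} {R : Subring (DD L)}

theorem mem_of_pow_mem {P : FF L → Prop} (hmul : ∀ c d, P (c * d) → 0 ≤ vF L c → 0 ≤ vF L d →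
    P c ∨ P d) (h1 : ¬ P 1) {c : FF L} (hc : 0 ≤ vF L c) (n : ℕ) (h : P (c ^ n)) : P c := by
  induction n with
  | zero => rw [pow_zero] at h; exact absurd h h1
  | succ n ih =>
    rw [pow_succ] at h
    refine (hmul _ _ h ?_ hc).elim ih id
    rw [AddValuation.map_pow]
    exact nsmul_nonneg hc n

theorem star_mem_inf (h : IsSplit r E) {z : DD L} (hz : z ∈ BD h.sqrt ⊓ BD h.sqrt.neg) :
    star z ∈ BD h.sqrt ⊓ BD h.sqrt.neg := by
  simp only [Subring.mem_inf, mem_BD, om_star, pD_star, neg_neg] at hz ⊢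
  tauto

theorem algebraMap_mem_inf (h : IsSplit r E) {c : FF L} :
    algebraMap (FF L) (DD L) c ∈ BD h.sqrt ⊓ BD h.sqrt.neg ↔ 0 ≤ vF L c := by
  rw [Subring.mem_inf, algebraMap_mem_BD, algebraMap_mem_BD, and_self_iff]

theorem mem_inf_of_om_pos (h : IsSplit r E) {z : DD L} (hz : 1 ≤ om z) :
    z ∈ BD h.sqrt ⊓ BD h.sqrt.neg := ⟨mem_BD_of_om_pos _ hz, mem_BD_of_om_pos _ hz⟩

/-- A nonzero prime ideal contains all elements of positive `y`-adic value. -/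
theorem mem_prime_of_om_pos (h : IsSplit r E)
    (hr : ∀ a t, a ∈ BD h.sqrt ⊓ BD h.sqrt.neg → t ∈ M → t * a ∈ M)
    (hp : ∀ a b, a ∈ BD h.sqrt ⊓ BD h.sqrt.neg → b ∈ BD h.sqrt ⊓ BD h.sqrt.neg →
      (∀ r ∈ BD h.sqrt ⊓ BD h.sqrt.neg, a * r * b ∈ M) → a ∈ M ∨ b ∈ M)
    {f : DD L} (hf : f ∈ M) (hf0 : f ≠ 0) (hfR : f ∈ BD h.sqrt ⊓ BD h.sqrt.neg)
    {z : DD L} (hz : 1 ≤ om z) : z ∈ M := by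
  obtain ⟨u, rfl⟩ := isUnit_of_ne_zero h.sqrt hf0
  obtain ⟨m, h1, h2⟩ := exists_om_unit u
  -- If `om a` exceeds `om u` then a = u(u⁻¹a) lies in M. If it is only at least n, every product a
  -- s a has at least 2n, so primeness halves the required bound; repetition brings it down to 1.
  have key : ∀ (k : ℕ) (n : ℤ), 1 ≤ n → m + 1 ≤ 2 ^ k * n →
      ∀ a : DD L, ((n : ℤ) : WithTop ℤ) ≤ om a → a ∈ M := by
    intro k
    induction k with
    | zero =>
      intro n hn hk a ha
      have h3 : (1 : WithTop ℤ) ≤ om (((u⁻¹ : (DD L)ˣ) : DD L) * a) := by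
        rw [om_mul, h2]
        refine le_trans ?_ (add_le_add le_rfl ha)
        have : (1 : ℤ) ≤ -m + n := by omega
        exact_mod_cast this
      have h4 := hr _ _ (mem_inf_of_om_pos h h3) hf
      rwa [Units.mul_inv_cancel_left] at h4
    | succ k ih =>
      intro n hn hk a ha
      have haR : a ∈ BD h.sqrt ⊓ BD h.sqrt.neg :=
        mem_inf_of_om_pos h (le_trans (by exact_mod_cast hn) ha)
      refine (hp a a haR haR fun s hs => ?_).elim id id
      refine ih (n + n) (by omega) (by rw [pow_succ] at hk; linarith) _ ?_
      rw [om_mul, om_mul, WithTop.coe_add]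
      refine add_le_add (le_trans ha (le_add_of_nonneg_right hs.1.1)) ha
  have h0 : 0 ≤ m := by
    have := hfR.1.1
    rw [h1] at this
    exact_mod_cast this
  refine key (m + 1).natAbs 1 le_rfl ?_ z hz
  rw [mul_one]
  have h5 : ((m + 1).natAbs : ℤ) < 2 ^ (m + 1).natAbs := by exact_mod_cast Nat.lt_two_pow_self
  omega

/-- Modulo M an element z of the ring is c₁E with c₁ in V. As E + E* = 2 is a unit, E is not in M;
as x is in M, c₁E is in M exactly when v(c₁) is positive. The value of p(z) is positive under the
same condition, because p(E) has value 0. -/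
theorem prime_eq_of_star_mem (h : IsSplit r E) (hL : (2 : L) ≠ 0)
    (hl : ∀ a t, a ∈ BD h.sqrt ⊓ BD h.sqrt.neg → t ∈ M → a * t ∈ M)
    (hc : ∀ (c : FF L) b, 0 ≤ vF L c → b ∈ BD h.sqrt ⊓ BD h.sqrt.neg →
      algebraMap (FF L) (DD L) c * b ∈ M → algebraMap (FF L) (DD L) c ∈ M ∨ b ∈ M)
    (h1 : (1 : DD L) ∉ M) (hP : ∀ z, 1 ≤ om z → z ∈ M)
    (hx : algebraMap (FF L) (DD L) (xF L) ∈ M) (hE : star E ∈ M) {z : DD L}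
    (hz : z ∈ BD h.sqrt ⊓ BD h.sqrt.neg) : z ∈ M ↔ 0 < vM L (pD r z) := by
  have hunit : ∀ c : FF L, vF L c = 0 → algebraMap (FF L) (DD L) c ∉ M := by
    intro c hc0 hcM
    have hcne : c ≠ 0 := by
      rintro rfl
      rw [AddValuation.map_zero] at hc0
      exact absurd hc0 (by simp)
    have h2 : 0 ≤ vF L c⁻¹ := by
      have := AddValuation.map_mul (vF L) c c⁻¹
      rw [mul_inv_cancel₀ hcne, AddValuation.map_one, hc0, zero_add] at this
      exact this.le
    have h3 := hl _ _ ((algebraMap_mem_inf h).2 h2) hcM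
    rw [← map_mul, inv_mul_cancel₀ hcne, map_one] at h3
    exact h1 h3
  have hEM : E ∉ M := by
    intro hE1
    have h2 := M.add_mem hE1 hE
    rw [h.add_star] at h2
    have h3 := hl _ _ ((algebraMap_mem_inf h).2 (vF_C_C_nonneg (2⁻¹ : L)).1) h2
    have e : (2 : DD L) = algebraMap (FF L) (DD L) (HahnSeries.C (RatFunc.C (2 : L))) := by
      rw [map_ofNat, map_ofNat, map_ofNat]
    rw [e, ← map_mul, ← map_mul, ← map_mul, inv_mul_cancel₀ hL, map_one, map_one, map_one] at h3
    exact h1 h3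
  have hER : E ∈ BD h.sqrt ⊓ BD h.sqrt.neg := E_mem_BD h
  obtain ⟨c₁, c₂, h2, h3, h4⟩ := exists_comb_of_mem h hz.1 hz.2
  have h5 : algebraMap (FF L) (DD L) c₂ * star E ∈ M := hl _ _ ((algebraMap_mem_inf h).2 h3) hE
  have h6 : z ∈ M ↔ algebraMap (FF L) (DD L) c₁ * E ∈ M := by
    have e : z = (z - (algebraMap (FF L) (DD L) c₁ * E + algebraMap (FF L) (DD L) c₂ * star E)) +
      algebraMap (FF L) (DD L) c₂ * star E + algebraMap (FF L) (DD L) c₁ * E := by abel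
    rw [e]
    exact AddSubgroup.add_mem_cancel_left _ (M.add_mem (hP _ h4) h5)
  have h7 : 0 < vM L (pD r z - mapF L c₁ * pD r E) := by
    have e : pD r z - mapF L c₁ * pD r E = pD r (z - (algebraMap (FF L) (DD L) c₁ * E +
        algebraMap (FF L) (DD L) c₂ * star E)) + mapF L c₂ * pD (-r) E := by
      rw [pD_sub, pD_add, pD_algebraMap_mul, pD_algebraMap_mul, pD_star]
      ring
    rw [e]
    refine AddValuation.map_lt_add _ (vM_pos_of_wM_pos ((om_pos_iff _ h.sqrt).1 h4).1) ?_
    rw [AddValuation.map_mul, vM_mapF, h.val']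
    exact (WithTop.coe_lt_coe.2 X1_pos).trans_le (le_add_of_nonneg_left h3)
  have h8 : 0 < vM L (pD r z) ↔ 0 < vF L c₁ := by
    have e1 : vM L (mapF L c₁ * pD r E) = vF L c₁ := by
      rw [AddValuation.map_mul, vM_mapF, h.val, add_zero]
    rw [← e1]
    constructor
    · intro h9
      have := AddValuation.map_lt_add _ h9 (h7.trans_eq (AddValuation.map_neg _ _).symm)
      rwa [← sub_eq_add_neg, sub_sub_cancel] at this
    · intro h9
      have := AddValuation.map_lt_add _ h7 h9
      rwa [sub_add_cancel] at this
  rw [h6, h8]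
  constructor
  · intro h9
    by_contra h10
    exact (hc _ _ h2 hER h9).elim (hunit c₁ (le_antisymm (not_lt.1 h10) h2)) hEM
  · intro h9
    rw [← vM_mapF] at h9
    have h10 := le_vM_of_pos h9
    rw [vM_mapF] at h10
    have h11 : 0 ≤ vF L ((xF L)⁻¹ * c₁) := by
      rw [AddValuation.map_mul, vF_xF_inv]
      calc (0 : WithTop GG) = ((-X1 : GG) : WithTop GG) + ((X1 : GG) : WithTop GG) := by
            rw [← WithTop.coe_add, neg_add_cancel]; rfl
        _ ≤ _ := add_le_add le_rfl h10
    have h12 := hl _ _ (mul_mem ((algebraMap_mem_inf h).2 h11) hER) hx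
    rwa [mul_assoc, ← Algebra.commutes, ← mul_assoc, ← map_mul,
      mul_right_comm, inv_mul_cancel₀ xF_ne_zero, one_mul] at h12

end Traces

/-! ### Prime ideals of the intersection and the Intersection Property -/

section Intersection

variable {L : Type u₁} [Field L] {r : LaurentSeries L} {E : DD L} {M : AddSubgroup (DD L)}

/-- The norm of g lies in M and in V and has y-value 0, so it is a unit of V times a power of x. -/
theorem xF_pow_mem (h : IsSplit r E)
    (hl : ∀ a t, a ∈ BD h.sqrt ⊓ BD h.sqrt.neg → t ∈ M → a * t ∈ M)
    {g : DD L} (hg : g ∈ M) (hgR : g ∈ BD h.sqrt ⊓ BD h.sqrt.neg) (h0 : om g = 0) :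
    ∃ l : ℕ, algebraMap (FF L) (DD L) (xF L ^ l) ∈ M := by
  have h1 := hl _ _ (star_mem_inf h hgR) hg
  have h2 := (BD h.sqrt ⊓ BD h.sqrt.neg).mul_mem (star_mem_inf h hgR) hgR
  rw [star_mul_eq_nrd] at h1 h2
  rw [algebraMap_mem_inf h] at h2
  have hn : nrd g ≠ 0 := by
    intro hn
    rw [om, hn, AddValuation.map_zero] at h0
    exact absurd h0 (by simp)
  obtain ⟨l, m, h3, h4⟩ := exists_vM_eq ((map_ne_zero (mapF L)).2 hn)
  rw [vM_mapF] at h3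
  rw [wM_mapF] at h4
  have hm : m = 0 := by
    rw [om, h4] at h0
    exact_mod_cast h0
  subst hm
  have hl0 : 0 ≤ l := by
    rw [h3, ← WithTop.coe_zero, WithTop.coe_le_coe, ← gg_zero, gg_le_gg] at h2
    rcases h2 with h2 | h2
    · simp at h2
    · exact_mod_cast h2.2
  lift l to ℕ using hl0
  refine ⟨l, ?_⟩
  have h5 := vF_xF_zpow_mul_yF_zpow (L := L) l 0
  rw [zpow_natCast, zpow_zero, mul_one, ← h3] at h5
  have h6 : vF L ((nrd g)⁻¹ * xF L ^ l) = 0 := by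
    have := AddValuation.map_mul (vF L) (nrd g)⁻¹ (nrd g)
    rw [inv_mul_cancel₀ hn, AddValuation.map_one] at this
    rw [AddValuation.map_mul, h5, this]
  have h7 := hl _ _ ((algebraMap_mem_inf h).2 h6.ge) h1
  rwa [← map_mul, mul_right_comm, inv_mul_cancel₀ hn, one_mul] at h7

/-- A nonzero prime contains all elements of positive `om`. If it contains more, it contains a power
of x, hence x, hence E or E*, since EE* = -x. Each of the two choices leaves only one prime. -/
theorem prime_cases (h : IsSplit r E) (hL : (2 : L) ≠ 0)
    (hMR : ∀ z ∈ M, z ∈ BD h.sqrt ⊓ BD h.sqrt.neg)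
    (hl : ∀ a t, a ∈ BD h.sqrt ⊓ BD h.sqrt.neg → t ∈ M → a * t ∈ M)
    (hr : ∀ a t, a ∈ BD h.sqrt ⊓ BD h.sqrt.neg → t ∈ M → t * a ∈ M)
    (hp : ∀ a b, a ∈ BD h.sqrt ⊓ BD h.sqrt.neg → b ∈ BD h.sqrt ⊓ BD h.sqrt.neg →
      (∀ r ∈ BD h.sqrt ⊓ BD h.sqrt.neg, a * r * b ∈ M) → a ∈ M ∨ b ∈ M)
    (h1 : (1 : DD L) ∉ M) :
    (∀ z ∈ BD h.sqrt ⊓ BD h.sqrt.neg, z ∈ M ↔ 0 < vM L (pD r z)) ∨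
    (∀ z ∈ BD h.sqrt ⊓ BD h.sqrt.neg, z ∈ M ↔ 0 < vM L (pD (-r) z)) ∨
    (∀ z, z ∈ M ↔ 1 ≤ om z) ∨ (∀ z, z ∈ M ↔ z = 0) := by
  by_cases h0 : ∀ f ∈ M, f = 0
  · exact Or.inr (Or.inr (Or.inr fun z => ⟨h0 z, fun hz => hz ▸ M.zero_mem⟩))
  push Not at h0
  obtain ⟨f, hf, hf0⟩ := h0
  have hP : ∀ z, 1 ≤ om z → z ∈ M := fun z hz =>
    mem_prime_of_om_pos h hr hp hf hf0 (hMR f hf) hz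
  by_cases h2 : ∀ g ∈ M, 1 ≤ om g
  · exact Or.inr (Or.inr (Or.inl fun z => ⟨h2 z, hP z⟩))
  push Not at h2
  obtain ⟨g, hg, hg0⟩ := h2
  have hgR := hMR g hg
  rw [← not_le, one_le_iff_pos, not_lt] at hg0
  obtain ⟨l, hxl⟩ := xF_pow_mem h hl hg hgR (le_antisymm hg0 hgR.1.1)
  have hc : ∀ (c : FF L) b, 0 ≤ vF L c → b ∈ BD h.sqrt ⊓ BD h.sqrt.neg →
      algebraMap (FF L) (DD L) c * b ∈ M → algebraMap (FF L) (DD L) c ∈ M ∨ b ∈ M := by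
    intro c b hc hb hcb
    refine hp _ _ ((algebraMap_mem_inf h).2 hc) hb fun s hs => ?_
    rw [Algebra.commutes, mul_assoc]
    exact hl _ _ hs hcb
  have hxV : 0 ≤ vF L (xF L) := by
    rw [vF_xF]
    exact WithTop.coe_le_coe.2 X1_pos.le
  have hx : algebraMap (FF L) (DD L) (xF L) ∈ M := by
    refine mem_of_pow_mem (P := fun c => algebraMap (FF L) (DD L) c ∈ M) ?_ ?_ hxV l hxl
    · intro c d hcd hc0 hd0
      rw [map_mul] at hcd
      exact hc c _ hc0 ((algebraMap_mem_inf h).2 hd0) hcd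
    · rwa [map_one]
  have hER : E ∈ BD h.sqrt ⊓ BD h.sqrt.neg := E_mem_BD h
  -- Modulo positive `om` the middle factor is a combination of E and E*, which commute; so E s E*
  -- is congruent to a multiple of EE* = -x.
  have hE : E ∈ M ∨ star E ∈ M := by
    refine hp _ _ hER (star_mem_inf h hER) fun s hs => ?_
    obtain ⟨c₁, c₂, h3, h4, h5⟩ := exists_comb_of_mem h hs.1 hs.2
    have hcomm : star E * E = E * star E := by rw [star_mul_eq_nrd, mul_star_eq_nrd]
    have e : E * s * star E = E * (s - (algebraMap (FF L) (DD L) c₁ * E +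
        algebraMap (FF L) (DD L) c₂ * star E)) * star E +
        E * (algebraMap (FF L) (DD L) c₁ * E + algebraMap (FF L) (DD L) c₂ * star E) * star E := by
      rw [← add_mul, ← mul_add, sub_add_cancel]
    have e2 : E * (algebraMap (FF L) (DD L) c₁ * E + algebraMap (FF L) (DD L) c₂ * star E) *
        star E = (algebraMap (FF L) (DD L) c₁ * E + algebraMap (FF L) (DD L) c₂ * star E) *
        -algebraMap (FF L) (DD L) (xF L) := by
      rw [← map_neg, ← h.mul_star, ← mul_assoc]
      congr 1
      rw [mul_add, add_mul, ← mul_assoc, ← mul_assoc, ← Algebra.commutes, ← Algebra.commutes,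
        mul_assoc, mul_assoc, mul_assoc, hcomm]
    have hs' : algebraMap (FF L) (DD L) c₁ * E + algebraMap (FF L) (DD L) c₂ * star E ∈
        BD h.sqrt ⊓ BD h.sqrt.neg :=
      add_mem (mul_mem ((algebraMap_mem_inf h).2 h3) hER)
        (mul_mem ((algebraMap_mem_inf h).2 h4) (star_mem_inf h hER))
    rw [e, e2]
    exact M.add_mem (hr _ _ (star_mem_inf h hER) (hl _ _ hER (hP _ h5)))
      (hl _ _ hs' (M.neg_mem hx))
  rcases hE with hE | hE
  · right; left
    intro z hz
    rw [← inf_BD_symm h] at hz hl hc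
    exact prime_eq_of_star_mem h.symm hL hl hc h1 hP hx (by rwa [star_star]) hz
  · left
    intro z hz
    exact prime_eq_of_star_mem h hL hl hc h1 hP hx hE hz

/-- Viewing a prime ideal of R inside the ambient ring removes the subtype and allows rewriting R by
equal subrings. -/
theorem exists_addSubgroup_of_ideal {A : Type*} [Ring A] {R : Subring A} (I : Ideal R)
    [I.IsTwoSided] (hp : ∀ a b, (∀ r, a * r * b ∈ I) → a ∈ I ∨ b ∈ I) :
    ∃ M : AddSubgroup A, (∀ z : R, z ∈ I ↔ z.1 ∈ M) ∧ (∀ z ∈ M, z ∈ R) ∧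
      (∀ a t, a ∈ R → t ∈ M → a * t ∈ M) ∧ (∀ a t, a ∈ R → t ∈ M → t * a ∈ M) ∧
      (∀ a b, a ∈ R → b ∈ R → (∀ r ∈ R, a * r * b ∈ M) → a ∈ M ∨ b ∈ M) := by
  let M : AddSubgroup A := I.toAddSubgroup.map R.subtype.toAddMonoidHom
  have hM : ∀ z : R, z ∈ I ↔ z.1 ∈ M := fun z => by
    constructor
    · exact fun hz => ⟨z, hz, rfl⟩
    · rintro ⟨w, hw, e⟩
      rwa [← Subtype.ext (a1 := w) (a2 := z) e]
  refine ⟨M, hM, ?_, ?_, ?_, ?_⟩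
  · rintro _ ⟨w, -, rfl⟩
    exact w.2
  · rintro a _ ha ⟨w, hw, rfl⟩
    exact ⟨⟨a, ha⟩ * w, I.mul_mem_left _ hw, rfl⟩
  · rintro a _ ha ⟨w, hw, rfl⟩
    exact ⟨w * ⟨a, ha⟩, I.mul_mem_right _ hw, rfl⟩
  · intro a b ha hb hab
    have := hp ⟨a, ha⟩ ⟨b, hb⟩ fun s => (hM _).2 (hab s.1 s.2)
    rwa [hM, hM] at this

theorem prime_ideal_cases (h : IsSplit r E) (hL : (2 : L) ≠ 0) {R : Subring (DD L)}
    (hR : R = BD h.sqrt ⊓ BD h.sqrt.neg) (I : Ideal R) [I.IsTwoSided] (hne : I ≠ ⊤)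
    (hp : ∀ a b, (∀ r, a * r * b ∈ I) → a ∈ I ∨ b ∈ I) :
    (∀ z, z ∈ I ↔ 0 < vM L (pD r z.1)) ∨ (∀ z, z ∈ I ↔ 0 < vM L (pD (-r) z.1)) ∨
    (∀ z, z ∈ I ↔ 1 ≤ om z.1) ∨ (∀ z, z ∈ I ↔ z.1 = 0) := by
  obtain ⟨M, hM, hMR, hl, hr, hp'⟩ := exists_addSubgroup_of_ideal I hp
  have h1 : (1 : DD L) ∉ M := fun h1 => (Ideal.ne_top_iff_one I).1 hne ((hM 1).2 h1)
  have hz : ∀ z : R, z.1 ∈ BD h.sqrt ⊓ BD h.sqrt.neg := fun z => hR ▸ z.2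
  rw [hR] at hMR hl hr hp'
  simp only [hM]
  exact (prime_cases h hL hMR hl hr hp' h1).imp (fun h2 z => h2 z.1 (hz z))
    (Or.imp (fun h2 z => h2 z.1 (hz z)) (Or.imp (fun h2 z => h2 z.1) (fun h2 z => h2 z.1)))

theorem overring_inf (hr : IsSqrt r) {S : Subring (DD L)} :
    (∃ i, ![BD hr, BD hr.neg] i ≤ S) ↔
      S = BD hr ∨ S = BD hr.neg ∨ S = WD hr ∨ S = ⊤ := by
  rw [Fin.exists_fin_two]
  constructor
  · rintro (h | h)
    · have := overring_BD hr h
      tauto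
    · have := overring_BD hr.neg h
      exact Or.inr this
  · rintro (rfl | rfl | rfl | rfl)
    · exact Or.inl le_rfl
    · exact Or.inr le_rfl
    · exact Or.inl (BD_le_WD hr)
    · exact Or.inl le_top

theorem iInf_BD (hr : IsSqrt r) : ⨅ i, ![BD hr, BD hr.neg] i = BD hr ⊓ BD hr.neg := by
  ext z
  rw [Subring.mem_iInf, Fin.forall_fin_two, Subring.mem_inf]
  rfl

theorem intersectionProperty_BD (h : IsSplit r E) (hL : (2 : L) ≠ 0) :
    IntersectionProperty ![BD h.sqrt, BD h.sqrt.neg] := by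
  have hA : ∀ a : DD L, a ≠ 0 → IsUnit a := fun a => isUnit_of_ne_zero h.sqrt
  unfold IntersectionProperty
  rw [iInf_BD]
  simp only [overring_inf]
  set R := BD h.sqrt ⊓ BD h.sqrt.neg with hR
  have hle : ∀ S : Subring (DD L), (S = BD h.sqrt ∨ S = BD h.sqrt.neg ∨ S = WD h.sqrt ∨ S = ⊤) →
      R ≤ S ∧ IsTotalValuationRing S := by
    rintro S (rfl | rfl | rfl | rfl)
    · exact ⟨inf_le_left, isTotal_BD _⟩
    · exact ⟨inf_le_right, isTotal_BD _⟩
    · exact ⟨inf_le_left.trans (BD_le_WD _), isTotal_WD _⟩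
    · exact ⟨le_top, fun _ => Or.inl trivial⟩
  have t1 : ∀ z : R, z ∈ radicalTrace R (BD h.sqrt) ↔ 0 < vM L (pD r z.1) := fun z => by
    rw [mem_radicalTrace_iff hA inf_le_left (isTotal_BD _), nonunit_BD_iff h.sqrt z.2.1]
  have t2 : ∀ z : R, z ∈ radicalTrace R (BD h.sqrt.neg) ↔ 0 < vM L (pD (-r) z.1) := fun z => by
    rw [mem_radicalTrace_iff hA inf_le_right (isTotal_BD _), nonunit_BD_iff h.sqrt.neg z.2.2]
  have t3 : ∀ z : R, z ∈ radicalTrace R (WD h.sqrt) ↔ 1 ≤ om z.1 := fun z => by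
    rw [mem_radicalTrace_iff hA (inf_le_left.trans (BD_le_WD _)) (isTotal_WD _),
      nonunit_WD_iff h.sqrt z.2.1.1]
  have t4 : ∀ z : R, z ∈ radicalTrace R ⊤ ↔ z.1 = 0 := fun z => by
    rw [mem_radicalTrace_iff hA le_top fun _ => Or.inl trivial, nonunit_top_iff h.sqrt]
  have hE : E ∈ R := E_mem_BD h
  have hE' : star E ∈ R := star_mem_inf h hE
  have hj : jD L ∈ R := ⟨jD_mem_BD _, jD_mem_BD _⟩
  clear_value R
  refine ⟨⟨?_, ?_, ?_⟩, ?_⟩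
  · intro S hS
    exact radicalTrace_mem_primeIdeals hA (hle S hS).1 (hle S hS).2
  -- Three test elements separate the four overrings: E* lies only in the trace of `BD` for r, E
  -- only in that for -r, and j is missing only from the trace of D itself.
  · have hpos : (0 : WithTop GG) < ((X1 : GG) : WithTop GG) := WithTop.coe_lt_coe.2 X1_pos
    have h1 : ¬ (1 : WithTop ℤ) ≤ 0 := by norm_cast
    have hE0 : E ≠ 0 := by
      intro h0
      have := om_E h
      rw [h0, om_zero] at this
      exact absurd this (by simp)
    have hj0 : jD L ≠ 0 := by
      intro h0
      have := om_jD (L := L)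
      rw [h0, om_zero] at this
      exact absurd this (by simp)
    have m1 : (⟨star E, hE'⟩ : R) ∈ radicalTrace R (BD h.sqrt) := by
      rw [t1, pD_star, h.val']; exact hpos
    have m2 : (⟨E, hE⟩ : R) ∈ radicalTrace R (BD h.sqrt.neg) := by
      rw [t2, h.val']; exact hpos
    have m4 : (⟨jD L, hj⟩ : R) ∉ radicalTrace R ⊤ := by rwa [t4]
    have u1 : ∀ S : Subring (DD L), (S = BD h.sqrt ∨ S = BD h.sqrt.neg ∨ S = WD h.sqrt ∨ S = ⊤) →
        (⟨star E, hE'⟩ : R) ∈ radicalTrace R S → S = BD h.sqrt := by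
      rintro S (rfl | rfl | rfl | rfl) hS
      · rfl
      · rw [t2, pD_star, neg_neg, h.val] at hS
        exact absurd hS (lt_irrefl _)
      · rw [t3, om_star, om_E h] at hS
        exact absurd hS h1
      · rw [t4] at hS
        exact absurd (star_eq_zero.1 hS) hE0
    have u2 : ∀ S : Subring (DD L), (S = BD h.sqrt ∨ S = BD h.sqrt.neg ∨ S = WD h.sqrt ∨ S = ⊤) →
        (⟨E, hE⟩ : R) ∈ radicalTrace R S → S = BD h.sqrt.neg := by
      rintro S (rfl | rfl | rfl | rfl) hS
      · rw [t1, h.val] at hS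
        exact absurd hS (lt_irrefl _)
      · rfl
      · rw [t3, om_E h] at hS
        exact absurd hS h1
      · rw [t4] at hS
        exact absurd hS hE0
    have u4 : ∀ S : Subring (DD L), (S = BD h.sqrt ∨ S = BD h.sqrt.neg ∨ S = WD h.sqrt ∨ S = ⊤) →
        (⟨jD L, hj⟩ : R) ∉ radicalTrace R S → S = ⊤ := by
      rintro S (rfl | rfl | rfl | rfl) hS
      · rw [t1, pD_jD, AddValuation.map_zero] at hS
        exact absurd (WithTop.coe_lt_top _) hS
      · rw [t2, pD_jD, AddValuation.map_zero] at hS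
        exact absurd (WithTop.coe_lt_top _) hS
      · rw [t3] at hS
        exact absurd om_jD.ge hS
      · rfl
    intro S hS T hT hST
    have hS' := hS
    rcases hS' with e | e | e | e
    · exact e.trans (u1 T hT (hST ▸ e ▸ m1)).symm
    · exact e.trans (u2 T hT (hST ▸ e ▸ m2)).symm
    · have hT' := hT
      rcases hT' with e' | e' | e' | e'
      · exact (u1 S hS (by rw [hST, e']; exact m1)).trans e'.symm
      · exact (u2 S hS (by rw [hST, e']; exact m2)).trans e'.symm
      · exact e.trans e'.symm
      · exact (u4 S hS (by rw [hST, e']; exact m4)).trans e'.symm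
    · exact e.trans (u4 T hT (hST ▸ e ▸ m4)).symm
  · rintro _ ⟨I, hI, hne, hprime, rfl⟩
    have hcases := prime_ideal_cases h hL hR I hne hprime
    rcases hcases with h2 | h2 | h2 | h2
    · refine ⟨BD h.sqrt, Or.inl rfl, ?_⟩
      ext z
      rw [t1, SetLike.mem_coe, h2]
    · refine ⟨BD h.sqrt.neg, Or.inr (Or.inl rfl), ?_⟩
      ext z
      rw [t2, SetLike.mem_coe, h2]
    · refine ⟨WD h.sqrt, Or.inr (Or.inr (Or.inl rfl)), ?_⟩
      ext z
      rw [t3, SetLike.mem_coe, h2]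
    · refine ⟨⊤, Or.inr (Or.inr (Or.inr rfl)), ?_⟩
      ext z
      rw [t4, SetLike.mem_coe, h2]
  · intro S hS T hT hST
    exact radicalTrace_anti hA (hle S hS).1 (hle S hS).2 hST

end Intersection

/-! ### Integrality, the Gräter ring and the extension number -/

section ExtensionNumber

variable {L : Type u₁} [Field L] {r : LaurentSeries L} {E : DD L}

/-- The intersection is stable under conjugation, so it contains the trace and norm of each of its
elements, and these are the coefficients of a monic quadratic equation. -/
theorem isIntegralOverCenter_inf (h : IsSplit r E) :
    IsIntegralOverCenter (BD h.sqrt ⊓ BD h.sqrt.neg) := by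
  have hstar : ∀ z ∈ BD h.sqrt ⊓ BD h.sqrt.neg, star z ∈ BD h.sqrt ⊓ BD h.sqrt.neg :=
    fun z hz => star_mem_inf h hz
  generalize BD h.sqrt ⊓ BD h.sqrt.neg = R at *
  have hc : ∀ (c : FF L) (hc : algebraMap (FF L) (DD L) c ∈ R),
      (⟨_, hc⟩ : R) ∈ Subring.center R := fun c hc =>
    Subring.mem_center_iff.2 fun b => Subtype.ext (Algebra.commutes c b.1).symm
  intro z
  have h1 : algebraMap (FF L) (DD L) (2 * z.1.re) ∈ R := by
    rw [← add_star_eq_trd]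
    exact R.add_mem z.2 (hstar _ z.2)
  have h2 : algebraMap (FF L) (DD L) (nrd z.1) ∈ R := by
    rw [← star_mul_eq_nrd]
    exact R.mul_mem (hstar _ z.2) z.2
  refine ⟨Polynomial.X ^ 2 + (Polynomial.C (-⟨_, hc _ h1⟩) * Polynomial.X +
    Polynomial.C ⟨_, hc _ h2⟩), Polynomial.monic_X_pow_add Polynomial.degree_linear_lt, ?_⟩
  rw [Polynomial.eval₂_add, Polynomial.eval₂_add, Polynomial.eval₂_X_pow, Polynomial.eval₂_mul_X,
    Polynomial.eval₂_C, Polynomial.eval₂_C]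
  apply Subtype.ext
  change z.1 ^ 2 + (-algebraMap (FF L) (DD L) (2 * z.1.re) * z.1 +
    algebraMap (FF L) (DD L) (nrd z.1)) = 0
  have key : ∀ {A : Type u₁} [Ring A] (a b : A), a ^ 2 + (-(a + b) * a + b * a) = 0 := by
    intro A _ a b
    noncomm_ring
  rw [← add_star_eq_trd, ← star_mul_eq_nrd]
  exact key z.1 (star z.1)

/-- An element of `BD r` on which the conjugate valuation is negative. -/
theorem exists_mem_BD_neg (h : IsSplit r E) : ∃ z ∈ BD h.sqrt, (∀ t, qD t z = 0) ∧
    vM L (pD (-r) z) = ((-X1 : GG) : WithTop GG) := by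
  refine ⟨algebraMap (FF L) (DD L) (xF L)⁻¹ * star E, ⟨?_, ?_⟩, fun t => ?_, ?_⟩
  · rw [om_algebraMap_mul, wF_xF_inv, om_star, om_E h]
    simp
  · rw [pD_algebraMap_mul, pD_star, AddValuation.map_mul, vM_mapF, vF_xF_inv, h.val',
      ← WithTop.coe_add, neg_add_cancel]
    exact le_rfl
  · rw [← Algebra.smul_def, qD_smul, qD_star, h.qD_eq, neg_zero, mul_zero]
  · rw [pD_algebraMap_mul, pD_star, neg_neg, AddValuation.map_mul, vM_mapF, vF_xF_inv, h.val,
      add_zero]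

theorem BD_not_le (h : IsSplit r E) : ¬ BD h.sqrt ≤ BD h.sqrt.neg := by
  obtain ⟨z, hz, -, h1⟩ := exists_mem_BD_neg h
  intro h2
  have := (h2 hz).2
  rw [h1] at this
  exact absurd (WithTop.coe_le_coe.1 this) (not_le.2 (neg_lt_zero.2 X1_pos))

theorem BD_ne_BD_neg (h : IsSplit r E) : BD h.sqrt ≠ BD h.sqrt.neg := fun e =>
  BD_not_le h e.le

theorem vM_C_sqrt (hr : IsSqrt r) : vM L (HahnSeries.C r) = 0 := by
  have h1 : vF L (1 + xF L) = 0 := by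
    rw [AddValuation.map_add_eq_of_lt_left, AddValuation.map_one]
    rw [AddValuation.map_one, vF_xF]
    exact WithTop.coe_lt_coe.2 X1_pos
  rw [← vM_mapF, mapF_one_add_xF hr, AddValuation.map_mul] at h1
  have h2 : 0 ≤ vM L (HahnSeries.C r) := by
    by_contra hneg
    rw [not_le] at hneg
    exact ((add_le_add le_rfl hneg.le).trans_lt ((add_zero _).trans_lt hneg)).ne h1
  exact le_antisymm ((le_add_of_nonneg_right h2).trans h1.le) h2

theorem iD_mem_BD (hr : IsSqrt r) : iD L ∈ BD hr := by
  refine ⟨(om_nonneg_iff_coords _ hr).2 ?_, ?_⟩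
  · simp [iD]
  · have e : pD r (iD L) = HahnSeries.C r := by simp [pD, ev, iD]
    rw [e, vM_C_sqrt hr]

theorem hasCenter_BD (hr : IsSqrt r) (hL : (2 : L) ≠ 0) : HasCenter (BD hr) (valRing (vF L)) :=
  hasCenter_of hL (iD_mem_BD hr) (jD_mem_BD hr) fun _ => algebraMap_mem_BD hr

theorem hasCenter_inf (h : IsSplit r E) (hL : (2 : L) ≠ 0) :
    HasCenter (BD h.sqrt ⊓ BD h.sqrt.neg) (valRing (vF L)) :=
  hasCenter_of hL ⟨iD_mem_BD _, iD_mem_BD _⟩ ⟨jD_mem_BD _, jD_mem_BD _⟩ fun _ =>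
    algebraMap_mem_inf h

/-- The element E*/x of the ring has conjugate entry p' of negative value. Since its q vanishes, p'
is multiplicative on its powers, and in a monic equation over V the leading term would be the only
one of least value. -/
theorem not_isIntegralOverCenter_BD (h : IsSplit r E) (hL : (2 : L) ≠ 0) :
    ¬ IsIntegralOverCenter (BD h.sqrt) := by
  intro hint
  obtain ⟨z, hz, hq, hv⟩ := exists_mem_BD_neg h
  obtain ⟨p, hp, he⟩ := hint ⟨z, hz⟩
  have hcoeff : ∀ a : Subring.center (BD h.sqrt), ∃ c, 0 ≤ vF L c ∧
      a.1.1 = algebraMap (FF L) (DD L) c := by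
    intro a
    have h1 : a.1.1 ∈ (Subring.center (BD h.sqrt)).map (BD h.sqrt).subtype := ⟨a.1, a.2, rfl⟩
    have h2 : HasCenter (BD h.sqrt) (valRing (vF L)) := hasCenter_BD h.sqrt hL
    rw [HasCenter] at h2
    rw [h2] at h1
    obtain ⟨c, hc, e⟩ := h1
    exact ⟨c, hc, e.symm⟩
  choose c hc hce using hcoeff
  rw [Polynomial.eval₂_eq_sum_range] at he
  have h3 : ∀ n : ℕ, pD (-r) (algebraMap (FF L) (DD L) (c (p.coeff n)) * z ^ n) =
      mapF L (c (p.coeff n)) * pD (-r) z ^ n := fun n => by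
    rw [pD_mul_pow h.sqrt.neg hq, pD_algebraMap]
  have h4 : ∑ n ∈ Finset.range (p.natDegree + 1), mapF L (c (p.coeff n)) * pD (-r) z ^ n = 0 := by
    have h5 := congrArg (fun a : BD h.sqrt => pD (-r) a.1) he
    simp only [AddSubmonoidClass.coe_finsetSum] at h5
    let φ : DD L →+ MM L := ⟨⟨pD (-r), pD_zero⟩, fun a b => pD_add a b⟩
    have h6 := map_sum φ (fun n => algebraMap (FF L) (DD L) (c (p.coeff n)) * z ^ n)
      (Finset.range (p.natDegree + 1))
    change pD (-r) _ = ∑ n ∈ _, pD (-r) _ at h6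
    simp only [h3] at h6
    rw [← h6]
    simp only [← hce]
    exact h5.trans pD_zero
  have hpow : ∀ n : ℕ, vM L (pD (-r) z ^ n) = ((-(n • X1) : GG) : WithTop GG) := fun n => by
    rw [AddValuation.map_pow, hv, ← WithTop.coe_nsmul]
    exact congrArg _ (neg_nsmul X1 n)
  have hlead : c (p.coeff p.natDegree) = 1 := by
    apply QuaternionAlgebra.algebraMap_injective (c₁ := 1 + xF L) (c₂ := 0) (c₃ := yF L)
    rw [← hce, hp.coeff_natDegree, map_one]
    rfl
  rw [Finset.sum_range_succ, hlead, map_one, one_mul] at h4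
  have h7 : ((-(p.natDegree • X1) : GG) : WithTop GG) <
      vM L (∑ n ∈ Finset.range p.natDegree, mapF L (c (p.coeff n)) * pD (-r) z ^ n) := by
    refine AddValuation.map_lt_sum _ (WithTop.coe_ne_top) fun n hn => ?_
    rw [AddValuation.map_mul, hpow, vM_mapF]
    refine lt_of_lt_of_le ?_ (le_add_of_nonneg_left (hc _))
    rw [WithTop.coe_lt_coe, neg_lt_neg_iff]
    exact nsmul_lt_nsmul_left X1_pos (Finset.mem_range.1 hn)
  rw [eq_neg_of_add_eq_zero_left h4, AddValuation.map_neg, hpow] at h7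
  exact lt_irrefl _ h7

theorem isGraterFamily_BD (h : IsSplit r E) (hL : (2 : L) ≠ 0) :
    IsGraterFamily ![BD h.sqrt, BD h.sqrt.neg] where
  isDubrovin := by
    rw [Fin.forall_fin_two]
    exact ⟨isDubrovin_BD h.sqrt, isDubrovin_BD h.sqrt.neg⟩
  incomparable := by
    have h2 : ¬ BD h.sqrt.neg ≤ BD h.sqrt := by
      have := BD_not_le h.symm
      simp only [neg_neg] at this
      exact this
    simp only [Fin.forall_fin_two]
    refine ⟨⟨fun h0 => absurd rfl h0, fun _ => BD_not_le h⟩, fun _ => h2, fun h0 => absurd rfl h0⟩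
  intersectionProperty := intersectionProperty_BD h hL
  isIntegral := by
    rw [iInf_BD]
    exact isIntegralOverCenter_inf h

theorem extensionNumber_eq_two (h : IsSplit r E) (hL : (2 : L) ≠ 0) :
    extensionNumber (valRing (vF L)) (DD L) = 2 := by
  have hmem : 2 ∈ {n | ∃ B : Fin n → Subring (DD L), IsGraterFamily B ∧
      HasCenter (⨅ i, B i) (valRing (vF L))} :=
    ⟨![BD h.sqrt, BD h.sqrt.neg], isGraterFamily_BD h hL, by
      rw [iInf_BD]; exact hasCenter_inf h hL⟩
  refine le_antisymm (Nat.sInf_le hmem) (le_csInf ⟨2, hmem⟩ ?_)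
  rintro n ⟨B, hB, hcen⟩
  by_contra hn
  have hn' : n = 0 ∨ n = 1 := by omega
  rcases hn' with rfl | rfl
  -- An empty family has intersection D, which contains the scalar 1/y.
  · rw [iInf_of_empty] at hcen
    exact yF_inv_not_nonneg ((hcen.algebraMap_mem_iff (yF L)⁻¹).1 (Subring.mem_top _))
  · have e : ⨅ i, B i = B 0 := by
      ext z
      rw [Subring.mem_iInf]
      exact ⟨fun hz => hz 0, fun hz i => by rwa [Subsingleton.elim i 0]⟩
    have hint := hB.isIntegral
    rw [e] at hint hcen
    rcases eq_BD_of_isDubrovin h hL (hB.isDubrovin 0) hcen.algebraMap_mem_iff with h1 | h1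
    · rw [h1] at hint
      exact not_isIntegralOverCenter_BD h hL hint
    · rw [h1] at hint
      exact not_isIntegralOverCenter_BD h.symm hL hint

end ExtensionNumber

/-! ### The extension of v to K, and the gauge ring in coordinates -/

section Coordinates

variable {L : Type u₁} [Field L] {r : LaurentSeries L} {E : DD L}

/-- The embedding of `K = F(t)` into `L((x))((y))` that maps `t` to `r`. -/
noncomputable def evHom (hr : IsSqrt r) : KK L →+* MM L where
  toFun a := ev r a.re a.im
  map_one' := by
    change ev r 1 0 = 1
    simp [ev]
  map_zero' := by simp [ev]
  map_add' a b := by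
    simp only [ev, QuadraticAlgebra.re_add, QuadraticAlgebra.im_add, map_add]
    ring
  map_mul' a b := by
    simp only [ev, QuadraticAlgebra.re_mul, QuadraticAlgebra.im_mul, map_add, map_mul, map_zero,
      zero_mul]
    linear_combination (mapF L a.im * mapF L b.im) *
      ((map_add (mapF L) 1 (xF L)).symm.trans (mapF_one_add_xF hr))

/-- The extension of `v` to `K` that is induced by the embedding `evHom`. -/
noncomputable def vK (hr : IsSqrt r) : AddValuation (KK L) (WithTop GG) :=
  (vM L).comap (evHom hr)

theorem vK_apply (hr : IsSqrt r) (a : KK L) : vK hr a = vM L (evHom hr a) := rfl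

theorem evHom_mk (hr : IsSqrt r) (a b : FF L) : evHom hr ⟨a, b⟩ = ev r a b := rfl

theorem evHom_algebraMap (hr : IsSqrt r) (c : FF L) :
    evHom hr (algebraMap (FF L) (KK L) c) = mapF L c := by
  rw [QuadraticAlgebra.algebraMap_eq, evHom_mk, ev, map_zero, mul_zero, add_zero]

theorem alphaFun_vK (hr : IsSqrt r) (γ : ℚ) (z : DD L) :
    alphaFun (vK hr) γ z = alphaFn r (gg γ (1 / 2)) z := by
  have e : ∀ a b : FF L, ev r a (-b) = ev (-r) a b := fun a b => by
    rw [ev, ev, map_neg, map_neg]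
    ring
  simp only [alphaFun, alphaFn, vK_apply, map_mul, evHom_algebraMap, evHom_mk, e]
  rfl

theorem vK_pos (h : IsSplit r (1 + iD L)) : 0 < vK h.sqrt (⟨0, 1⟩ - 1) := by
  have e : evHom h.sqrt (⟨0, 1⟩ - 1) = -pD (-r) (1 + iD L) := by
    rw [map_sub, map_one, evHom_mk, pD_add, pD_one]
    simp [pD, ev, iD, sub_eq_add_neg]
  rw [vK_apply, e, AddValuation.map_neg, h.val']
  exact WithTop.coe_lt_coe.2 X1_pos

/-- The coordinates a and br are half the sum and half the difference of p and p'; both 2 and r have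
value 0, so bounds on p and p' amount to bounds on a and b. -/
theorem mem_inf_BD_iff (h : IsSplit r E) (hL : (2 : L) ≠ 0) (z : DD L) :
    z ∈ BD h.sqrt ⊓ BD h.sqrt.neg ↔ 0 ≤ vF L z.re ∧ 0 ≤ vF L z.imI ∧
      0 ≤ wF L z.imJ ∧ 0 ≤ wF L z.imK := by
  have hC := vM_C_sqrt h.sqrt
  have hhalf : ∀ f g : MM L, 2 * f = g → 0 ≤ vM L g → 0 ≤ vM L f := by
    rintro f _ rfl hg
    have e : f = HahnSeries.C (HahnSeries.C (2⁻¹ : L)) * (2 * f) := by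
      have e2 : (2 : MM L) = HahnSeries.C (HahnSeries.C (2 : L)) := by
        rw [map_ofNat, map_ofNat]
      rw [e2, ← mul_assoc, ← map_mul, ← map_mul, inv_mul_cancel₀ hL, map_one, map_one, one_mul]
    rw [e, AddValuation.map_mul]
    exact add_nonneg (vM_C_C_nonneg _) hg
  have key : 0 ≤ vM L (pD r z) ∧ 0 ≤ vM L (pD (-r) z) ↔ 0 ≤ vF L z.re ∧ 0 ≤ vF L z.imI := by
    constructor
    · rintro ⟨h1, h2⟩
      constructor
      · rw [← vM_mapF]
        refine hhalf _ _ ?_ (AddValuation.map_le_add _ h1 h2)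
        simp only [pD, ev, map_neg]
        ring
      · have h3 : 0 ≤ vM L (HahnSeries.C r * mapF L z.imI) := by
          refine hhalf _ _ ?_ (AddValuation.map_le_sub _ h1 h2)
          simp only [pD, ev, map_neg]
          ring
        rwa [AddValuation.map_mul, hC, zero_add, vM_mapF] at h3
    · rintro ⟨h1, h2⟩
      rw [← vM_mapF] at h1 h2
      have h3 : ∀ s : LaurentSeries L, vM L (HahnSeries.C s) = 0 → 0 ≤ vM L (pD s z) := by
        intro s hs
        refine AddValuation.map_le_add _ h1 ?_
        rwa [AddValuation.map_mul, hs, zero_add]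
      exact ⟨h3 r hC, h3 (-r) (vM_C_sqrt h.sqrt.neg)⟩
  rw [Subring.mem_inf, mem_BD, mem_BD, om_nonneg_iff_coords z h.sqrt, ← and_assoc (a := 0 ≤ vF L _),
    ← key]
  constructor
  · rintro ⟨⟨⟨h1, h2⟩, h3⟩, -, h4⟩
    exact ⟨⟨h3, h4⟩, h2⟩
  · rintro ⟨h1, h2⟩
    have h3 := key.1 h1
    have h4 := And.intro (And.intro (wF_nonneg_of_vF_nonneg h3.1) (wF_nonneg_of_vF_nonneg h3.2)) h2
    exact ⟨⟨h4, h1.1⟩, h4, h1.2⟩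

end Coordinates

theorem mainTheorem11 {L : Type u₁} [Field L] (hL : ringChar L ≠ 2) :
    (∀ z : DD L, z ≠ 0 → IsUnit z) ∧
    (∃ v' : AddValuation (KK L) (WithTop GG),
      (∀ c : FF L, v' (algebraMap (FF L) (KK L) c) = vF L c) ∧
      0 < v' (⟨0, 1⟩ - 1) ∧
      ∃ (α : {γ : ℚ // 0 < γ ∧ γ < 1 / 2} → SurmultValueFunction (vF L) (DD L))
        (B₁ B₂ : Subring (DD L)),
        (∀ γ z, α γ z = alphaFun v' γ.1 z) ∧
        (∀ γ, (α γ).IsMinimalGauge) ∧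
        (∀ γ, (α γ).omega = 2) ∧
        extensionNumber (valRing (vF L)) (DD L) = 2 ∧
        (∀ γ, (α γ).valueSet = {g | ∃ l m : ℤ, g = gg l m ∨ g = gg γ.1 (1 / 2) + gg l m ∨
          g = -gg γ.1 (1 / 2) + gg l m}) ∧
        (∀ γ γ', γ ≠ γ' → ¬ (α γ).IsIsomorphic (α γ')) ∧
        B₁ ≠ B₂ ∧ IsTotalValuationRing B₁ ∧ IsTotalValuationRing B₂ ∧
        {B : Subring (DD L) | IsDubrovin B ∧ HasCenter B (valRing (vF L))} = {B₁, B₂} ∧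
        (∀ γ, (α γ).gaugeRing = B₁ ⊓ B₂) ∧
        (∀ z : DD L, z ∈ B₁ ⊓ B₂ ↔ 0 ≤ vF L z.re ∧ 0 ≤ vF L z.imI ∧
          0 ≤ HahnSeries.addVal ℤ (RatFunc L) z.imJ ∧
          0 ≤ HahnSeries.addVal ℤ (RatFunc L) z.imK)) ∧
    (∀ (Γ : Type u₄) (E : Type u₂) (A : Type u₃) [AddCommGroup Γ] [LinearOrder Γ]
      [IsOrderedAddMonoid Γ] [Field E] [Ring A] [Algebra E A] [FiniteDimensional E A]
      [Algebra.IsCentral E A] [IsSimpleRing A] (v : AddValuation E (WithTop Γ))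
      (α β : SurmultValueFunction v A), α.IsMorandi → β.IsMorandi →
      α.gaugeRing = β.gaugeRing → ∀ z, α z = β z) := by
  have h2 : (2 : L) ≠ 0 := Ring.two_ne_zero hL
  obtain ⟨r, h⟩ := exists_isSplit h2
  refine ⟨fun z => isUnit_of_ne_zero h.sqrt, ⟨vK h.sqrt, ?_, vK_pos h,
    fun γ => alphaS h.sqrt (gg γ.1 (1 / 2)), BD h.sqrt, BD h.sqrt.neg, ?_, ?_, ?_, ?_, ?_, ?_,
    BD_ne_BD_neg h, isTotal_BD _, isTotal_BD _, ?_, ?_, ?_⟩, ?_⟩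
  · intro c
    rw [vK_apply, evHom_algebraMap, vM_mapF]
  · intro γ z
    rw [alphaS_apply, alphaFun_vK]
  · intro γ
    exact ⟨isGauge_alphaS h γ.2.1 γ.2.2, by rw [omega_alphaS h, extensionNumber_eq_two h h2]⟩
  · exact fun γ => omega_alphaS h γ.1
  · exact extensionNumber_eq_two h h2
  · exact fun γ => valueSet_alphaS h γ.2.1 γ.2.2
  · intro γ γ' hne
    exact not_isIsomorphic_alphaS h γ.2.1 γ.2.2 γ'.2.1 γ'.2.2 fun e => hne (Subtype.ext e)
  · ext B
    constructor
    · rintro ⟨hB, hcen⟩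
      exact eq_BD_of_isDubrovin h h2 hB hcen.algebraMap_mem_iff
    · rintro (rfl | rfl)
      · exact ⟨isDubrovin_BD _, hasCenter_BD _ h2⟩
      · exact ⟨isDubrovin_BD _, hasCenter_BD _ h2⟩
  · exact fun γ => gaugeRing_alphaS h.sqrt γ.1
  · exact mem_inf_BD_iff h h2
  · intro Γ E A _ _ _ _ _ _ _ _ _ v α β hα hβ hR z
    exact SurmultValueFunction.eq_of_isMorandi hα hβ hR z
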